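/- **Conventions.** All manifolds are smooth, Hausdorff and connected; $(M,g)$ is a pseudo-Riemannian manifold of dimension $n$ with contravariant metric $G=g^{-1}$. $S^2(M)$ is the space of smooth symmetric contravariant $2$-tensor fields; $K\in S^2(M)$ also denotes the endomorphism of $TM$ (and of $T^*M$) obtained by lowering an index with $g$. $K$ is a *Killing tensor* if its Schouten bracket with the metric vanishes, $[K,G]=0$. It is a *characteristic Killing tensor* (ChKT) if moreover at each point it has $n$ distinct real eigenvalues and around each point there are local coordinates whose coordinate vector fields are eigenvector fields of $K$. A *Killing–Stäckel space* (KS-space) associated with a ChKT $K$ is an $n$-dimensional real vector space of Killing tensors on $M$ that are diagonalized by the eigenspaces of $K$ (every eigenvector of $K$ is an eigenvector of each of them). A non-degenerate distribution $D$ is *Killing* if it is spherical, i.e. there is a section $H$ of $D^\perp$ with $(\nabla_XY)^{D^\perp}=\langle X,Y\rangle H$ and $(\nabla_XH)^{D^\perp}=0$ for all sections $X,Y$ of $D$, and if $D^\perp$ is geodesic, i.e. $(\nabla_XY)^{D}=0$ for all sections $X,Y$ of $D^\perp$. **Proposition (the Killing–Stäckel space of a reducible separable web).** Let $K$ be a ChKT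 on $M$ with associated KS-space $\mathcal K$, and let $D$ be a $K$-invariant Killing distribution on $M$. Let $B\times_\rho F$, with $\dim F>0$ and $\rho:B\to\mathbb R^+$ smooth, be a local warped product adapted to $(D^\perp,D)$; that is, $(B,g_B)$ and $(F,g_F)$ are pseudo-Riemannian manifolds, and $B\times F$ is identified by a diffeomorphism with an open subset $U\subseteq M$ such that $g|_U=g_B+\rho^2g_F$ (equivalently $G|_U=G_B+\rho^{-2}G_F$), the slices $B\times\{y\}$ are integral manifolds of $D^\perp$ and the slices $\{x\}\times F$ are integral manifolds of $D$. Then there are KS-spaces $\mathcal K_B$ on $B$ and $\mathcal K_F$ on $F$ (each associated with some ChKT of $B$, respectively $F$, and so of dimension $\dim B$, respectively $\dim F$) such that a contravariant $2$-tensor field $L$ on $U$ belongs to $\mathcal K|_U$ if and only if there exist $L_B\in\mathcal K_B$, $L_F\in\mathcal K_F$ and a smooth function $l$ on $B$ with $$L=L_B+l\,G_F+L_F,\qquad dl=L_B\,d\rho^{-2},$$ where tensors and functions on $B$ and $F$ are lifted to $B\times F=U$. -/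

import Mathlib

open scoped Manifold ContDiff

noncomputable section

namespace KillingStackel

/-- The tangent space at a point of an `n`-dimensional manifold. -/
abbrev Tan (n : ℕ) {M : Type*} [TopologicalSpace M] [ChartedSpace (EuclideanSpace ℝ (Fin n)) M]
    (x : M) : Type :=
  TangentSpace (𝓡 n) x

/-- The cotangent space at a point of an `n`-dimensional manifold. -/
abbrev Cotan (n : ℕ) {M : Type*} [TopologicalSpace M]
    [ChartedSpace (EuclideanSpace ℝ (Fin n)) M] (x : M) : Type :=
  Tan n x →L[ℝ] ℝ

/-- A field of contravariant 2-tensors, not necessarily smooth or symmetric. The tensor `K` at `x`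
is given as the linear map `α ↦ K(·, α)` from `T*ₓM` to `TₓM`, so that `K(α, β) = α (K x β)`. -/
abbrev ContraField (n : ℕ) (M : Type*) [TopologicalSpace M]
    [ChartedSpace (EuclideanSpace ℝ (Fin n)) M] : Type _ :=
  ∀ x : M, Cotan n x →ₗ[ℝ] Tan n x

section Manifold

variable {n : ℕ} {M : Type*} [TopologicalSpace M] [ChartedSpace (EuclideanSpace ℝ (Fin n)) M]

/-- A smooth real-valued function on an `n`-dimensional manifold. -/
def SmoothFn (n : ℕ) {M : Type*} [TopologicalSpace M]
    [ChartedSpace (EuclideanSpace ℝ (Fin n)) M] (f : M → ℝ) : Prop :=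
  ContMDiff (𝓡 n) 𝓘(ℝ, ℝ) ∞ f

/-- The function `K(df, dh)`. -/
def ContraField.pair (K : ContraField n M) (f h : M → ℝ) (x : M) : ℝ :=
  mvfderiv (𝓡 n) f x (K x (mvfderiv (𝓡 n) h x))

/-- The space `S²(M)` of smooth symmetric contravariant 2-tensor fields. Smoothness means that
`K(df, dh)` is smooth for all smooth functions `f`, `h`. -/
def SymTensor (n : ℕ) (M : Type*) [TopologicalSpace M]
    [ChartedSpace (EuclideanSpace ℝ (Fin n)) M] : Submodule ℝ (ContraField n M) where
  carrier := {K | (∀ (x : M) (α β : Cotan n x), α (K x β) = β (K x α)) ∧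
    ∀ f h : M → ℝ, SmoothFn n f → SmoothFn n h → SmoothFn n (K.pair f h)}
  add_mem' := by
    rintro K L ⟨hK, hK'⟩ ⟨hL, hL'⟩
    refine ⟨fun x α β => by simp [hK x α β, hL x α β], fun f h hf hh => ?_⟩
    have : ContraField.pair (K + L) f h = fun x => K.pair f h x + L.pair f h x := by
      funext x; simp [ContraField.pair]
    rw [this]
    exact ContMDiff.add (hK' f h hf hh) (hL' f h hf hh)
  zero_mem' := by
    refine ⟨fun x α β => by simp, fun f h _ _ => ?_⟩
    have : ContraField.pair (0 : ContraField n M) f h = fun _ => (0 : ℝ) := by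
      funext x; simp [ContraField.pair]
    rw [this]
    exact contMDiff_const
  smul_mem' := by
    rintro c K ⟨hK, hK'⟩
    refine ⟨fun x α β => by simp [hK x α β], fun f h hf hh => ?_⟩
    have : ContraField.pair (c • K) f h = fun x => c * K.pair f h x := by
      funext x; simp [ContraField.pair]
    rw [this]
    exact ContMDiff.mul contMDiff_const (hK' f h hf hh)

/-- A (covariant) pseudo-Riemannian metric. -/
structure PseudoRiemannianMetric (n : ℕ) (M : Type*) [TopologicalSpace M]
    [ChartedSpace (EuclideanSpace ℝ (Fin n)) M] [IsManifold (𝓡 n) ∞ M] where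
  val : ∀ x : M, TangentSpace (𝓡 n) x →L[ℝ] TangentSpace (𝓡 n) x →L[ℝ] ℝ
  symm : ∀ (x : M) (v w : Tan n x), val x v w = val x w v
  nondegenerate : ∀ (x : M) (v : Tan n x), (∀ w, val x v w = 0) → v = 0
  smooth : ContMDiff (𝓡 n)
    ((𝓡 n).prod 𝓘(ℝ, EuclideanSpace ℝ (Fin n) →L[ℝ] EuclideanSpace ℝ (Fin n) →L[ℝ] ℝ)) ∞
    (fun x => Bundle.TotalSpace.mk'
      (EuclideanSpace ℝ (Fin n) →L[ℝ] EuclideanSpace ℝ (Fin n) →L[ℝ] ℝ)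
      (E := fun x : M => TangentSpace (𝓡 n) x →L[ℝ] TangentSpace (𝓡 n) x →L[ℝ] ℝ) x (val x))

theorem bijective_of_nondegenerate {n : ℕ}
    (b : EuclideanSpace ℝ (Fin n) →L[ℝ] EuclideanSpace ℝ (Fin n) →L[ℝ] ℝ)
    (hb : ∀ v, (∀ w, b v w = 0) → v = 0) : Function.Bijective b := by
  have inj : Function.Injective b.toLinearMap := by
    rw [← LinearMap.ker_eq_bot, LinearMap.ker_eq_bot']
    intro v hv
    refine hb v fun w => ?_
    have : b v = 0 := hv
    simp [this]
  have e : Module.finrank ℝ (EuclideanSpace ℝ (Fin n)) =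
      Module.finrank ℝ (EuclideanSpace ℝ (Fin n) →L[ℝ] ℝ) := by
    rw [← (LinearMap.toContinuousLinearMap
      (𝕜 := ℝ) (E := EuclideanSpace ℝ (Fin n)) (F' := ℝ)).finrank_eq]
    exact (Subspace.dual_finrank_eq (K := ℝ) (V := EuclideanSpace ℝ (Fin n))).symm
  exact ⟨inj, (LinearMap.injective_iff_surjective_of_finrank_eq_finrank e).1 inj⟩

variable [IsManifold (𝓡 n) ∞ M]

namespace PseudoRiemannianMetric

/-- The musical isomorphism `v ↦ g(v, ·)`. -/
def flat (g : PseudoRiemannianMetric n M) (x : M) : Tan n x ≃ₗ[ℝ] Cotan n x :=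
  LinearEquiv.ofBijective (g.val x).toLinearMap
    (bijective_of_nondegenerate (g.val x) (g.nondegenerate x))

/-- The contravariant metric `G`, the inverse of `g`. -/
def contra (g : PseudoRiemannianMetric n M) : ContraField n M :=
  fun x => (g.flat x).symm.toLinearMap

end PseudoRiemannianMetric

/-- The Schouten bracket `[K, L]` of two symmetric contravariant 2-tensors, evaluated on
`(df, df, df)`. The second derivatives of `f` cancel, so this is the cubic form
`2 (K^{il} ∂_l L^{jk} - L^{il} ∂_l K^{jk}) f_i f_j f_k`, which determines the symmetric 3-tensor
`[K, L]`. -/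
def schouten (K L : ContraField n M) (f : M → ℝ) (x : M) : ℝ :=
  2 * (K.pair f (L.pair f f) x - L.pair f (K.pair f f) x)

/-- Killing 2-tensors: `[K, G] = 0`. -/
def IsKilling (g : PseudoRiemannianMetric n M) (K : SymTensor n M) : Prop :=
  ∀ f : M → ℝ, SmoothFn n f → ∀ x : M, schouten K.1 g.contra f x = 0

/-- The endomorphism of `TₓM` associated with a contravariant 2-tensor by lowering an index. -/
def endo (g : PseudoRiemannianMetric n M) (K : ContraField n M) (x : M) :
    Tan n x →ₗ[ℝ] Tan n x :=
  K x ∘ₗ (g.flat x).toLinearMap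

/-- All eigenvalues are real and simple: there are `n` distinct real eigenvalues. -/
def HasSimpleEigenvalues (g : PseudoRiemannianMetric n M) (K : ContraField n M) (x : M) : Prop :=
  ∃ (b : Module.Basis (Fin n) ℝ (Tan n x)) (μ : Fin n → ℝ),
    Function.Injective μ ∧ ∀ i, endo g K x (b i) = μ i • b i

/-- The eigenspaces (assumed to be lines) form an integrable net: around every point there are
local coordinates all of whose coordinate vector fields are eigenvector fields of `K`. -/
def HasIntegrableEigenspaces (g : PseudoRiemannianMetric n M) (K : ContraField n M) : Prop :=
  ∀ p : M, ∃ φ : PartialDiffeomorph (𝓡 n) (𝓡 n) (EuclideanSpace ℝ (Fin n)) M ∞,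
    p ∈ φ.target ∧ ∀ q ∈ φ.source, ∀ i : Fin n, ∃ μ : ℝ,
      endo g K (φ q) (mfderiv (𝓡 n) (𝓡 n) φ q (EuclideanSpace.single i (1 : ℝ))) =
        μ • mfderiv (𝓡 n) (𝓡 n) φ q (EuclideanSpace.single i (1 : ℝ))

/-- Characteristic Killing tensors: Killing tensors with simple eigenfunctions and orthogonally
integrable eigenspaces. -/
structure IsCharacteristic (g : PseudoRiemannianMetric n M) (K : SymTensor n M) : Prop where
  killing : IsKilling g K
  simple : ∀ x : M, HasSimpleEigenvalues g K.1 x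
  integrable : HasIntegrableEigenspaces g K.1

/-- `𝒦` is the Killing–Stäckel space associated with (the web of) the characteristic Killing
tensor `K`: an `n`-dimensional space of Killing tensors which are diagonalized in the web formed
by the eigenspaces of `K`. -/
structure IsKSSpaceOf (g : PseudoRiemannianMetric n M) (K : SymTensor n M)
    (𝒦 : Submodule ℝ (SymTensor n M)) : Prop where
  killing : ∀ L ∈ 𝒦, IsKilling g L
  diagonal : ∀ L ∈ 𝒦, ∀ (x : M) (v : Tan n x) (μ : ℝ), endo g K.1 x v = μ • v →
    ∃ ν : ℝ, endo g L.1 x v = ν • v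
  finrank_eq : Module.finrank ℝ 𝒦 = n

/-- `𝒦` is a Killing–Stäckel space: the one associated with some characteristic Killing tensor. -/
def IsKSSpace (g : PseudoRiemannianMetric n M) (𝒦 : Submodule ℝ (SymTensor n M)) : Prop :=
  ∃ K : SymTensor n M, IsCharacteristic g K ∧ IsKSSpaceOf g K 𝒦

/-- Smooth sections of a field `E` of subspaces of the tangent spaces. -/
def IsSection (E : ∀ x : M, Submodule ℝ (Tan n x)) (X : ∀ x : M, Tan n x) : Prop :=
  ContMDiff (𝓡 n) (𝓡 n).tangent ∞ (fun x => (⟨x, X x⟩ : TangentBundle (𝓡 n) M)) ∧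
    ∀ x, X x ∈ E x

/-- Smooth distributions of constant rank (vector subbundles of the tangent bundle). -/
structure IsDistribution (E : ∀ x : M, Submodule ℝ (Tan n x)) : Prop where
  rank_const : ∃ m : ℕ, ∀ x, Module.finrank ℝ (E x) = m
  smooth : ∀ (x : M), ∀ v ∈ E x, ∃ X, IsSection E X ∧ X x = v

/-- The orthogonal complement of a distribution. -/
def orth (g : PseudoRiemannianMetric n M) (E : ∀ x : M, Submodule ℝ (Tan n x)) (x : M) :
    Submodule ℝ (Tan n x) where
  carrier := {v | ∀ w ∈ E x, g.val x w v = 0}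
  add_mem' := by
    intro a b ha hb w hw
    simp [ha w hw, hb w hw]
  zero_mem' := by
    intro w _
    simp
  smul_mem' := by
    intro c a ha w hw
    simp [ha w hw]

/-- `⟨∇_X Y, Z⟩` for the Levi-Civita connection `∇`, by the Koszul formula. -/
def leviCivita (g : PseudoRiemannianMetric n M) (X Y Z : ∀ x : M, Tan n x) (x : M) : ℝ :=
  (mvfderiv (𝓡 n) (fun p => g.val p (Y p) (Z p)) x (X x)
    + mvfderiv (𝓡 n) (fun p => g.val p (X p) (Z p)) x (Y x)
    - mvfderiv (𝓡 n) (fun p => g.val p (X p) (Y p)) x (Z x)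
    + g.val x (VectorField.mlieBracket (𝓡 n) X Y x) (Z x)
    - g.val x (VectorField.mlieBracket (𝓡 n) X Z x) (Y x)
    - g.val x (VectorField.mlieBracket (𝓡 n) Y Z x) (X x)) / 2

/-- Geodesic distributions: `(∇_X Y)^{E^⊥} = 0` for sections `X`, `Y` of `E`. -/
def IsGeodesicDistribution (g : PseudoRiemannianMetric n M)
    (E : ∀ x : M, Submodule ℝ (Tan n x)) : Prop :=
  ∀ X Y Z, IsSection E X → IsSection E Y → IsSection (orth g E) Z →
    ∀ x, leviCivita g X Y Z x = 0

/-- Spherical distributions: there is a section `H` of `E^⊥` (the mean curvature normal) with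
`(∇_X Y)^{E^⊥} = ⟨X, Y⟩ H` and `(∇_X H)^{E^⊥} = 0` for all sections `X`, `Y` of `E`. -/
def IsSphericalDistribution (g : PseudoRiemannianMetric n M)
    (E : ∀ x : M, Submodule ℝ (Tan n x)) : Prop :=
  ∃ H, IsSection (orth g E) H ∧
    (∀ X Y Z, IsSection E X → IsSection E Y → IsSection (orth g E) Z →
      ∀ x, leviCivita g X Y Z x = g.val x (X x) (Y x) * g.val x (H x) (Z x)) ∧
    (∀ X Z, IsSection E X → IsSection (orth g E) Z → ∀ x, leviCivita g X H Z x = 0)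

/-- Killing distributions: non-degenerate spherical distributions whose orthogonal complement is
geodesic. -/
structure IsKillingDistribution (g : PseudoRiemannianMetric n M)
    (D : ∀ x : M, Submodule ℝ (Tan n x)) : Prop where
  distribution : IsDistribution D
  nondegenerate : ∀ x, D x ⊓ orth g D x = ⊥
  spherical : IsSphericalDistribution g D
  orth_geodesic : IsGeodesicDistribution g (orth g D)

/-- `K`-invariance of a distribution. -/
def IsInvariant (g : PseudoRiemannianMetric n M) (K : SymTensor n M)
    (D : ∀ x : M, Submodule ℝ (Tan n x)) : Prop :=
  ∀ (x : M), ∀ v ∈ D x, endo g K.1 x v ∈ D x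

end Manifold

section WarpedProduct

variable {n b k : ℕ}
  {M : Type*} [TopologicalSpace M] [ChartedSpace (EuclideanSpace ℝ (Fin n)) M]
  {B : Type*} [TopologicalSpace B] [ChartedSpace (EuclideanSpace ℝ (Fin b)) B]
  {F : Type*} [TopologicalSpace F] [ChartedSpace (EuclideanSpace ℝ (Fin k)) F]

/-- The push-forward of a contravariant 2-tensor at `x` along a map `φ`. -/
def push (φ : B → M) (x : B) (A : Cotan b x →ₗ[ℝ] Tan b x) :
    Cotan n (φ x) →ₗ[ℝ] Tan n (φ x) where
  toFun α := mfderiv (𝓡 b) (𝓡 n) φ x (A (α.comp (mfderiv (𝓡 b) (𝓡 n) φ x)))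
  map_add' α β := by simp [ContinuousLinearMap.add_comp]
  map_smul' c α := by simp [ContinuousLinearMap.smul_comp]

variable [IsManifold (𝓡 n) ∞ M] [IsManifold (𝓡 b) ∞ B] [IsManifold (𝓡 k) ∞ F]

/-- `Φ : B × F → M` exhibits an open subset of `M` as the warped product `B ×_ρ F` adapted to the
net `(D^⊥, D)`: `Φ` is a diffeomorphism onto an open subset, the pulled back metric is
`g_B + ρ² g_F`, and the slices `B × {y}` and `{x} × F` are mapped to integral manifolds of `D^⊥`
and `D`. -/
structure IsAdaptedWarpedProduct (g : PseudoRiemannianMetric n M)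
    (D : ∀ x : M, Submodule ℝ (Tan n x)) (gB : PseudoRiemannianMetric b B)
    (gF : PseudoRiemannianMetric k F) (ρ : B → ℝ) (Φ : B × F → M) : Prop where
  dim_pos : 0 < k
  warp_smooth : SmoothFn b ρ
  warp_pos : ∀ x, 0 < ρ x
  injective : Function.Injective Φ
  localDiffeo : IsLocalDiffeomorph ((𝓡 b).prod (𝓡 k)) (𝓡 n) ∞ Φ
  metric : ∀ (p : B × F) (u v : TangentSpace ((𝓡 b).prod (𝓡 k)) p),
    g.val (Φ p) (mfderiv ((𝓡 b).prod (𝓡 k)) (𝓡 n) Φ p u)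
        (mfderiv ((𝓡 b).prod (𝓡 k)) (𝓡 n) Φ p v) =
      gB.val p.1 (mfderiv ((𝓡 b).prod (𝓡 k)) (𝓡 b) Prod.fst p u)
          (mfderiv ((𝓡 b).prod (𝓡 k)) (𝓡 b) Prod.fst p v) +
        ρ p.1 ^ 2 * gF.val p.2 (mfderiv ((𝓡 b).prod (𝓡 k)) (𝓡 k) Prod.snd p u)
          (mfderiv ((𝓡 b).prod (𝓡 k)) (𝓡 k) Prod.snd p v)
  tangent_base : ∀ (x : B) (y : F), orth g D (Φ (x, y)) =
    (mfderiv (𝓡 b) (𝓡 n) (fun x' => Φ (x', y)) x).toLinearMap.range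
  tangent_fiber : ∀ (x : B) (y : F), D (Φ (x, y)) =
    (mfderiv (𝓡 k) (𝓡 n) (fun y' => Φ (x, y')) y).toLinearMap.range

end WarpedProduct

end KillingStackel

end

/-!
A Killing tensor diagonal in the web of a characteristic Killing tensor satisfies, in separable
coordinates, a linear system expressing all first derivatives of its eigenvalues through the
eigenvalues themselves. Over a connected manifold it is therefore determined by its value at one
point, and an `n`-dimensional space of such tensors realizes every diagonal endomorphism there.

Since `K` preserves the fibers, it has no mixed components on the warped product, and hence neither
has any tensor `L` of the Killing–Stäckel space. Evaluating `[L, G] = 0` on `d(u + v)`, with `u` a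
function on the base and `v` one on the fiber, and separating by degree in `u` and `v`, gives four
equations: the components `L_B` and `L_F` are Killing, `L_B` does not depend on the fiber, and
`d(L_F(dv, dv)) = G_F(dv, dv) L_B dρ⁻²` along the base. Integrating the last one along the base
yields `l`. The projections to the factors carry `K` to its components up to an affine change of the
eigenvalues, so these components are characteristic. Conversely, given `L_B`, `L_F` and `l`, an
element of the Killing–Stäckel space is chosen to agree with `L_B + l G_F + L_F` at one point, and
the uniqueness statement on both factors makes them agree everywhere.
-/

noncomputable section

namespace KillingStackel

open Filter Topology Set

/-! ### Differentials of smooth functions -/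

section Differentials

variable {n : ℕ} {M : Type*} [TopologicalSpace M] [ChartedSpace (EuclideanSpace ℝ (Fin n)) M]

theorem mvfderiv_congr {f f' : M → ℝ} {x : M} (h : f =ᶠ[𝓝 x] f') :
    mvfderiv (𝓡 n) f x = mvfderiv (𝓡 n) f' x := by
  have := h.mfderiv_eq (I := 𝓡 n) (I' := 𝓘(ℝ, ℝ))
  ext v
  exact congrArg (fun A : EuclideanSpace ℝ (Fin n) →L[ℝ] ℝ => A v) this

theorem mvfderiv_const_mul (c : ℝ) {f : M → ℝ} {x : M}
    (hf : MDifferentiableAt (𝓡 n) 𝓘(ℝ, ℝ) f x) :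
    mvfderiv (𝓡 n) (fun y => c * f y) x = c • mvfderiv (𝓡 n) f x := by
  have h := mvfderiv_mul (I := 𝓡 n) (f := fun _ : M => c) (g := f) (x := x)
    mdifferentiableAt_const hf
  rw [mvfderiv_const] at h
  exact h.trans (by simp)

theorem SmoothFn.mdifferentiableAt {f : M → ℝ} (hf : SmoothFn n f) (x : M) :
    MDifferentiableAt (𝓡 n) 𝓘(ℝ, ℝ) f x :=
  ContMDiff.mdifferentiable hf (by simp) x

theorem cotan_ext {x : M} {v w : Tan n x} (h : ∀ α : Cotan n x, α v = α w) : v = w :=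
  sub_eq_zero.1 <| SeparatingDual.eq_zero_of_forall_dual_eq_zero (R := ℝ)
    (V := EuclideanSpace ℝ (Fin n)) fun α : Cotan n x =>
      (map_sub α v w).trans (sub_eq_zero.2 (h α))

variable [IsManifold (𝓡 n) ∞ M]

theorem contMDiffAt_mvfderiv_apply {f : M → ℝ} (hf : SmoothFn n f) {X : ∀ x : M, Tan n x} {x : M}
    (hX : ContMDiffAt (𝓡 n) (𝓡 n).tangent ∞ (fun y => (⟨y, X y⟩ : TangentBundle (𝓡 n) M)) x) :
    ContMDiffAt (𝓡 n) 𝓘(ℝ, ℝ) ∞ (fun y => mvfderiv (𝓡 n) f y (X y)) x := by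
  have tangentMap_smooth : ContMDiff (𝓡 n).tangent 𝓘(ℝ, ℝ).tangent ∞
      (tangentMap (𝓡 n) 𝓘(ℝ, ℝ) f) :=
    ContMDiff.contMDiff_tangentMap hf (by simp)
  exact (contMDiff_snd_tangentBundle_modelSpace ℝ 𝓘(ℝ, ℝ)).contMDiffAt.comp x
    (tangentMap_smooth.contMDiffAt.comp x hX)

theorem hasFDerivAt_comp_chart_symm_of_mvfderiv_eq_zero {f : M → ℝ} {p : M}
    {q : EuclideanSpace ℝ (Fin n)} (hq : q ∈ (chartAt (EuclideanSpace ℝ (Fin n)) p).target)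
    (hf : MDifferentiable (𝓡 n) 𝓘(ℝ, ℝ) f) (h : ∀ x, mvfderiv (𝓡 n) f x = 0) :
    HasFDerivAt (f ∘ (chartAt (EuclideanSpace ℝ (Fin n)) p).symm)
      (0 : EuclideanSpace ℝ (Fin n) →L[ℝ] ℝ) q := by
  set e := chartAt (EuclideanSpace ℝ (Fin n)) p
  have he : MDifferentiableAt (𝓡 n) (𝓡 n) e.symm q :=
    ((contMDiffOn_chart_symm (I := 𝓡 n) (n := ∞)).contMDiffAt
      (e.open_target.mem_nhds hq)).mdifferentiableAt (by simp)
  have hcomp := (hf (e.symm q)).hasMFDerivAt.comp q he.hasMFDerivAt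
  refine HasMFDerivAt.hasFDerivAt (hcomp.congr_mfderiv ?_)
  rw [show mfderiv (𝓡 n) 𝓘(ℝ, ℝ) f (e.symm q) = 0 from h _]
  exact ContinuousLinearMap.zero_comp _

theorem isLocallyConstant_of_mvfderiv_eq_zero {f : M → ℝ}
    (hf : MDifferentiable (𝓡 n) 𝓘(ℝ, ℝ) f) (h : ∀ x, mvfderiv (𝓡 n) f x = 0) :
    IsLocallyConstant f := by
  rw [IsLocallyConstant.iff_eventually_eq]
  intro p
  let e := chartAt (EuclideanSpace ℝ (Fin n)) p
  have hp : p ∈ e.source := mem_chart_source _ p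
  obtain ⟨r, hr, hball⟩ := Metric.isOpen_iff.1 e.open_target (e p) (e.map_source hp)
  have hderiv : ∀ q ∈ Metric.ball (e p) r, HasFDerivWithinAt (f ∘ e.symm)
      (0 : EuclideanSpace ℝ (Fin n) →L[ℝ] ℝ) (Metric.ball (e p) r) q := fun q hq =>
    (hasFDerivAt_comp_chart_symm_of_mvfderiv_eq_zero (hball hq) hf h).hasFDerivWithinAt
  filter_upwards [(e.continuousAt hp).eventually (Metric.ball_mem_nhds _ hr),
    e.open_source.mem_nhds hp] with y hy hy'
  have hle := (convex_ball (e p) r).norm_image_sub_le_of_norm_hasFDerivWithin_le (C := 0)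
    hderiv (by simp) (Metric.mem_ball_self hr) hy
  simpa only [Function.comp, e.left_inv hy', e.left_inv hp, zero_mul, norm_le_zero_iff,
    sub_eq_zero] using hle

theorem eq_of_mvfderiv_eq_zero [PreconnectedSpace M] {f : M → ℝ}
    (hf : MDifferentiable (𝓡 n) 𝓘(ℝ, ℝ) f) (h : ∀ x, mvfderiv (𝓡 n) f x = 0) (x y : M) :
    f x = f y :=
  (isLocallyConstant_of_mvfderiv_eq_zero hf h).apply_eq_of_isPreconnected isPreconnected_univ
    (mem_univ _) (mem_univ _)

variable [T2Space M]

theorem exists_smoothFn_eventuallyEq {U : Set M} (hU : IsOpen U) {x : M} (hx : x ∈ U)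
    {f : M → ℝ} (hf : ContMDiffOn (𝓡 n) 𝓘(ℝ, ℝ) ∞ f U) :
    ∃ f' : M → ℝ, SmoothFn n f' ∧ f' =ᶠ[𝓝 x] f := by
  obtain ⟨χ, -, hχ⟩ := (SmoothBumpFunction.nhds_basis_tsupport (I := 𝓡 n) x).mem_iff.1
    (hU.mem_nhds hx)
  refine ⟨fun y => χ y * f y, contMDiff_of_tsupport fun y hy => ?_, ?_⟩
  · have hyU : y ∈ U := hχ (tsupport_mul_subset_left hy)
    exact χ.contMDiffAt.mul (hf.contMDiffAt (hU.mem_nhds hyU))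
  · filter_upwards [χ.eventuallyEq_one] with y hy
    simp [hy]

theorem exists_smoothFn_mvfderiv_eq (x : M) (α : Cotan n x) :
    ∃ f : M → ℝ, SmoothFn n f ∧ mvfderiv (𝓡 n) f x = α := by
  obtain ⟨A, hA⟩ := isInvertible_mfderiv_extChartAt (I := 𝓡 n) (mem_extChartAt_source (I := 𝓡 n) x)
  let β : EuclideanSpace ℝ (Fin n) →L[ℝ] ℝ :=
    ContinuousLinearMap.comp α A.symm.toContinuousLinearMap
  have hβ : ContMDiff 𝓘(ℝ, EuclideanSpace ℝ (Fin n)) 𝓘(ℝ, ℝ) ∞ β := β.contMDiff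
  obtain ⟨f, hf, hfβ⟩ := exists_smoothFn_eventuallyEq (chartAt _ x).open_source
    (mem_chart_source _ x) (hβ.comp_contMDiffOn (contMDiffOn_extChartAt (I := 𝓡 n) (x := x)))
  refine ⟨f, hf, ?_⟩
  rw [mvfderiv_congr hfβ]
  ext v
  refine (mfderiv_comp_apply (I := 𝓡 n) (I' := 𝓡 n) (I'' := 𝓘(ℝ, ℝ)) x
    (hβ.mdifferentiable (by simp) _)
    (mdifferentiableAt_extChartAt (I := 𝓡 n) (mem_chart_source _ x)) v).trans ?_
  rw [← hA, ContinuousLinearMap.mfderiv_eq]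
  exact congrArg α (A.symm_apply_apply v)

end Differentials

/-! ### Symmetric tensors and the Schouten bracket -/

section SymmetricTensors

variable {n m : ℕ} {M : Type*} [TopologicalSpace M] [ChartedSpace (EuclideanSpace ℝ (Fin n)) M]
  {N : Type*} [TopologicalSpace N] [ChartedSpace (EuclideanSpace ℝ (Fin m)) N]

/-- Symmetry of a contravariant 2-tensor at a point. -/
def IsSymm {x : M} (A : Cotan n x →ₗ[ℝ] Tan n x) : Prop :=
  ∀ α β : Cotan n x, α (A β) = β (A α)

theorem SymTensor.isSymm (K : SymTensor n M) (x : M) : IsSymm (K.1 x) :=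
  K.2.1 x

theorem SymTensor.smoothFn_pair (K : SymTensor n M) {f h : M → ℝ} (hf : SmoothFn n f)
    (hh : SmoothFn n h) : SmoothFn n (K.1.pair f h) :=
  K.2.2 f h hf hh

theorem IsSymm.add {x : M} {A A' : Cotan n x →ₗ[ℝ] Tan n x} (hA : IsSymm A) (hA' : IsSymm A') :
    IsSymm (A + A') := fun α β => by
  simp only [LinearMap.add_apply, map_add, hA α β, hA' α β]

theorem IsSymm.smul {x : M} {A : Cotan n x →ₗ[ℝ] Tan n x} (hA : IsSymm A) (c : ℝ) :
    IsSymm (c • A) := fun α β => by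
  simp only [LinearMap.smul_apply, map_smul, hA α β]

theorem IsSymm.ext {x : M} {A A' : Cotan n x →ₗ[ℝ] Tan n x} (hA : IsSymm A) (hA' : IsSymm A')
    (h : ∀ α : Cotan n x, α (A α) = α (A' α)) : A = A' := by
  refine LinearMap.ext fun β => cotan_ext fun α => ?_
  have polarization := h (α + β)
  simp only [map_add, add_apply, h α, h β, hA β α, hA' β α] at polarization
  linarith

/-- The push-forward `α ↦ P (A (α ∘ P))` of a contravariant 2-tensor along a linear map `P` between
tangent spaces. -/
def transport {x : M} {z : N} (P : Tan n x →L[ℝ] Tan m z) (A : Cotan n x →ₗ[ℝ] Tan n x) :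
    Cotan m z →ₗ[ℝ] Tan m z where
  toFun α := P (A (α.comp P))
  map_add' α β := by simp [ContinuousLinearMap.add_comp]
  map_smul' c α := by simp [ContinuousLinearMap.smul_comp]

theorem IsSymm.transport {x : M} {z : N} {A : Cotan n x →ₗ[ℝ] Tan n x} (hA : IsSymm A)
    (P : Tan n x →L[ℝ] Tan m z) : IsSymm (transport P A) :=
  fun α β => hA (α.comp P) (β.comp P)

theorem ContraField.pair_congr (K : ContraField n M) {f f' h h' : M → ℝ} {x : M}
    (hf : f =ᶠ[𝓝 x] f') (hh : h =ᶠ[𝓝 x] h') : K.pair f h =ᶠ[𝓝 x] K.pair f' h' := by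
  filter_upwards [hf.eventuallyEq_nhds, hh.eventuallyEq_nhds] with y hy hy'
  simp only [ContraField.pair, mvfderiv_congr hy, mvfderiv_congr hy']

theorem schouten_congr (K L : ContraField n M) {f f' : M → ℝ} {x : M} (h : f =ᶠ[𝓝 x] f') :
    schouten K L f x = schouten K L f' x := by
  simp only [schouten]
  rw [(ContraField.pair_congr K h (ContraField.pair_congr L h h)).self_of_nhds,
    (ContraField.pair_congr L h (ContraField.pair_congr K h h)).self_of_nhds]

theorem schouten_add_left (S T U : SymTensor n M) {f : M → ℝ} (hf : SmoothFn n f) (x : M) :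
    schouten (S + T).1 U.1 f x = schouten S.1 U.1 f x + schouten T.1 U.1 f x := by
  have hpair : ContraField.pair (S + T).1 f f = S.1.pair f f + T.1.pair f f := by
    funext y
    simp [ContraField.pair]
  have hderiv := mvfderiv_add ((SymTensor.smoothFn_pair S hf hf).mdifferentiableAt x)
    ((SymTensor.smoothFn_pair T hf hf).mdifferentiableAt x)
  simp only [schouten, hpair]
  simp only [ContraField.pair, hderiv, Submodule.coe_add, Pi.add_apply, LinearMap.add_apply,
    map_add]
  ring

theorem schouten_smul_left (c : ℝ) (S U : SymTensor n M) {f : M → ℝ} (hf : SmoothFn n f) (x : M) :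
    schouten (c • S).1 U.1 f x = c * schouten S.1 U.1 f x := by
  have hpair : ContraField.pair (c • S).1 f f = fun y => c * S.1.pair f f y := by
    funext y
    simp [ContraField.pair]
  have hderiv := mvfderiv_const_mul c ((SymTensor.smoothFn_pair S hf hf).mdifferentiableAt x)
  simp only [schouten, hpair]
  simp only [ContraField.pair] at hderiv ⊢
  simp only [hderiv, Submodule.coe_smul, Pi.smul_apply, LinearMap.smul_apply, map_smul, smul_eq_mul]
  ring

variable [IsManifold (𝓡 n) ∞ M] [T2Space M]

theorem SymTensor.contMDiffAt_pair (K : SymTensor n M) {f h : M → ℝ} {U : Set M} (hU : IsOpen U)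
    {x : M} (hx : x ∈ U) (hf : ContMDiffOn (𝓡 n) 𝓘(ℝ, ℝ) ∞ f U)
    (hh : ContMDiffOn (𝓡 n) 𝓘(ℝ, ℝ) ∞ h U) :
    ContMDiffAt (𝓡 n) 𝓘(ℝ, ℝ) ∞ (K.1.pair f h) x := by
  obtain ⟨f', hf', hff'⟩ := exists_smoothFn_eventuallyEq hU hx hf
  obtain ⟨h', hh', hhh'⟩ := exists_smoothFn_eventuallyEq hU hx hh
  exact (SymTensor.smoothFn_pair K hf' hh').contMDiffAt.congr_of_eventuallyEq
    (ContraField.pair_congr _ hff'.symm hhh'.symm)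

theorem IsSymm.ext_mvfderiv {x : M} {A A' : Cotan n x →ₗ[ℝ] Tan n x} (hA : IsSymm A)
    (hA' : IsSymm A')
    (h : ∀ f : M → ℝ, SmoothFn n f →
      mvfderiv (𝓡 n) f x (A (mvfderiv (𝓡 n) f x)) =
        mvfderiv (𝓡 n) f x (A' (mvfderiv (𝓡 n) f x))) : A = A' :=
  hA.ext hA' fun α => by
    obtain ⟨f, hf, rfl⟩ := exists_smoothFn_mvfderiv_eq x α
    exact h f hf

end SymmetricTensors

/-! ### The contravariant metric -/

section InverseMatrix

variable {E H : Type*} [NormedAddCommGroup E] [NormedSpace ℝ E] [TopologicalSpace H]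
  {I : ModelWithCorners ℝ E H} {M : Type*} [TopologicalSpace M] [ChartedSpace H M]
  {ι : Type*} [Fintype ι] [DecidableEq ι] {r : WithTop ℕ∞}

theorem contMDiffAt_det {A : M → Matrix ι ι ℝ} {x : M}
    (hA : ∀ i j, ContMDiffAt I 𝓘(ℝ, ℝ) r (fun y => A y i j) x) :
    ContMDiffAt I 𝓘(ℝ, ℝ) r (fun y => (A y).det) x := by
  simp only [Matrix.det_apply']
  exact contMDiffAt_finsetSum fun σ _ => contMDiffAt_const.mul
    (contMDiffAt_finsetProd fun i _ => hA _ _)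

theorem contMDiffAt_matrix_inv_apply {A : M → Matrix ι ι ℝ} {x : M}
    (hA : ∀ i j, ContMDiffAt I 𝓘(ℝ, ℝ) r (fun y => A y i j) x) (hdet : (A x).det ≠ 0) (i j : ι) :
    ContMDiffAt I 𝓘(ℝ, ℝ) r (fun y => (A y)⁻¹ i j) x := by
  simp only [Matrix.inv_def, Ring.inverse_eq_inv', Matrix.smul_apply, smul_eq_mul,
    Matrix.adjugate_apply]
  refine ((contMDiffAt_det hA).inv₀ hdet).mul (contMDiffAt_det fun k l => ?_)
  simp only [Matrix.updateRow_apply]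
  split_ifs
  exacts [contMDiffAt_const, hA k l]

end InverseMatrix

section GramMatrix

variable {V ι : Type*} [AddCommGroup V] [Module ℝ V] [Fintype ι] [DecidableEq ι]
  {β : LinearMap.BilinForm ℝ V}

theorem repr_eq_inv_toMatrix_mulVec (c : Module.Basis ι ℝ V) (hβ : β.Nondegenerate) (w : V) :
    ⇑(c.repr w) = (LinearMap.BilinForm.toMatrix c β)⁻¹.mulVec fun i => β (c i) w := by
  have hdet := (LinearMap.BilinForm.nondegenerate_iff_det_ne_zero c).1 hβ
  have hmul : (LinearMap.BilinForm.toMatrix c β).mulVec (c.repr w) = fun i => β (c i) w := by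
    funext i
    conv_rhs => rw [← c.sum_repr w]
    simp only [Matrix.mulVec, dotProduct, LinearMap.BilinForm.toMatrix_apply, map_sum, map_smul,
      smul_eq_mul]
    exact Finset.sum_congr rfl fun _ _ => mul_comm _ _
  rw [← hmul, Matrix.mulVec_mulVec, Matrix.nonsing_inv_mul _ (isUnit_iff_ne_zero.2 hdet),
    Matrix.one_mulVec]

end GramMatrix

namespace PseudoRiemannianMetric

variable {n : ℕ} {M : Type*} [TopologicalSpace M] [ChartedSpace (EuclideanSpace ℝ (Fin n)) M]
  [IsManifold (𝓡 n) ∞ M]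

theorem contMDiffAt_val (g : PseudoRiemannianMetric n M) {X Y : ∀ x : M, Tan n x} {x : M}
    (hX : ContMDiffAt (𝓡 n) (𝓡 n).tangent ∞ (fun y => (⟨y, X y⟩ : TangentBundle (𝓡 n) M)) x)
    (hY : ContMDiffAt (𝓡 n) (𝓡 n).tangent ∞ (fun y => (⟨y, Y y⟩ : TangentBundle (𝓡 n) M)) x) :
    ContMDiffAt (𝓡 n) 𝓘(ℝ, ℝ) ∞ (fun y => g.val y (X y) (Y y)) x := by
  have h : ContMDiffAt (𝓡 n) ((𝓡 n).prod 𝓘(ℝ)) ∞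
      (fun m ↦ Bundle.TotalSpace.mk' ℝ (E := Bundle.Trivial M ℝ) m (g.val m (X m) (Y m))) x :=
    ContMDiffAt.clm_bundle_apply₂ (F₁ := EuclideanSpace ℝ (Fin n))
      (F₂ := EuclideanSpace ℝ (Fin n)) (b := fun m : M => m) g.smooth.contMDiffAt hX hY
  simp only [Bundle.contMDiffAt_totalSpace] at h
  exact h.2

theorem val_contra (g : PseudoRiemannianMetric n M) (x : M) (α : Cotan n x) (v : Tan n x) :
    g.val x (g.contra x α) v = α v :=
  congrArg (fun β : Cotan n x => β v) ((g.flat x).apply_symm_apply α)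

theorem contra_isSymm (g : PseudoRiemannianMetric n M) (x : M) : IsSymm (g.contra x) :=
  fun α β => by rw [← g.val_contra x α, ← g.val_contra x β, g.symm]

/-- The metric at a point, as an algebraic bilinear form. -/
def bilin (g : PseudoRiemannianMetric n M) (x : M) : LinearMap.BilinForm ℝ (Tan n x) :=
  LinearMap.mk₂ ℝ (fun v w => g.val x v w) (by simp) (by simp) (by simp) (by simp)

theorem bilin_nondegenerate (g : PseudoRiemannianMetric n M) (x : M) :
    (g.bilin x).Nondegenerate :=
  ⟨fun v hv => g.nondegenerate x v hv,
    fun v hv => g.nondegenerate x v fun w => (g.symm x v w).trans (hv w)⟩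

theorem toMatrix_bilin (g : PseudoRiemannianMetric n M) {x : M}
    (c : Module.Basis (Fin n) ℝ (Tan n x)) : LinearMap.BilinForm.toMatrix c (g.bilin x) =
      Matrix.of fun k l => g.val x (c k) (c l) := by
  ext k l
  exact LinearMap.BilinForm.toMatrix_apply _ _ _ _

theorem pair_contra_eq_sum (g : PseudoRiemannianMetric n M) {x : M}
    (c : Module.Basis (Fin n) ℝ (Tan n x)) (f h : M → ℝ) :
    g.contra.pair f h x = ∑ i, (∑ j, (Matrix.of fun k l => g.val x (c k) (c l))⁻¹ i j *
      mvfderiv (𝓡 n) h x (c j)) * mvfderiv (𝓡 n) f x (c i) := by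
  set w := g.contra x (mvfderiv (𝓡 n) h x)
  have hw : ∀ i, g.bilin x (c i) w = mvfderiv (𝓡 n) h x (c i) := fun i =>
    (g.symm x _ _).trans (g.val_contra x _ _)
  have hrepr := repr_eq_inv_toMatrix_mulVec c (g.bilin_nondegenerate x) w
  simp only [hw, toMatrix_bilin] at hrepr
  change mvfderiv (𝓡 n) f x w = _
  conv_lhs => rw [← c.sum_repr w]
  simp only [map_sum, map_smul, smul_eq_mul, hrepr]
  rfl

theorem smoothFn_pair_contra (g : PseudoRiemannianMetric n M) {f h : M → ℝ} (hf : SmoothFn n f)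
    (hh : SmoothFn n h) : SmoothFn n (g.contra.pair f h) := by
  intro x₀
  let e := trivializationAt (EuclideanSpace ℝ (Fin n)) (TangentSpace (𝓡 n) : M → Type _) x₀
  let b := (EuclideanSpace.basisFun (Fin n) ℝ).toBasis
  let s : Fin n → ∀ x : M, Tan n x := e.localFrame b
  have hx₀ : x₀ ∈ e.baseSet := FiberBundle.mem_baseSet_trivializationAt' x₀
  have hs : ∀ i, ContMDiffAt (𝓡 n) (𝓡 n).tangent ∞
      (fun y => (⟨y, s i y⟩ : TangentBundle (𝓡 n) M)) x₀ :=
    fun i => contMDiffAt_localFrame_of_mem (n := ∞) e b i hx₀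
  have hframe := e.isLocalFrameOn_localFrame_baseSet (𝓡 n) ∞ b
  let gram : M → Matrix (Fin n) (Fin n) ℝ := fun y => Matrix.of fun i j => g.val y (s i y) (s j y)
  have hdet : (gram x₀).det ≠ 0 := by
    have := (LinearMap.BilinForm.nondegenerate_iff_det_ne_zero (hframe.toBasisAt hx₀)).1
      (g.bilin_nondegenerate x₀)
    simpa only [toMatrix_bilin, hframe.toBasisAt_coe] using this
  have hpair : g.contra.pair f h =ᶠ[𝓝 x₀] fun y => ∑ i, (∑ j, (gram y)⁻¹ i j *
      mvfderiv (𝓡 n) h y (s j y)) * mvfderiv (𝓡 n) f y (s i y) := by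
    filter_upwards [e.open_baseSet.mem_nhds hx₀] with y hy
    have := g.pair_contra_eq_sum (hframe.toBasisAt hy) f h
    simpa only [hframe.toBasisAt_coe] using this
  refine ContMDiffAt.congr_of_eventuallyEq (contMDiffAt_finsetSum fun i _ => ?_) hpair
  refine ContMDiffAt.mul (contMDiffAt_finsetSum fun j _ => ?_)
    (contMDiffAt_mvfderiv_apply hf (hs i))
  exact (contMDiffAt_matrix_inv_apply (fun k l => g.contMDiffAt_val (hs k) (hs l)) hdet i j).mul
    (contMDiffAt_mvfderiv_apply hh (hs j))

/-- The contravariant metric as an element of `S²(M)`. -/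
def contraTensor (g : PseudoRiemannianMetric n M) : SymTensor n M :=
  ⟨g.contra, g.contra_isSymm, fun _ _ hf hh => g.smoothFn_pair_contra hf hh⟩

end PseudoRiemannianMetric

/-! ### Linear systems of partial differential equations -/

section LinearSystem

variable {E G : Type*} [NormedAddCommGroup E] [NormedSpace ℝ E] [NormedAddCommGroup G]
  [NormedSpace ℝ G]

theorem eqOn_zero_of_norm_fderiv_le {s : Set E} (hs : Convex ℝ s) {f : E → G}
    (hf : ∀ q ∈ s, DifferentiableAt ℝ f q) {C : ℝ} (hC : ∀ q ∈ s, ‖fderiv ℝ f q‖ ≤ C * ‖f q‖)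
    {q₀ : E} (hq₀ : q₀ ∈ s) (hf₀ : f q₀ = 0) : EqOn f 0 s := by
  intro q hq
  let γ : ℝ → E := AffineMap.lineMap q₀ q
  have hγ : ∀ t ∈ Icc (0 : ℝ) 1, γ t ∈ s := fun t ht => hs.lineMap_mem hq₀ hq ht
  have hderiv : ∀ t ∈ Icc (0 : ℝ) 1,
      HasDerivAt (f ∘ γ) (fderiv ℝ f (γ t) (q - q₀)) t := fun t ht =>
    (hf _ (hγ t ht)).hasFDerivAt.comp_hasDerivAt t AffineMap.hasDerivAt_lineMap
  have hbound : ∀ t ∈ Ico (0 : ℝ) 1,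
      ‖fderiv ℝ f (γ t) (q - q₀)‖ ≤ C * ‖q - q₀‖ * ‖(f ∘ γ) t‖ := fun t ht =>
    calc ‖fderiv ℝ f (γ t) (q - q₀)‖ ≤ ‖fderiv ℝ f (γ t)‖ * ‖q - q₀‖ :=
          ContinuousLinearMap.le_opNorm _ _
      _ ≤ C * ‖f (γ t)‖ * ‖q - q₀‖ := by
          gcongr
          exact hC _ (hγ t (Ico_subset_Icc_self ht))
      _ = C * ‖q - q₀‖ * ‖(f ∘ γ) t‖ := by
          rw [Function.comp_apply]
          ring
  have hzero := eq_zero_of_abs_deriv_le_mul_abs_self_of_eq_zero_right (f := f ∘ γ) (a := 0)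
    (b := 1) (fun t ht => (hderiv t ht).continuousAt.continuousWithinAt)
    (fun t ht => (hderiv t (Ico_subset_Icc_self ht)).hasDerivWithinAt) (by simp [γ, hf₀])
    hbound 1 (by simp)
  simpa [γ] using hzero

theorem map_eq_sum_single {n : ℕ} (β : EuclideanSpace ℝ (Fin n) →L[ℝ] G)
    (w : EuclideanSpace ℝ (Fin n)) : β w = ∑ i, w i • β (EuclideanSpace.single i 1) := by
  conv_lhs => rw [← (EuclideanSpace.basisFun (Fin n) ℝ).sum_repr w]
  simp

theorem eq_zero_of_partial_derivatives_eq_mul {n : ℕ} {s : Set (EuclideanSpace ℝ (Fin n))}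
    (hs : Convex ℝ s) (hs' : IsCompact s) {σ : Fin n → EuclideanSpace ℝ (Fin n) → ℝ}
    (hσ : ∀ j, ∀ q ∈ s, DifferentiableAt ℝ (σ j) q)
    {A : Fin n → Fin n → EuclideanSpace ℝ (Fin n) → ℝ} (hA : ∀ i j, ContinuousOn (A i j) s)
    (hσA : ∀ q ∈ s, ∀ i j,
      fderiv ℝ (σ j) q (EuclideanSpace.single i 1) = σ i q * A i j q)
    {q₀ : EuclideanSpace ℝ (Fin n)} (hq₀ : q₀ ∈ s) (hσ₀ : ∀ j, σ j q₀ = 0) :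
    ∀ q ∈ s, ∀ j, σ j q = 0 := by
  obtain ⟨C, hC⟩ := hs'.exists_bound_of_continuousOn (f := fun q i j => A i j q)
    (continuousOn_pi.2 fun i => continuousOn_pi.2 fun j => hA i j)
  have hAC : ∀ q ∈ s, ∀ i j, |A i j q| ≤ C := fun q hq i j =>
    ((norm_le_pi_norm (fun j => A i j q) j).trans
      (norm_le_pi_norm (fun i j => A i j q) i)).trans (hC q hq)
  let f : EuclideanSpace ℝ (Fin n) → Fin n → ℝ := fun q j => σ j q
  have hbound : ∀ q ∈ s, ‖fderiv ℝ f q‖ ≤ (n * C) * ‖f q‖ := fun q hq => by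
    rcases isEmpty_or_nonempty (Fin n) with hn | ⟨⟨i₀⟩⟩
    · rw [Subsingleton.elim (f q) 0, Subsingleton.elim (fderiv ℝ f q) 0]
      simp
    have hC₀ : 0 ≤ C := (abs_nonneg _).trans (hAC q hq i₀ i₀)
    refine ContinuousLinearMap.opNorm_le_bound _ (by positivity) fun w => ?_
    refine (pi_norm_le_iff_of_nonneg (by positivity)).2 fun j => ?_
    calc ‖fderiv ℝ f q w j‖ = |∑ i, w i * (σ i q * A i j q)| := by
          rw [fderiv_pi fun j => hσ j q hq]
          simp only [ContinuousLinearMap.pi_apply, map_eq_sum_single _ w, hσA q hq,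
            smul_eq_mul, Real.norm_eq_abs]
      _ ≤ ∑ _i : Fin n, ‖w‖ * (‖f q‖ * C) := by
          refine (Finset.abs_sum_le_sum_abs _ _).trans (Finset.sum_le_sum fun i _ => ?_)
          rw [abs_mul, abs_mul]
          gcongr
          · exact PiLp.norm_apply_le w i
          · exact norm_le_pi_norm (f q) i
          · exact hAC q hq i j
      _ = n * C * ‖f q‖ * ‖w‖ := by
          rw [Finset.sum_const, Finset.card_univ, Fintype.card_fin, nsmul_eq_mul]
          ring
  intro q hq j
  exact congrFun (eqOn_zero_of_norm_fderiv_le hs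
    (fun q hq => differentiableAt_pi.2 fun j => hσ j q hq) hbound hq₀ (funext hσ₀) hq) j

end LinearSystem

theorem coeff_eq_zero_of_cubic_eq_zero {ι : Type*} [Fintype ι] {c : ι → ι → ℝ}
    (h : ∀ p : ι → ℝ, ∑ k, ∑ j, p k * p j ^ 2 * c k j = 0) (i j : ι) : c i j = 0 := by
  classical
  have hdiag : ∀ i, c i i = 0 := fun i => by
    have := h (Pi.single i 1)
    rw [Fintype.sum_eq_single i (fun k hk => by simp [hk]),
      Fintype.sum_eq_single i (fun k hk => by simp [hk])] at this
    simpa using this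
  obtain rfl | hij := eq_or_ne i j
  · exact hdiag i
  have htwo : ∀ s t : ℝ, s * t ^ 2 * c i j + t * s ^ 2 * c j i = 0 := fun s t => by
    have := h (Pi.single i s + Pi.single j t)
    rw [Fintype.sum_eq_add i j hij (fun k hk => by simp [hk.1, hk.2])] at this
    rw [Fintype.sum_eq_add i j hij (fun k hk => by simp [hk.1, hk.2]),
      Fintype.sum_eq_add i j hij (fun k hk => by simp [hk.1, hk.2])] at this
    simp only [Pi.add_apply, Pi.single_eq_same, Pi.single_eq_of_ne hij,
      Pi.single_eq_of_ne hij.symm, hdiag] at this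
    linarith
  linarith [htwo 1 1, htwo 1 (-1)]

/-! ### Tensors diagonal in local coordinates -/

section Coordinates

variable {n : ℕ} {M : Type*} [TopologicalSpace M] [ChartedSpace (EuclideanSpace ℝ (Fin n)) M]
  (φ : PartialDiffeomorph (𝓡 n) (𝓡 n) (EuclideanSpace ℝ (Fin n)) M ∞)

/-- The coordinate vectors of a local parametrization. -/
def frame (q : EuclideanSpace ℝ (Fin n)) (i : Fin n) : Tan n (φ q) :=
  mfderiv (𝓡 n) (𝓡 n) φ q (EuclideanSpace.single i (1 : ℝ))

/-- The function which is the linear form `β` in the coordinates given by `φ`; its value outside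
`φ.target` is irrelevant. -/
def linearFn (β : EuclideanSpace ℝ (Fin n) →L[ℝ] ℝ) (m : M) : ℝ :=
  β (φ.symm m)

/-- The coordinate functions of a local parametrization. -/
def coordFn (i : Fin n) : M → ℝ :=
  linearFn φ (EuclideanSpace.proj i)

/-- A tensor field is diagonal in the coordinates given by `φ`. -/
def IsDiagonalIn (T : ContraField n M) : Prop :=
  ∀ q ∈ φ.source, ∀ i, ∃ ν : ℝ,
    T (φ q) (mvfderiv (𝓡 n) (coordFn φ i) (φ q)) = ν • frame φ q i

/-- The diagonal components of a tensor field in the coordinates given by `φ`, as functions of the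
coordinates. -/
def diagCoeff (T : ContraField n M) (i : Fin n) (q : EuclideanSpace ℝ (Fin n)) : ℝ :=
  T.pair (coordFn φ i) (coordFn φ i) (φ q)

variable {φ}

theorem symm_apply_apply {q : EuclideanSpace ℝ (Fin n)} (hq : q ∈ φ.source) : φ.symm (φ q) = q :=
  φ.left_inv hq

theorem apply_symm_apply {m : M} (hm : m ∈ φ.target) : φ (φ.symm m) = m :=
  φ.right_inv hm

theorem symm_mem_source {m : M} (hm : m ∈ φ.target) : φ.symm m ∈ φ.source :=
  φ.map_target hm

theorem contMDiffOn_linearFn (β : EuclideanSpace ℝ (Fin n) →L[ℝ] ℝ) :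
    ContMDiffOn (𝓡 n) 𝓘(ℝ, ℝ) ∞ (linearFn φ β) φ.target :=
  β.contMDiff.comp_contMDiffOn φ.symm.contMDiffOn

theorem mvfderiv_frame {q : EuclideanSpace ℝ (Fin n)} (hq : q ∈ φ.source) {h : M → ℝ}
    (hh : MDifferentiableAt (𝓡 n) 𝓘(ℝ, ℝ) h (φ q)) (j : Fin n) :
    mvfderiv (𝓡 n) h (φ q) (frame φ q j) =
      fderiv ℝ (h ∘ φ) q (EuclideanSpace.single j (1 : ℝ)) := by
  refine (mfderiv_comp_apply (I := 𝓡 n) (I' := 𝓡 n) (I'' := 𝓘(ℝ, ℝ)) q hh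
    (φ.mdifferentiableAt (by simp) hq) (EuclideanSpace.single j (1 : ℝ))).symm.trans ?_
  rw [mfderiv_eq_fderiv]
  rfl

theorem mvfderiv_linearFn_frame (β : EuclideanSpace ℝ (Fin n) →L[ℝ] ℝ)
    {q : EuclideanSpace ℝ (Fin n)} (hq : q ∈ φ.source) (j : Fin n) :
    mvfderiv (𝓡 n) (linearFn φ β) (φ q) (frame φ q j) = β (EuclideanSpace.single j 1) := by
  have hβ : linearFn φ β ∘ φ =ᶠ[𝓝 q] β := by
    filter_upwards [φ.open_source.mem_nhds hq] with y hy using congrArg β (symm_apply_apply hy)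
  rw [mvfderiv_frame hq (((contMDiffOn_linearFn β).contMDiffAt
    (φ.open_target.mem_nhds (φ.map_source hq))).mdifferentiableAt (by simp)), hβ.fderiv_eq,
    ContinuousLinearMap.fderiv]

theorem mvfderiv_coordFn_frame {q : EuclideanSpace ℝ (Fin n)} (hq : q ∈ φ.source) (i j : Fin n) :
    mvfderiv (𝓡 n) (coordFn φ i) (φ q) (frame φ q j) = if i = j then 1 else 0 := by
  rw [coordFn, mvfderiv_linearFn_frame _ hq]
  simp

/-- The basis of the tangent space formed by the coordinate vectors. -/
def frameBasis {q : EuclideanSpace ℝ (Fin n)} (hq : q ∈ φ.source) :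
    Module.Basis (Fin n) ℝ (Tan n (φ q)) :=
  (EuclideanSpace.basisFun (Fin n) ℝ).toBasis.map
    ((φ.isLocalDiffeomorphAt _ _ _ hq).mfderivToContinuousLinearEquiv (by simp)).toLinearEquiv

theorem frameBasis_apply {q : EuclideanSpace ℝ (Fin n)} (hq : q ∈ φ.source) (i : Fin n) :
    frameBasis hq i = frame φ q i := by
  refine ((EuclideanSpace.basisFun (Fin n) ℝ).toBasis.map_apply ((φ.isLocalDiffeomorphAt _ _ _
    hq).mfderivToContinuousLinearEquiv (by simp)).toLinearEquiv i).trans ?_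
  rw [OrthonormalBasis.coe_toBasis, EuclideanSpace.basisFun_apply]
  rfl

theorem cotan_eq_sum_coordFn {q : EuclideanSpace ℝ (Fin n)} (hq : q ∈ φ.source)
    (α : Cotan n (φ q)) :
    α = ∑ i, α (frame φ q i) • mvfderiv (𝓡 n) (coordFn φ i) (φ q) := by
  ext v
  rw [← (frameBasis hq).sum_repr v]
  simp only [map_sum, map_smul, frameBasis_apply, sum_apply, smul_apply,
    mvfderiv_coordFn_frame hq, smul_eq_mul]
  simp

theorem IsDiagonalIn.apply_coordFn {T : ContraField n M} (hT : IsDiagonalIn φ T)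
    {q : EuclideanSpace ℝ (Fin n)} (hq : q ∈ φ.source) (i : Fin n) :
    T (φ q) (mvfderiv (𝓡 n) (coordFn φ i) (φ q)) = diagCoeff φ T i q • frame φ q i := by
  obtain ⟨ν, hν⟩ := hT q hq i
  rw [diagCoeff, ContraField.pair, hν, map_smul, mvfderiv_coordFn_frame hq]
  simp

theorem IsDiagonalIn.eq_zero {T : ContraField n M} (hT : IsDiagonalIn φ T)
    {q : EuclideanSpace ℝ (Fin n)} (hq : q ∈ φ.source) (h : ∀ i, diagCoeff φ T i q = 0) :
    T (φ q) = 0 := by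
  refine LinearMap.ext fun α => ?_
  rw [cotan_eq_sum_coordFn hq α]
  simp [hT.apply_coordFn hq, h]

theorem IsDiagonalIn.apply_linearFn {T : ContraField n M} (hT : IsDiagonalIn φ T)
    {q : EuclideanSpace ℝ (Fin n)} (hq : q ∈ φ.source) (β : EuclideanSpace ℝ (Fin n) →L[ℝ] ℝ) :
    T (φ q) (mvfderiv (𝓡 n) (linearFn φ β) (φ q)) =
      ∑ i, (β (EuclideanSpace.single i 1) * diagCoeff φ T i q) • frame φ q i := by
  rw [cotan_eq_sum_coordFn hq (mvfderiv (𝓡 n) (linearFn φ β) (φ q)), map_sum]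
  refine Finset.sum_congr rfl fun i _ => ?_
  rw [map_smul, hT.apply_coordFn hq, mvfderiv_linearFn_frame β hq, smul_smul]

theorem IsDiagonalIn.pair_linearFn {T : ContraField n M} (hT : IsDiagonalIn φ T)
    {q : EuclideanSpace ℝ (Fin n)} (hq : q ∈ φ.source) (β : EuclideanSpace ℝ (Fin n) →L[ℝ] ℝ) :
    T.pair (linearFn φ β) (linearFn φ β) (φ q) =
      ∑ i, β (EuclideanSpace.single i 1) ^ 2 * diagCoeff φ T i q := by
  rw [ContraField.pair, hT.apply_linearFn hq, map_sum]
  refine Finset.sum_congr rfl fun i _ => ?_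
  rw [map_smul, mvfderiv_linearFn_frame β hq, smul_eq_mul]
  ring

variable [IsManifold (𝓡 n) ∞ M] [T2Space M]

theorem contDiffOn_diagCoeff (T : SymTensor n M) (i : Fin n) :
    ContDiffOn ℝ ∞ (diagCoeff φ T.1 i) φ.source := by
  have h : ContMDiffOn (𝓡 n) 𝓘(ℝ, ℝ) ∞ (diagCoeff φ T.1 i) φ.source := fun q hq =>
    ((SymTensor.contMDiffAt_pair T φ.open_target (φ.map_source hq) (contMDiffOn_linearFn _)
      (contMDiffOn_linearFn _)).comp q
        (φ.contMDiffOn.contMDiffAt (φ.open_source.mem_nhds hq))).contMDiffWithinAt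
  exact h.contDiffOn

theorem differentiableAt_diagCoeff (T : SymTensor n M) (i : Fin n)
    {q : EuclideanSpace ℝ (Fin n)} (hq : q ∈ φ.source) :
    DifferentiableAt ℝ (diagCoeff φ T.1 i) q :=
  ((contDiffOn_diagCoeff T i).contDiffAt (φ.open_source.mem_nhds hq)).differentiableAt (by simp)

theorem pair_linearFn_pair_linearFn {S T : SymTensor n M} (hS : IsDiagonalIn φ S.1)
    (hT : IsDiagonalIn φ T.1) {q : EuclideanSpace ℝ (Fin n)} (hq : q ∈ φ.source)
    (β : EuclideanSpace ℝ (Fin n) →L[ℝ] ℝ) :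
    S.1.pair (linearFn φ β) (T.1.pair (linearFn φ β) (linearFn φ β)) (φ q) =
      ∑ i, ∑ j, β (EuclideanSpace.single i 1) * β (EuclideanSpace.single j 1) ^ 2 *
        (diagCoeff φ S.1 i q * fderiv ℝ (diagCoeff φ T.1 j) q (EuclideanSpace.single i 1)) := by
  rw [ContraField.pair, SymTensor.isSymm S, hS.apply_linearFn hq, map_sum]
  refine Finset.sum_congr rfl fun i _ => ?_
  have hdiff : MDifferentiableAt (𝓡 n) 𝓘(ℝ, ℝ)
      (T.1.pair (linearFn φ β) (linearFn φ β)) (φ q) :=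
    (SymTensor.contMDiffAt_pair T φ.open_target (φ.map_source hq) (contMDiffOn_linearFn β)
      (contMDiffOn_linearFn β)).mdifferentiableAt (by simp)
  have hcoord : T.1.pair (linearFn φ β) (linearFn φ β) ∘ φ =ᶠ[𝓝 q]
      fun y => ∑ j, β (EuclideanSpace.single j 1) ^ 2 * diagCoeff φ T.1 j y := by
    filter_upwards [φ.open_source.mem_nhds hq] with y hy using hT.pair_linearFn hy β
  rw [map_smul, mvfderiv_frame hq hdiff, hcoord.fderiv_eq, fderiv_fun_sum (fun j _ =>
    (differentiableAt_diagCoeff T j hq).const_mul _), sum_apply, smul_eq_mul, Finset.mul_sum]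
  refine Finset.sum_congr rfl fun j _ => ?_
  rw [fderiv_const_mul (differentiableAt_diagCoeff T j hq), smul_apply, smul_eq_mul]
  ring

theorem diagCoeff_mul_fderiv_eq {S T : SymTensor n M} (hS : IsDiagonalIn φ S.1)
    (hT : IsDiagonalIn φ T.1)
    (hST : ∀ f : M → ℝ, SmoothFn n f → ∀ x : M, schouten S.1 T.1 f x = 0)
    {q : EuclideanSpace ℝ (Fin n)} (hq : q ∈ φ.source) (i j : Fin n) :
    diagCoeff φ S.1 i q * fderiv ℝ (diagCoeff φ T.1 j) q (EuclideanSpace.single i 1) =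
      diagCoeff φ T.1 i q * fderiv ℝ (diagCoeff φ S.1 j) q (EuclideanSpace.single i 1) := by
  rw [← sub_eq_zero]
  refine coeff_eq_zero_of_cubic_eq_zero (c := fun i j =>
    diagCoeff φ S.1 i q * fderiv ℝ (diagCoeff φ T.1 j) q (EuclideanSpace.single i 1) -
      diagCoeff φ T.1 i q * fderiv ℝ (diagCoeff φ S.1 j) q (EuclideanSpace.single i 1))
    (fun p => ?_) i j
  let β : EuclideanSpace ℝ (Fin n) →L[ℝ] ℝ :=
    ∑ i, p i • (EuclideanSpace.proj i : EuclideanSpace ℝ (Fin n) →L[ℝ] ℝ)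
  have hβ : ∀ i, β (EuclideanSpace.single i 1) = p i := fun i => by simp [β]
  obtain ⟨f, hf, hfβ⟩ := exists_smoothFn_eventuallyEq φ.open_target (φ.map_source hq)
    (contMDiffOn_linearFn β)
  have h := hST f hf (φ q)
  rw [schouten_congr _ _ hfβ, schouten, pair_linearFn_pair_linearFn hS hT hq,
    pair_linearFn_pair_linearFn hT hS hq] at h
  simp only [hβ] at h
  simp only [mul_sub, Finset.sum_sub_distrib]
  linarith

theorem diagCoeff_eq_zero_of_schouten_eq_zero {S T : SymTensor n M} (hS : IsDiagonalIn φ S.1)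
    (hT : IsDiagonalIn φ T.1) (hT₀ : ∀ q ∈ φ.source, ∀ i, diagCoeff φ T.1 i q ≠ 0)
    (hST : ∀ f : M → ℝ, SmoothFn n f → ∀ x : M, schouten S.1 T.1 f x = 0)
    {q₀ : EuclideanSpace ℝ (Fin n)} {r : ℝ} (hr : 0 ≤ r)
    (hball : Metric.closedBall q₀ r ⊆ φ.source) (hS₀ : ∀ i, diagCoeff φ S.1 i q₀ = 0) :
    ∀ q ∈ Metric.closedBall q₀ r, ∀ i, diagCoeff φ S.1 i q = 0 := by
  refine eq_zero_of_partial_derivatives_eq_mul (convex_closedBall q₀ r) (isCompact_closedBall q₀ r)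
    (fun j q hq => differentiableAt_diagCoeff S j (hball hq)) (A := fun i j q =>
      fderiv ℝ (diagCoeff φ T.1 j) q (EuclideanSpace.single i 1) / diagCoeff φ T.1 i q)
    (fun i j => ?_) (fun q hq i j => ?_) (Metric.mem_closedBall_self hr) hS₀
  · refine ContinuousOn.div ?_ ((contDiffOn_diagCoeff T i).continuousOn.mono hball)
      fun q hq => hT₀ q (hball hq) i
    exact (((contDiffOn_diagCoeff T j).continuousOn_fderiv_of_isOpen φ.open_source
      (by simp)).mono hball).clm_apply continuousOn_const
  · rw [← mul_div_assoc, eq_div_iff (hT₀ q (hball hq) i),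
      diagCoeff_mul_fderiv_eq hS hT hST (hball hq), mul_comm]

theorem eventually_eq_zero_of_schouten_eq_zero {S T : SymTensor n M} (hS : IsDiagonalIn φ S.1)
    (hT : IsDiagonalIn φ T.1) (hT₀ : ∀ q ∈ φ.source, ∀ i, diagCoeff φ T.1 i q ≠ 0)
    (hST : ∀ f : M → ℝ, SmoothFn n f → ∀ x : M, schouten S.1 T.1 f x = 0)
    {x : M} (hx : x ∈ φ.target) (hSx : S.1 x = 0) : ∀ᶠ y in 𝓝 x, S.1 y = 0 := by
  obtain ⟨r, hr, hball⟩ := Metric.nhds_basis_closedBall.mem_iff.1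
    (φ.open_source.mem_nhds (symm_mem_source hx))
  have hS₀ : ∀ i, diagCoeff φ S.1 i (φ.symm x) = 0 := fun i => by
    rw [diagCoeff, apply_symm_apply hx, ContraField.pair, hSx]
    simp
  have hcont : ContinuousAt φ.symm x :=
    (φ.symm.contMDiffOn.contMDiffAt (φ.open_target.mem_nhds hx)).continuousAt
  filter_upwards [hcont.preimage_mem_nhds (Metric.closedBall_mem_nhds _ hr),
    φ.open_target.mem_nhds hx] with y hy hyt
  rw [← apply_symm_apply hyt]
  exact hS.eq_zero (symm_mem_source hyt)
    (diagCoeff_eq_zero_of_schouten_eq_zero hS hT hT₀ hST hr.le hball hS₀ _ hy)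

end Coordinates

/-! ### Eigenvectors of a diagonalizable endomorphism -/

section Eigenvectors

variable {ι V : Type*} [AddCommGroup V] [Module ℝ V] {A : V →ₗ[ℝ] V}
  {b : Module.Basis ι ℝ V} {μ : ι → ℝ}

theorem repr_apply_of_eigenbasis (hb : ∀ i, A (b i) = μ i • b i) (v : V) (i : ι) :
    b.repr (A v) i = μ i * b.repr v i := by
  have h : Finsupp.lapply i ∘ₗ b.repr.toLinearMap ∘ₗ A =
      μ i • (Finsupp.lapply i ∘ₗ b.repr.toLinearMap) := by
    refine b.ext fun j => ?_
    by_cases hij : j = i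
    · subst hij
      simp [hb]
    · simp [hb, Finsupp.single_eq_of_ne (Ne.symm hij)]
  exact LinearMap.congr_fun h v

theorem repr_eq_zero_of_eigenvector (hb : ∀ i, A (b i) = μ i • b i) {v : V} {r : ℝ}
    (hv : A v = r • v) {i : ι} (hi : μ i ≠ r) : b.repr v i = 0 := by
  have h := repr_apply_of_eigenbasis hb v i
  rw [hv, map_smul, Finsupp.smul_apply, smul_eq_mul] at h
  have : (μ i - r) * b.repr v i = 0 := by linarith
  exact (mul_eq_zero.1 this).resolve_left (sub_ne_zero.2 hi)

theorem exists_eq_smul_of_eigenvector (hb : ∀ i, A (b i) = μ i • b i)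
    (hμ : Function.Injective μ) {v w : V} {r : ℝ} (hv : A v = r • v) (hw : A w = r • w)
    (hv₀ : v ≠ 0) : ∃ c : ℝ, w = c • v := by
  obtain ⟨i, hi⟩ : ∃ i, b.repr v i ≠ 0 := by
    by_contra! h
    exact hv₀ (b.repr.map_eq_zero_iff.1 (Finsupp.ext h))
  have hir : μ i = r := not_ne_iff.1 fun h => hi (repr_eq_zero_of_eigenvector hb hv h)
  refine ⟨b.repr w i / b.repr v i, b.repr.injective (Finsupp.ext fun j => ?_)⟩
  rw [map_smul, Finsupp.smul_apply, smul_eq_mul]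
  by_cases hj : j = i
  · subst hj
    field_simp
  · have hjr : μ j ≠ r := fun h => hj (hμ (h.trans hir.symm))
    rw [repr_eq_zero_of_eigenvector hb hv hjr, repr_eq_zero_of_eigenvector hb hw hjr, mul_zero]

theorem apply_eigenvector_of_eigenbasis (hb : ∀ i, A (b i) = μ i • b i) {T : V →ₗ[ℝ] V}
    {c : ℝ → ℝ} (hT : ∀ i, T (b i) = c (μ i) • b i) {v : V} {r : ℝ} (hv : A v = r • v) :
    T v = c r • v := by
  refine b.repr.injective (Finsupp.ext fun i => ?_)
  rw [repr_apply_of_eigenbasis hT, map_smul, Finsupp.smul_apply, smul_eq_mul]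
  by_cases hi : μ i = r
  · rw [hi]
  · rw [repr_eq_zero_of_eigenvector hb hv hi, mul_zero, mul_zero]

end Eigenvectors

theorem exists_basis_of_span_eq_top {ι V : Type*} [Finite ι] [AddCommGroup V]
    [Module ℝ V] {m : ℕ} (hm : Module.finrank ℝ V = m) {v : ι → V}
    (hv : Submodule.span ℝ (range v) = ⊤) :
    ∃ (σ : Fin m → ι) (b : Module.Basis (Fin m) ℝ V), Function.Injective σ ∧
      ∀ i, b i = v (σ i) := by
  obtain ⟨κ, a, ha, hspan, hli⟩ := exists_linearIndependent' ℝ v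
  have : Finite κ := Finite.of_injective a ha
  have : Fintype κ := Fintype.ofFinite κ
  let b := Module.Basis.mk hli (hspan.trans hv).ge
  have hcard : Fintype.card κ = m := by rw [← hm, Module.finrank_eq_card_basis b]
  let e := Fintype.equivFinOfCardEq hcard
  exact ⟨a ∘ e.symm, b.reindex e, ha.comp e.symm.injective, fun i => by simp [b]⟩

/-! ### Tensors diagonalized by a characteristic Killing tensor -/

section Diagonal

variable {n : ℕ} {M : Type*} [TopologicalSpace M] [ChartedSpace (EuclideanSpace ℝ (Fin n)) M]

theorem finrank_tan (x : M) : Module.finrank ℝ (Tan n x) = n :=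
  finrank_euclideanSpace_fin (𝕜 := ℝ) (n := n)

variable [IsManifold (𝓡 n) ∞ M] {g : PseudoRiemannianMetric n M}

theorem val_endo_comm (g : PseudoRiemannianMetric n M) (K : SymTensor n M) (x : M)
    (v w : Tan n x) : g.val x (endo g K.1 x v) w = g.val x v (endo g K.1 x w) := by
  rw [g.symm]
  exact SymTensor.isSymm K x (g.flat x w) (g.flat x v)

theorem val_eq_zero_of_eigenvectors {K : SymTensor n M} {x : M} {v w : Tan n x} {r s : ℝ}
    (hv : endo g K.1 x v = r • v) (hw : endo g K.1 x w = s • w) (hrs : r ≠ s) :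
    g.val x v w = 0 := by
  have h := val_endo_comm g K x v w
  rw [hv, hw] at h
  simp only [map_smul, smul_apply, smul_eq_mul] at h
  have : (r - s) * g.val x v w = 0 := by linarith
  exact (mul_eq_zero.1 this).resolve_left (sub_ne_zero.2 hrs)

theorem eq_of_endo_eq {K L : ContraField n M} {x : M} (h : endo g K x = endo g L x) :
    K x = L x :=
  LinearMap.ext fun α => by simpa [endo] using LinearMap.congr_fun h ((g.flat x).symm α)

theorem endo_contra (x : M) : endo g g.contra x = LinearMap.id :=
  LinearMap.ext fun v => (g.flat x).symm_apply_apply v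

/-- Every eigenvector of `K` is an eigenvector of `L`, that is, `L` is diagonalized in the web of
`K`. -/
def IsDiagonalFor (g : PseudoRiemannianMetric n M) (K L : ContraField n M) : Prop :=
  ∀ (x : M) (v : Tan n x) (μ : ℝ), endo g K x v = μ • v → ∃ ν : ℝ, endo g L x v = ν • v

theorem isDiagonalFor_contra (K : ContraField n M) : IsDiagonalFor g K g.contra :=
  fun x v _ _ => ⟨1, by rw [endo_contra, one_smul, LinearMap.id_apply]⟩

/-- The coordinate vector fields of `φ` are eigenvector fields of `K`. -/
def IsEigenframe (g : PseudoRiemannianMetric n M) (K : ContraField n M)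
    (φ : PartialDiffeomorph (𝓡 n) (𝓡 n) (EuclideanSpace ℝ (Fin n)) M ∞) : Prop :=
  ∀ q ∈ φ.source, ∀ i, ∃ μ : ℝ, endo g K (φ q) (frame φ q i) = μ • frame φ q i

section Eigenframe

variable {φ : PartialDiffeomorph (𝓡 n) (𝓡 n) (EuclideanSpace ℝ (Fin n)) M ∞} {K : SymTensor n M}

theorem val_frame_eq_zero (hK : ∀ x : M, HasSimpleEigenvalues g K.1 x)
    (hφ : IsEigenframe g K.1 φ) {q : EuclideanSpace ℝ (Fin n)} (hq : q ∈ φ.source) {i j : Fin n}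
    (hij : i ≠ j) : g.val (φ q) (frame φ q i) (frame φ q j) = 0 := by
  obtain ⟨r, hr⟩ := hφ q hq i
  obtain ⟨s, hs⟩ := hφ q hq j
  refine val_eq_zero_of_eigenvectors hr hs fun hrs => ?_
  obtain ⟨b, μ, hμ, hb⟩ := hK (φ q)
  rw [← hrs] at hs
  rw [← frameBasis_apply hq] at hr hs
  obtain ⟨c, hc⟩ := exists_eq_smul_of_eigenvector hb hμ hr hs ((frameBasis hq).ne_zero i)
  have := congrArg (fun v => (frameBasis hq).repr v j) hc
  simp [Finsupp.single_eq_of_ne (Ne.symm hij)] at this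

theorem flat_frame (hK : ∀ x : M, HasSimpleEigenvalues g K.1 x) (hφ : IsEigenframe g K.1 φ)
    {q : EuclideanSpace ℝ (Fin n)} (hq : q ∈ φ.source) (i : Fin n) :
    g.flat (φ q) (frame φ q i) =
      g.val (φ q) (frame φ q i) (frame φ q i) • mvfderiv (𝓡 n) (coordFn φ i) (φ q) := by
  rw [cotan_eq_sum_coordFn hq (g.flat (φ q) (frame φ q i))]
  refine Fintype.sum_eq_single i fun j hj => ?_
  have : g.flat (φ q) (frame φ q i) (frame φ q j) = 0 := val_frame_eq_zero hK hφ hq (Ne.symm hj)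
  rw [this, zero_smul]

theorem val_frame_self_ne_zero (hK : ∀ x : M, HasSimpleEigenvalues g K.1 x)
    (hφ : IsEigenframe g K.1 φ) {q : EuclideanSpace ℝ (Fin n)} (hq : q ∈ φ.source) (i : Fin n) :
    g.val (φ q) (frame φ q i) (frame φ q i) ≠ 0 := by
  intro h
  have hflat := flat_frame hK hφ hq i
  rw [h, zero_smul, LinearEquiv.map_eq_zero_iff, ← frameBasis_apply hq] at hflat
  exact (frameBasis hq).ne_zero i hflat

theorem IsDiagonalFor.isDiagonalIn {L : ContraField n M} (hL : IsDiagonalFor g K.1 L)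
    (hK : ∀ x : M, HasSimpleEigenvalues g K.1 x) (hφ : IsEigenframe g K.1 φ) :
    IsDiagonalIn φ L := by
  intro q hq i
  obtain ⟨μ, hμ⟩ := hφ q hq i
  obtain ⟨ν, hν⟩ : ∃ ν : ℝ, L (φ q) (g.flat (φ q) (frame φ q i)) = ν • frame φ q i :=
    hL (φ q) _ μ hμ
  rw [flat_frame hK hφ hq, map_smul] at hν
  refine ⟨(g.val (φ q) (frame φ q i) (frame φ q i))⁻¹ * ν, ?_⟩
  rw [mul_smul, ← hν, smul_smul, inv_mul_cancel₀ (val_frame_self_ne_zero hK hφ hq i), one_smul]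

theorem diagCoeff_contra_ne_zero (hK : ∀ x : M, HasSimpleEigenvalues g K.1 x)
    (hφ : IsEigenframe g K.1 φ) {q : EuclideanSpace ℝ (Fin n)} (hq : q ∈ φ.source) (i : Fin n) :
    diagCoeff φ g.contra i q ≠ 0 := by
  intro h
  have hcontra := ((isDiagonalFor_contra K.1).isDiagonalIn hK hφ).apply_coordFn hq i
  rw [h, zero_smul] at hcontra
  have hcoord : mvfderiv (𝓡 n) (coordFn φ i) (φ q) = 0 :=
    (g.flat (φ q)).symm.map_eq_zero_iff.1 hcontra
  have hframe := mvfderiv_coordFn_frame hq i i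
  simp [hcoord] at hframe

end Eigenframe

/-! ### Diagonal Killing tensors are determined by their value at a point -/

variable {K : SymTensor n M}

/-- The space of all Killing tensors that are diagonal in the eigenvectors of `K`. It contains
every Killing–Stäckel space associated with `K`, and is itself one as soon as its dimension is the
maximal one. -/
def killingSpace (g : PseudoRiemannianMetric n M) (K : SymTensor n M) :
    Submodule ℝ (SymTensor n M) where
  carrier := {L | IsKilling g L ∧ IsDiagonalFor g K.1 L.1}
  add_mem' := by
    rintro L L' ⟨hL, hd⟩ ⟨hL', hd'⟩
    refine ⟨fun f hf x => ?_, fun x v μ hv => ?_⟩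
    · refine (schouten_add_left L L' g.contraTensor hf x).trans ?_
      rw [show g.contraTensor.1 = g.contra from rfl, hL f hf x, hL' f hf x, add_zero]
    · obtain ⟨ν, hν⟩ := hd x v μ hv
      obtain ⟨ν', hν'⟩ := hd' x v μ hv
      refine ⟨ν + ν', ?_⟩
      rw [add_smul, ← hν, ← hν']
      rfl
  zero_mem' := by
    refine ⟨fun f hf x => ?_, fun x v μ _ => ⟨0, by simp [endo]⟩⟩
    have := schouten_smul_left 0 (0 : SymTensor n M) g.contraTensor hf x
    rwa [zero_smul, zero_mul] at this
  smul_mem' := by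
    rintro c L ⟨hL, hd⟩
    refine ⟨fun f hf x => ?_, fun x v μ hv => ?_⟩
    · refine (schouten_smul_left c L g.contraTensor hf x).trans ?_
      rw [show g.contraTensor.1 = g.contra from rfl, hL f hf x, mul_zero]
    · obtain ⟨ν, hν⟩ := hd x v μ hv
      refine ⟨c * ν, ?_⟩
      rw [mul_smul, ← hν]
      rfl

theorem contraTensor_mem_killingSpace (g : PseudoRiemannianMetric n M) (K : SymTensor n M) :
    g.contraTensor ∈ killingSpace g K :=
  ⟨fun f _ x => by simp [schouten, PseudoRiemannianMetric.contraTensor], isDiagonalFor_contra K.1⟩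

theorem IsKSSpaceOf.le_killingSpace {𝒦 : Submodule ℝ (SymTensor n M)}
    (h𝒦 : IsKSSpaceOf g K 𝒦) : 𝒦 ≤ killingSpace g K :=
  fun L hL => ⟨h𝒦.killing L hL, h𝒦.diagonal L hL⟩

/-- The diagonal entries at `x` of the endomorphism of a tensor, in a basis `b` of the tangent
space; for a basis of eigenvectors and a diagonal tensor these are the eigenvalues. -/
def evalDiag (g : PseudoRiemannianMetric n M) {x : M} (b : Module.Basis (Fin n) ℝ (Tan n x)) :
    SymTensor n M →ₗ[ℝ] (Fin n → ℝ) where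
  toFun L i := b.repr (endo g L.1 x (b i)) i
  map_add' L L' := by
    funext i
    simp [endo]
  map_smul' c L := by
    funext i
    simp [endo]

theorem IsDiagonalFor.endo_eq_evalDiag_smul {x : M} {b : Module.Basis (Fin n) ℝ (Tan n x)}
    {μ : Fin n → ℝ} (hb : ∀ i, endo g K.1 x (b i) = μ i • b i) {L : SymTensor n M}
    (hL : IsDiagonalFor g K.1 L.1) (i : Fin n) :
    endo g L.1 x (b i) = evalDiag g b L i • b i := by
  obtain ⟨ν, hν⟩ := hL x (b i) _ (hb i)
  simp [evalDiag, hν]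

variable [T2Space M]

theorem isOpen_ne_zero (L : SymTensor n M) : IsOpen {x | L.1 x ≠ 0} := by
  rw [isOpen_iff_mem_nhds]
  intro x hx
  obtain ⟨f, hf, hfx⟩ : ∃ f, SmoothFn n f ∧ L.1.pair f f x ≠ 0 := by
    by_contra! h
    exact hx ((SymTensor.isSymm L x).ext_mvfderiv (SymTensor.isSymm 0 x)
      fun f hf => (h f hf).trans (map_zero _).symm)
  have hcont := (SymTensor.smoothFn_pair L hf hf).continuous.continuousAt (x := x)
  filter_upwards [hcont.eventually_ne hfx] with y hy hLy
  exact hy (by simp [ContraField.pair, hLy])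

variable [PreconnectedSpace M]

theorem eq_zero_of_apply_eq_zero (hK : IsCharacteristic g K) {L : SymTensor n M}
    (hL : L ∈ killingSpace g K) {x : M} (hx : L.1 x = 0) : L = 0 := by
  have hopen : IsOpen {y | L.1 y = 0} := by
    rw [isOpen_iff_mem_nhds]
    intro y hy
    obtain ⟨φ, hyφ, hφ⟩ := hK.integrable y
    exact eventually_eq_zero_of_schouten_eq_zero (T := g.contraTensor)
      (hL.2.isDiagonalIn hK.simple hφ) ((isDiagonalFor_contra K.1).isDiagonalIn hK.simple hφ)
      (fun q hq i => diagCoeff_contra_ne_zero hK.simple hφ hq i) hL.1 hyφ hy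
  have hclopen : IsClopen {y | L.1 y = 0} := ⟨⟨isOpen_ne_zero L⟩, hopen⟩
  exact Subtype.ext (funext (eq_univ_iff_forall.1 (hclopen.eq_univ ⟨x, hx⟩)))

theorem eq_of_apply_eq (hK : IsCharacteristic g K) {L L' : SymTensor n M}
    (hL : L ∈ killingSpace g K) (hL' : L' ∈ killingSpace g K) {x : M} (hx : L.1 x = L'.1 x) :
    L = L' :=
  sub_eq_zero.1 (eq_zero_of_apply_eq_zero hK (Submodule.sub_mem _ hL hL') (x := x)
    (sub_eq_zero.2 hx))

theorem evalDiag_injective (hK : IsCharacteristic g K) {𝒦 : Submodule ℝ (SymTensor n M)}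
    (h𝒦 : 𝒦 ≤ killingSpace g K) {x : M} {b : Module.Basis (Fin n) ℝ (Tan n x)} {μ : Fin n → ℝ}
    (hb : ∀ i, endo g K.1 x (b i) = μ i • b i) :
    Function.Injective (evalDiag g b ∘ₗ 𝒦.subtype) := by
  intro L L' h
  refine Subtype.ext (eq_of_apply_eq hK (h𝒦 L.2) (h𝒦 L'.2) (x := x) (eq_of_endo_eq (g := g) ?_))
  refine b.ext fun i => ?_
  rw [(h𝒦 L.2).2.endo_eq_evalDiag_smul hb, (h𝒦 L'.2).2.endo_eq_evalDiag_smul hb]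
  exact congrArg (· • b i) (congrFun h i)

theorem IsKSSpaceOf.exists_endo_eq (hK : IsCharacteristic g K)
    {𝒦 : Submodule ℝ (SymTensor n M)} (h𝒦 : IsKSSpaceOf g K 𝒦) (x : M) (c : ℝ → ℝ) :
    ∃ L ∈ 𝒦, ∀ (v : Tan n x) (μ : ℝ), endo g K.1 x v = μ • v → endo g L.1 x v = c μ • v := by
  obtain ⟨b, μ, -, hb⟩ := hK.simple x
  have hinj := evalDiag_injective hK h𝒦.le_killingSpace hb
  have : FiniteDimensional ℝ 𝒦 := FiniteDimensional.of_injective _ hinj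
  have hsurj : Function.Surjective (evalDiag g b ∘ₗ 𝒦.subtype) := by
    rw [← LinearMap.range_eq_top]
    apply Submodule.eq_top_of_finrank_eq
    rw [LinearMap.finrank_range_of_inj hinj, h𝒦.finrank_eq, Module.finrank_fin_fun]
  obtain ⟨L, hL⟩ := hsurj fun i => c (μ i)
  refine ⟨L.1, L.2, fun v r hv => apply_eigenvector_of_eigenbasis hb (fun i => ?_) hv⟩
  rw [IsDiagonalFor.endo_eq_evalDiag_smul hb (h𝒦.diagonal _ L.2)]
  exact congrArg (· • b i) (congrFun hL i)

theorem IsKSSpaceOf.exists_endo_eq_of_diagonal (hK : IsCharacteristic g K)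
    {𝒦 : Submodule ℝ (SymTensor n M)} (h𝒦 : IsKSSpaceOf g K 𝒦) (x : M)
    (T : Tan n x →ₗ[ℝ] Tan n x)
    (hT : ∀ (v : Tan n x) (μ : ℝ), endo g K.1 x v = μ • v → ∃ ν : ℝ, T v = ν • v) :
    ∃ L ∈ 𝒦, endo g L.1 x = T := by
  obtain ⟨b, μ, hμ, hb⟩ := hK.simple x
  choose ν hν using fun i => hT (b i) (μ i) (hb i)
  obtain ⟨L, hL, hLc⟩ := h𝒦.exists_endo_eq hK x (Function.extend μ ν 0)
  refine ⟨L, hL, b.ext fun i => ?_⟩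
  rw [hLc _ _ (hb i), hμ.extend_apply, hν]

theorem isKSSpaceOf_killingSpace (hK : IsCharacteristic g K) {x : M}
    (h : ∀ c : ℝ → ℝ, ∃ L ∈ killingSpace g K, ∀ (v : Tan n x) (μ : ℝ),
      endo g K.1 x v = μ • v → endo g L.1 x v = c μ • v) :
    IsKSSpaceOf g K (killingSpace g K) := by
  refine ⟨fun L hL => hL.1, fun L hL => hL.2, ?_⟩
  obtain ⟨b, μ, hμ, hb⟩ := hK.simple x
  have hinj := evalDiag_injective hK le_rfl hb
  have hsurj : Function.Surjective (evalDiag g b ∘ₗ (killingSpace g K).subtype) := by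
    intro c
    obtain ⟨L, hL, hLc⟩ := h (Function.extend μ c 0)
    refine ⟨⟨L, hL⟩, funext fun i => ?_⟩
    have hLb := hLc (b i) _ (hb i)
    rw [hμ.extend_apply] at hLb
    simp [evalDiag, hLb]
  simpa using (LinearEquiv.ofBijective _ ⟨hinj, hsurj⟩).finrank_eq

end Diagonal

/-! ### The inverse function theorem on manifolds -/

theorem exists_openPartialHomeomorph_of_hasFDerivAt {E G : Type*} [NormedAddCommGroup E]
    [NormedSpace ℝ E] [CompleteSpace E] [NormedAddCommGroup G] [NormedSpace ℝ G] {h : E → G}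
    {V : Set E} (hV : IsOpen V) (hh : ContDiffOn ℝ ∞ h V) {u : E} (hu : u ∈ V) {A : E ≃L[ℝ] G}
    (hA : HasFDerivAt h (A : E →L[ℝ] G) u) :
    ∃ O : OpenPartialHomeomorph E G,
      u ∈ O.source ∧ O.source ⊆ V ∧ ⇑O = h ∧ ContDiffOn ℝ ∞ O.symm O.target := by
  have hhu : ContDiffAt ℝ ∞ h u := hh.contDiffAt (hV.mem_nhds hu)
  let W := V ∩ fderiv ℝ h ⁻¹' range ((↑) : (E ≃L[ℝ] G) → E →L[ℝ] G)
  have hW : IsOpen W := (hh.continuousOn_fderiv_of_isOpen hV (by simp)).isOpen_inter_preimage hV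
    ContinuousLinearEquiv.isOpen
  let O := (hhu.toOpenPartialHomeomorph h hA (by simp)).restrOpen W hW
  have hOW : O.source ⊆ W := inter_subset_right
  refine ⟨O, ⟨hhu.mem_toOpenPartialHomeomorph_source hA (by simp), hu, A, hA.fderiv.symm⟩,
    hOW.trans inter_subset_left, rfl, fun y hy => ContDiffAt.contDiffWithinAt ?_⟩
  obtain ⟨hyV, A', hA'⟩ := hOW (O.map_target hy)
  have hhy := hh.contDiffAt (hV.mem_nhds hyV)
  refine O.contDiffAt_symm (f₀' := A') hy ?_ hhy
  rw [hA']
  exact (hhy.differentiableAt (by simp)).hasFDerivAt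

section InverseFunction

variable {m : ℕ} {N : Type*} [TopologicalSpace N] [ChartedSpace (EuclideanSpace ℝ (Fin m)) N]
  [IsManifold (𝓡 m) ∞ N]

theorem bijective_fderiv_chart_comp {ψ : EuclideanSpace ℝ (Fin m) → N}
    {u : EuclideanSpace ℝ (Fin m)} (hψ : MDifferentiableAt (𝓡 m) (𝓡 m) ψ u)
    (hb : Function.Bijective (mfderiv (𝓡 m) (𝓡 m) ψ u)) :
    Function.Bijective (fderiv ℝ (chartAt (EuclideanSpace ℝ (Fin m)) (ψ u) ∘ ψ) u) := by
  let e := chartAt (EuclideanSpace ℝ (Fin m)) (ψ u)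
  have he : ContMDiffAt (𝓡 m) (𝓡 m) ∞ e (ψ u) :=
    contMDiffOn_chart.contMDiffAt (e.open_source.mem_nhds (mem_chart_source _ _))
  have hcomp : mfderiv (𝓡 m) (𝓡 m) (e ∘ ψ) u =
      (mfderiv (𝓡 m) (𝓡 m) e (ψ u)).comp (mfderiv (𝓡 m) (𝓡 m) ψ u) :=
    mfderiv_comp u (he.mdifferentiableAt (by simp)) hψ
  obtain ⟨A, hA⟩ := isInvertible_mfderiv_extChartAt (I := 𝓡 m)
    (mem_extChartAt_source (I := 𝓡 m) (ψ u))
  have hAe : mfderiv (𝓡 m) (𝓡 m) e (ψ u) = A.toContinuousLinearMap := hA.symm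
  rw [mfderiv_eq_fderiv] at hcomp
  rw [hcomp, hAe]
  exact A.bijective.comp hb

theorem exists_partialDiffeomorph_of_bijective_mfderiv {ψ : EuclideanSpace ℝ (Fin m) → N}
    {V : Set (EuclideanSpace ℝ (Fin m))} (hV : IsOpen V) (hψ : ContMDiffOn (𝓡 m) (𝓡 m) ∞ ψ V)
    {u : EuclideanSpace ℝ (Fin m)} (hu : u ∈ V)
    (hb : Function.Bijective (mfderiv (𝓡 m) (𝓡 m) ψ u)) :
    ∃ φ : PartialDiffeomorph (𝓡 m) (𝓡 m) (EuclideanSpace ℝ (Fin m)) N ∞,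
      u ∈ φ.source ∧ φ.source ⊆ V ∧ EqOn φ ψ φ.source := by
  let e := chartAt (EuclideanSpace ℝ (Fin m)) (ψ u)
  have he : ContMDiffOn (𝓡 m) (𝓡 m) ∞ e e.source := contMDiffOn_chart
  let V' := V ∩ ψ ⁻¹' e.source
  have hV' : IsOpen V' := hψ.continuousOn.isOpen_inter_preimage hV e.open_source
  have huV' : u ∈ V' := ⟨hu, mem_chart_source _ _⟩
  have hh : ContDiffOn ℝ ∞ (e ∘ ψ) V' :=
    (he.comp (hψ.mono inter_subset_left) inter_subset_right).contDiffOn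
  have hbij := bijective_fderiv_chart_comp
    ((hψ.contMDiffAt (hV.mem_nhds hu)).mdifferentiableAt (by simp)) hb
  let A : EuclideanSpace ℝ (Fin m) ≃L[ℝ] EuclideanSpace ℝ (Fin m) :=
    ContinuousLinearEquiv.ofBijective (fderiv ℝ (e ∘ ψ) u) (LinearMap.ker_eq_bot.2 hbij.1)
      (LinearMap.range_eq_top.2 hbij.2)
  have hA : HasFDerivAt (e ∘ ψ)
      (A : EuclideanSpace ℝ (Fin m) →L[ℝ] EuclideanSpace ℝ (Fin m)) u :=
    ((hh.contDiffAt (hV'.mem_nhds huV')).differentiableAt (by simp)).hasFDerivAt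
  obtain ⟨O, huO, hOV', hO, hO_symm⟩ := exists_openPartialHomeomorph_of_hasFDerivAt hV' hh huV' hA
  let P := O.trans e.symm
  have hPV' : P.source ⊆ V' := fun z hz => hOV' hz.1
  have hPψ : EqOn P ψ P.source := fun z hz => by
    have hz' : e.symm (O z) = e.symm (e (ψ z)) := by rw [hO]; rfl
    exact hz'.trans (e.left_inv (hPV' hz).2)
  refine ⟨⟨P.toPartialEquiv, P.open_source, P.open_target, ?_, ?_⟩, ⟨huO, ?_⟩,
    hPV'.trans inter_subset_left, hPψ⟩
  · exact (hψ.mono (hPV'.trans inter_subset_left)).congr hPψ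
  · exact hO_symm.contMDiffOn.comp (he.mono fun y hy => hy.1) fun y hy => hy.2
  · change O u ∈ e.target
    rw [hO]
    exact e.map_source huV'.2

end InverseFunction

/-! ### Transferring eigenspaces along submersions -/

theorem bijective_of_apply_basis {ι V W : Type*} [AddCommGroup V] [Module ℝ V] [AddCommGroup W]
    [Module ℝ W] (b : Module.Basis ι ℝ V) (b' : Module.Basis ι ℝ W) {A : V →ₗ[ℝ] W}
    (hA : ∀ i, A (b i) = b' i) : Function.Bijective A := by
  have : A = (b.equiv b' (Equiv.refl ι)).toLinearMap := b.ext fun i => by simp [hA]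
  rw [this]
  exact LinearEquiv.bijective _

theorem span_range_comp_basis_eq_top {ι V W : Type*} [AddCommGroup V] [Module ℝ V]
    [AddCommGroup W] [Module ℝ W] (b : Module.Basis ι ℝ V) {A : V →ₗ[ℝ] W}
    (hA : Function.Surjective A) : Submodule.span ℝ (range (A ∘ b)) = ⊤ := by
  rw [range_comp, Submodule.span_image, b.span_eq, Submodule.map_top, LinearMap.range_eq_top.2 hA]

section CoordSlice

variable {n m : ℕ}

/-- The parametrization `u ↦ q + ∑ i, u i • e (σ i)` of the coordinate slice through `q` spanned
by the coordinates selected by `σ`. -/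
def coordSlice (σ : Fin m → Fin n) (q : EuclideanSpace ℝ (Fin n)) (u : EuclideanSpace ℝ (Fin m)) :
    EuclideanSpace ℝ (Fin n) :=
  q + ((EuclideanSpace.basisFun (Fin m) ℝ).toBasis.constr ℝ
    fun i => EuclideanSpace.single (σ i) (1 : ℝ)) u

variable {σ : Fin m → Fin n} {q : EuclideanSpace ℝ (Fin n)}

theorem coordSlice_zero : coordSlice σ q 0 = q := by
  simp [coordSlice]

theorem contMDiff_coordSlice : ContMDiff (𝓡 m) (𝓡 n) ∞ (coordSlice σ q) :=
  (contDiff_const.add (LinearMap.toContinuousLinearMap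
    ((EuclideanSpace.basisFun (Fin m) ℝ).toBasis.constr ℝ
      fun i => EuclideanSpace.single (σ i) (1 : ℝ))).contDiff).contMDiff

theorem mfderiv_coordSlice_single (u : EuclideanSpace ℝ (Fin m)) (i : Fin m) :
    mfderiv (𝓡 m) (𝓡 n) (coordSlice σ q) u (EuclideanSpace.single i (1 : ℝ)) =
      EuclideanSpace.single (σ i) (1 : ℝ) := by
  let J := LinearMap.toContinuousLinearMap ((EuclideanSpace.basisFun (Fin m) ℝ).toBasis.constr ℝ
    fun i => EuclideanSpace.single (σ i) (1 : ℝ))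
  have hderiv : fderiv ℝ (coordSlice σ q) u = J := (J.hasFDerivAt.const_add q).fderiv
  have hJ : J (EuclideanSpace.single i 1) = EuclideanSpace.single (σ i) 1 := by
    simp [J, Module.Basis.constr_apply_fintype]
  rw [mfderiv_eq_fderiv, hderiv]
  exact hJ

variable {M : Type*} [TopologicalSpace M] [ChartedSpace (EuclideanSpace ℝ (Fin n)) M]
  {N : Type*} [TopologicalSpace N] [ChartedSpace (EuclideanSpace ℝ (Fin m)) N]
  {φ : PartialDiffeomorph (𝓡 n) (𝓡 n) (EuclideanSpace ℝ (Fin n)) M ∞} {π : M → N}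

theorem contMDiffOn_comp_coordSlice {W : Set M} (hπ : ContMDiffOn (𝓡 n) (𝓡 m) ∞ π W) :
    ContMDiffOn (𝓡 m) (𝓡 m) ∞ (fun u => π (φ (coordSlice σ q u)))
      (coordSlice σ q ⁻¹' (φ.source ∩ φ ⁻¹' W)) := by
  have hπφ : ContMDiffOn (𝓡 n) (𝓡 m) ∞ (π ∘ φ) (φ.source ∩ φ ⁻¹' W) :=
    hπ.comp (φ.contMDiffOn.mono inter_subset_left) inter_subset_right
  exact hπφ.comp contMDiff_coordSlice.contMDiffOn subset_rfl

theorem mfderiv_comp_coordSlice_single {u : EuclideanSpace ℝ (Fin m)}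
    (hu : coordSlice σ q u ∈ φ.source)
    (hπ : MDifferentiableAt (𝓡 n) (𝓡 m) π (φ (coordSlice σ q u))) (i : Fin m) :
    mfderiv (𝓡 m) (𝓡 m) (fun u => π (φ (coordSlice σ q u))) u (EuclideanSpace.single i (1 : ℝ)) =
      mfderiv (𝓡 n) (𝓡 m) π (φ (coordSlice σ q u)) (frame φ (coordSlice σ q u) (σ i)) := by
  have hφ := φ.mdifferentiableAt (by simp) hu
  have hcomp := mfderiv_comp_apply (I := 𝓡 m) (I' := 𝓡 n) (I'' := 𝓡 m) u
    (hπ.comp (coordSlice σ q u) hφ) (contMDiff_coordSlice.mdifferentiable (by simp) u)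
    (EuclideanSpace.single i (1 : ℝ) : EuclideanSpace ℝ (Fin m))
  exact (hcomp.trans (congrArg (mfderiv (𝓡 n) (𝓡 m) (π ∘ φ) (coordSlice σ q u))
    (mfderiv_coordSlice_single u i))).trans (mfderiv_comp_apply (coordSlice σ q u) hπ hφ _)

theorem bijective_mfderiv_comp_coordSlice (hq : q ∈ φ.source)
    (hπ : MDifferentiableAt (𝓡 n) (𝓡 m) π (φ q))
    (b : Module.Basis (Fin m) ℝ (Tan m (π (φ q))))
    (hb : ∀ i, b i = mfderiv (𝓡 n) (𝓡 m) π (φ q) (frame φ q (σ i))) :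
    Function.Bijective (mfderiv (𝓡 m) (𝓡 m) (fun u => π (φ (coordSlice σ q u))) 0) := by
  let T : EuclideanSpace ℝ (Fin m) →L[ℝ] EuclideanSpace ℝ (Fin m) :=
    mfderiv (𝓡 m) (𝓡 m) (fun u => π (φ (coordSlice σ q u))) 0
  let b' : Module.Basis (Fin m) ℝ (EuclideanSpace ℝ (Fin m)) := b
  refine bijective_of_apply_basis (EuclideanSpace.basisFun (Fin m) ℝ).toBasis b'
    (A := T.toLinearMap) fun i => ?_
  have hframe : ∀ p, p = q → (mfderiv (𝓡 n) (𝓡 m) π (φ p) (frame φ p (σ i)) :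
      EuclideanSpace ℝ (Fin m)) = b' i := by
    rintro _ rfl
    exact (hb i).symm
  rw [OrthonormalBasis.coe_toBasis, EuclideanSpace.basisFun_apply]
  rw [← coordSlice_zero (σ := σ) (q := q)] at hq hπ
  exact (mfderiv_comp_coordSlice_single hq hπ i).trans (hframe _ coordSlice_zero)

end CoordSlice

section Transfer

variable {n m : ℕ} {M : Type*} [TopologicalSpace M] [ChartedSpace (EuclideanSpace ℝ (Fin n)) M]
  [IsManifold (𝓡 n) ∞ M] {N : Type*} [TopologicalSpace N]
  [ChartedSpace (EuclideanSpace ℝ (Fin m)) N] [IsManifold (𝓡 m) ∞ N]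
  {g : PseudoRiemannianMetric n M} {K : ContraField n M}
  {gN : PseudoRiemannianMetric m N} {KN : ContraField m N}

/-- `A` maps `K` to `KN` up to an affine change of the eigenvalues. -/
def Intertwines (g : PseudoRiemannianMetric n M) (K : ContraField n M)
    (gN : PseudoRiemannianMetric m N) (KN : ContraField m N) {x : M} {z : N}
    (A : Tan n x →L[ℝ] Tan m z) : Prop :=
  ∃ a c : ℝ, a ≠ 0 ∧ ∀ v, endo gN KN z (A v) = A (a • endo g K x v + c • v)

theorem HasSimpleEigenvalues.of_intertwines {x : M} {z : N} (hK : HasSimpleEigenvalues g K x)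
    {A : Tan n x →L[ℝ] Tan m z} (hA : Function.Surjective A) (h : Intertwines g K gN KN A) :
    HasSimpleEigenvalues gN KN z := by
  obtain ⟨b, μ, hμ, hb⟩ := hK
  obtain ⟨a, c, ha, hac⟩ := h
  obtain ⟨σ, b', hσ, hb'⟩ := exists_basis_of_span_eq_top (finrank_tan z)
    (span_range_comp_basis_eq_top b (A := A.toLinearMap) hA)
  refine ⟨b', fun i => a * μ (σ i) + c, fun i j hij => ?_, fun i => ?_⟩
  · exact hσ (hμ (mul_left_cancel₀ ha (add_right_cancel hij)))
  · rw [hb']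
    change endo gN KN z (A (b (σ i))) = _ • A (b (σ i))
    rw [hac, hb, smul_smul, ← add_smul, map_smul]

theorem hasIntegrableEigenspaces_of_intertwines (hK : HasIntegrableEigenspaces g K)
    (h : ∀ z : N, ∃ (W : Set M) (π : M → N) (x : M), IsOpen W ∧ ContMDiffOn (𝓡 n) (𝓡 m) ∞ π W ∧
      x ∈ W ∧ π x = z ∧ Function.Surjective (mfderiv (𝓡 n) (𝓡 m) π x) ∧
      ∀ y ∈ W, Intertwines g K gN KN (mfderiv (𝓡 n) (𝓡 m) π y)) :
    HasIntegrableEigenspaces gN KN := by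
  intro z
  obtain ⟨W, π, x, hW, hπ, hxW, rfl, hsurj, hint⟩ := h z
  obtain ⟨φ, hxφ, hφ⟩ := hK x
  obtain ⟨q, hq, rfl⟩ : ∃ q ∈ φ.source, φ q = x :=
    ⟨φ.symm x, symm_mem_source hxφ, apply_symm_apply hxφ⟩
  have hπd : ∀ y ∈ W, MDifferentiableAt (𝓡 n) (𝓡 m) π y := fun y hy =>
    (hπ.contMDiffAt (hW.mem_nhds hy)).mdifferentiableAt (by simp)
  obtain ⟨σ, b, -, hb⟩ := exists_basis_of_span_eq_top (finrank_tan (π (φ q)))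
    (span_range_comp_basis_eq_top (frameBasis hq)
      (A := (mfderiv (𝓡 n) (𝓡 m) π (φ q)).toLinearMap) hsurj)
  let ψ : EuclideanSpace ℝ (Fin m) → N := fun u => π (φ (coordSlice σ q u))
  have hS : IsOpen (φ.source ∩ φ ⁻¹' W) :=
    φ.contMDiffOn.continuousOn.isOpen_inter_preimage φ.open_source hW
  have hbij : Function.Bijective (mfderiv (𝓡 m) (𝓡 m) ψ 0) :=
    bijective_mfderiv_comp_coordSlice hq (hπd _ hxW) b fun i => by
      rw [hb, ← frameBasis_apply hq]
      rfl
  obtain ⟨χ, h0χ, hχV, hχ⟩ := exists_partialDiffeomorph_of_bijective_mfderiv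
    (hS.preimage contMDiff_coordSlice.continuous) (contMDiffOn_comp_coordSlice hπ)
    (by rw [mem_preimage, coordSlice_zero]; exact ⟨hq, hxW⟩) hbij
  refine ⟨χ, ?_, fun u hu i => ?_⟩
  · have hχ0 : χ 0 = π (φ q) := (hχ h0χ).trans
      (congrArg (fun p => π (φ p)) coordSlice_zero)
    rw [← hχ0]
    exact χ.map_source h0χ
  · obtain ⟨hus, huW⟩ := hχV hu
    obtain ⟨μ, hμ⟩ : ∃ μ : ℝ, endo g K (φ (coordSlice σ q u))
        (frame φ (coordSlice σ q u) (σ i)) = μ • frame φ (coordSlice σ q u) (σ i) :=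
      hφ _ hus (σ i)
    obtain ⟨a, c, -, hac⟩ := hint _ huW
    have hψu := hac (frame φ (coordSlice σ q u) (σ i))
    rw [hμ, smul_smul, ← add_smul, map_smul,
      ← mfderiv_comp_coordSlice_single hus (hπd _ huW)] at hψu
    refine ⟨a * μ + c, ?_⟩
    rw [(hχ.eventuallyEq_of_mem (χ.open_source.mem_nhds hu)).mfderiv_eq, hχ hu]
    exact hψu

end Transfer

/-! ### Local diffeomorphisms from a product -/

section Product

variable {n b k : ℕ}
  {M : Type*} [TopologicalSpace M] [ChartedSpace (EuclideanSpace ℝ (Fin n)) M]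
  {B : Type*} [TopologicalSpace B] [ChartedSpace (EuclideanSpace ℝ (Fin b)) B]
  {F : Type*} [TopologicalSpace F] [ChartedSpace (EuclideanSpace ℝ (Fin k)) F]
  {Φ : B × F → M}

/-- The differential of a local diffeomorphism `B × F → M` as an isomorphism of tangent spaces. -/
def diffEquiv (hl : IsLocalDiffeomorph ((𝓡 b).prod (𝓡 k)) (𝓡 n) ∞ Φ) (p : B × F) :
    TangentSpace ((𝓡 b).prod (𝓡 k)) p ≃L[ℝ] Tan n (Φ p) :=
  (hl p).mfderivToContinuousLinearEquiv (by simp)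

/-- The differential at `Φ p` of the local projection to the base `B`. -/
def projB (hl : IsLocalDiffeomorph ((𝓡 b).prod (𝓡 k)) (𝓡 n) ∞ Φ) (p : B × F) :
    Tan n (Φ p) →L[ℝ] Tan b p.1 :=
  (mfderiv ((𝓡 b).prod (𝓡 k)) (𝓡 b) Prod.fst p).comp (diffEquiv hl p).symm.toContinuousLinearMap

/-- The differential at `Φ p` of the local projection to the fiber `F`. -/
def projF (hl : IsLocalDiffeomorph ((𝓡 b).prod (𝓡 k)) (𝓡 n) ∞ Φ) (p : B × F) :
    Tan n (Φ p) →L[ℝ] Tan k p.2 :=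
  (mfderiv ((𝓡 b).prod (𝓡 k)) (𝓡 k) Prod.snd p).comp (diffEquiv hl p).symm.toContinuousLinearMap

/-- The differential at `p.1` of the inclusion of the base slice through `p`. -/
def inclB (Φ : B × F → M) (p : B × F) : Tan b p.1 →L[ℝ] Tan n (Φ p) :=
  mfderiv (𝓡 b) (𝓡 n) (fun x => Φ (x, p.2)) p.1

/-- The differential at `p.2` of the inclusion of the fiber slice through `p`. -/
def inclF (Φ : B × F → M) (p : B × F) : Tan k p.2 →L[ℝ] Tan n (Φ p) :=
  mfderiv (𝓡 k) (𝓡 n) (fun y => Φ (p.1, y)) p.2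

theorem contMDiff_slice_base {m : ℕ} {N : Type*} [TopologicalSpace N]
    [ChartedSpace (EuclideanSpace ℝ (Fin m)) N] {h : B × F → N}
    (hh : ContMDiff ((𝓡 b).prod (𝓡 k)) (𝓡 m) ∞ h) (y : F) :
    ContMDiff (𝓡 b) (𝓡 m) ∞ (fun x => h (x, y)) :=
  hh.comp (contMDiff_id.prodMk contMDiff_const)

theorem contMDiff_slice_fiber {m : ℕ} {N : Type*} [TopologicalSpace N]
    [ChartedSpace (EuclideanSpace ℝ (Fin m)) N] {h : B × F → N}
    (hh : ContMDiff ((𝓡 b).prod (𝓡 k)) (𝓡 m) ∞ h) (x : B) :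
    ContMDiff (𝓡 k) (𝓡 m) ∞ (fun y => h (x, y)) :=
  hh.comp (contMDiff_const.prodMk contMDiff_id)

theorem smoothFn_slice_base {h : B × F → ℝ} (hh : ContMDiff ((𝓡 b).prod (𝓡 k)) 𝓘(ℝ, ℝ) ∞ h)
    (y : F) : SmoothFn b (fun x => h (x, y)) :=
  hh.comp (contMDiff_id.prodMk contMDiff_const)

theorem smoothFn_slice_fiber {h : B × F → ℝ} (hh : ContMDiff ((𝓡 b).prod (𝓡 k)) 𝓘(ℝ, ℝ) ∞ h)
    (x : B) : SmoothFn k (fun y => h (x, y)) :=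
  hh.comp (contMDiff_const.prodMk contMDiff_id)

variable (hl : IsLocalDiffeomorph ((𝓡 b).prod (𝓡 k)) (𝓡 n) ∞ Φ)

theorem inclB_eq_diffEquiv (p : B × F) (u : Tan b p.1) :
    inclB Φ p u =
      diffEquiv hl p ((u, 0) : EuclideanSpace ℝ (Fin b) × EuclideanSpace ℝ (Fin k)) := by
  have hslice : MDifferentiableAt (𝓡 b) ((𝓡 b).prod (𝓡 k)) (fun x => (x, p.2)) p.1 :=
    mdifferentiableAt_id.prodMk mdifferentiableAt_const
  refine (mfderiv_comp_apply (I := 𝓡 b) (I' := (𝓡 b).prod (𝓡 k)) (I'' := 𝓡 n) p.1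
    (hl.contMDiff.mdifferentiable (by simp) (p.1, p.2)) hslice u).trans ?_
  rw [mfderiv_prod_left]
  rfl

theorem inclF_eq_diffEquiv (p : B × F) (w : Tan k p.2) :
    inclF Φ p w =
      diffEquiv hl p ((0, w) : EuclideanSpace ℝ (Fin b) × EuclideanSpace ℝ (Fin k)) := by
  have hslice : MDifferentiableAt (𝓡 k) ((𝓡 b).prod (𝓡 k)) (fun y => (p.1, y)) p.2 :=
    mdifferentiableAt_const.prodMk mdifferentiableAt_id
  refine (mfderiv_comp_apply (I := 𝓡 k) (I' := (𝓡 b).prod (𝓡 k)) (I'' := 𝓡 n) p.2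
    (hl.contMDiff.mdifferentiable (by simp) (p.1, p.2)) hslice w).trans ?_
  rw [mfderiv_prod_right]
  rfl

theorem projB_diffEquiv (p : B × F) (v : EuclideanSpace ℝ (Fin b) × EuclideanSpace ℝ (Fin k)) :
    projB hl p (diffEquiv hl p v) = v.1 := by
  refine (congrArg (mfderiv ((𝓡 b).prod (𝓡 k)) (𝓡 b) Prod.fst p)
    ((diffEquiv hl p).symm_apply_apply v)).trans ?_
  rw [mfderiv_fst]
  rfl

theorem projF_diffEquiv (p : B × F) (v : EuclideanSpace ℝ (Fin b) × EuclideanSpace ℝ (Fin k)) :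
    projF hl p (diffEquiv hl p v) = v.2 := by
  refine (congrArg (mfderiv ((𝓡 b).prod (𝓡 k)) (𝓡 k) Prod.snd p)
    ((diffEquiv hl p).symm_apply_apply v)).trans ?_
  rw [mfderiv_snd]
  rfl

@[simp]
theorem projB_inclB (p : B × F) (u : Tan b p.1) : projB hl p (inclB Φ p u) = u := by
  rw [inclB_eq_diffEquiv hl, projB_diffEquiv]

@[simp]
theorem projB_inclF (p : B × F) (w : Tan k p.2) : projB hl p (inclF Φ p w) = 0 := by
  rw [inclF_eq_diffEquiv hl, projB_diffEquiv]
  rfl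

@[simp]
theorem projF_inclB (p : B × F) (u : Tan b p.1) : projF hl p (inclB Φ p u) = 0 := by
  rw [inclB_eq_diffEquiv hl, projF_diffEquiv]
  rfl

@[simp]
theorem projF_inclF (p : B × F) (w : Tan k p.2) : projF hl p (inclF Φ p w) = w := by
  rw [inclF_eq_diffEquiv hl, projF_diffEquiv]

theorem projB_surjective (p : B × F) : Function.Surjective (projB hl p) :=
  fun u => ⟨inclB Φ p u, projB_inclB hl p u⟩

theorem projF_surjective (p : B × F) : Function.Surjective (projF hl p) :=
  fun w => ⟨inclF Φ p w, projF_inclF hl p w⟩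

theorem inclB_projB_add_inclF_projF (p : B × F) (v : Tan n (Φ p)) :
    inclB Φ p (projB hl p v) + inclF Φ p (projF hl p v) = v := by
  have hsum : ∀ w : EuclideanSpace ℝ (Fin b) × EuclideanSpace ℝ (Fin k),
      inclB Φ p (projB hl p (diffEquiv hl p w)) + inclF Φ p (projF hl p (diffEquiv hl p w)) =
        diffEquiv hl p w := by
    intro w
    rw [projB_diffEquiv, projF_diffEquiv]
    refine (congrArg₂ (· + ·) (inclB_eq_diffEquiv hl p w.1)
      (inclF_eq_diffEquiv hl p w.2)).trans ?_
    refine ((diffEquiv hl p).map_add _ _).symm.trans ?_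
    exact congrArg (diffEquiv hl p) (Prod.ext (add_zero w.1) (zero_add w.2))
  obtain ⟨w, rfl⟩ := (diffEquiv hl p).surjective v
  exact hsum w

theorem cotan_eq_comp_projB_add_comp_projF (p : B × F) (α : Cotan n (Φ p)) :
    α = (α.comp (inclB Φ p)).comp (projB hl p) + (α.comp (inclF Φ p)).comp (projF hl p) := by
  ext v
  conv_lhs => rw [← inclB_projB_add_inclF_projF hl p v]
  simp

theorem exists_local_factor {m : ℕ} {N : Type*} [TopologicalSpace N]
    [ChartedSpace (EuclideanSpace ℝ (Fin m)) N] {f : B × F → N}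
    (hf : ContMDiff ((𝓡 b).prod (𝓡 k)) (𝓡 m) ∞ f) (p : B × F) :
    ∃ (W : Set M) (π : M → N), IsOpen W ∧ Φ p ∈ W ∧ ContMDiffOn (𝓡 n) (𝓡 m) ∞ π W ∧
      π (Φ p) = f p ∧ ∀ z ∈ W, ∃ q, Φ q = z ∧ π (Φ q) = f q ∧
        ∀ v, (mfderiv (𝓡 n) (𝓡 m) π (Φ q) v : EuclideanSpace ℝ (Fin m)) =
          mfderiv ((𝓡 b).prod (𝓡 k)) (𝓡 m) f q ((diffEquiv hl q).symm v) := by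
  obtain ⟨Ψ, hp, hΨ⟩ := hl p
  have hinv : ∀ q ∈ Ψ.source, Ψ.symm (Φ q) = q := fun q hq => by
    rw [hΨ hq]
    exact Ψ.left_inv hq
  have hmem : ∀ q ∈ Ψ.source, Φ q ∈ Ψ.target := fun q hq => by
    rw [hΨ hq]
    exact Ψ.map_source hq
  have hπ : ContMDiffOn (𝓡 n) (𝓡 m) ∞ (fun z => f (Ψ.symm z)) Ψ.target :=
    hf.comp_contMDiffOn Ψ.symm.contMDiffOn
  refine ⟨Ψ.target, fun z => f (Ψ.symm z), Ψ.open_target, hmem p hp, hπ,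
    congrArg f (hinv p hp), fun z hz => ?_⟩
  have hq : Ψ.symm z ∈ Ψ.source := Ψ.map_target hz
  refine ⟨Ψ.symm z, (hΨ hq).trans (Ψ.right_inv hz), congrArg f (hinv _ hq), fun v => ?_⟩
  generalize Ψ.symm z = q at hq v ⊢
  have hchain := mfderiv_comp_apply (I := (𝓡 b).prod (𝓡 k)) (I' := 𝓡 n) (I'' := 𝓡 m) q
    ((hπ.contMDiffAt (Ψ.open_target.mem_nhds (hmem q hq))).mdifferentiableAt (by simp))
    (hl.contMDiff.mdifferentiable (by simp) q) ((diffEquiv hl q).symm v)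
  have hcomp : (fun z => f (Ψ.symm z)) ∘ Φ =ᶠ[𝓝 q] f := by
    filter_upwards [Ψ.open_source.mem_nhds hq] with z hz using congrArg f (hinv z hz)
  rw [hcomp.mfderiv_eq] at hchain
  refine Eq.trans ?_ hchain.symm
  exact congrArg (mfderiv (𝓡 n) (𝓡 m) (fun z => f (Ψ.symm z)) (Φ q))
    ((diffEquiv hl q).apply_symm_apply v).symm

theorem exists_smoothFn_lift [IsManifold (𝓡 n) ∞ M] [T2Space M]
    (hl : IsLocalDiffeomorph ((𝓡 b).prod (𝓡 k)) (𝓡 n) ∞ Φ) (p : B × F) {h : B × F → ℝ}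
    (hh : ContMDiff ((𝓡 b).prod (𝓡 k)) 𝓘(ℝ, ℝ) ∞ h) :
    ∃ f : M → ℝ, SmoothFn n f ∧ ∀ᶠ q in 𝓝 p, f (Φ q) = h q := by
  obtain ⟨Ψ, hp, hΨ⟩ := hl p
  obtain ⟨f, hf, hfe⟩ := exists_smoothFn_eventuallyEq Ψ.open_target (Ψ.map_source hp)
    (hh.comp_contMDiffOn Ψ.symm.contMDiffOn)
  refine ⟨f, hf, ?_⟩
  have hΨp : ContinuousAt Ψ p :=
    (Ψ.contMDiffOn.contMDiffAt (Ψ.open_source.mem_nhds hp)).continuousAt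
  filter_upwards [hΨp.eventually hfe, Ψ.open_source.mem_nhds hp] with q hq hqs
  rw [hΨ hqs]
  exact hq.trans (congrArg h (Ψ.left_inv hqs))

theorem exists_smoothFn_lift_add [IsManifold (𝓡 n) ∞ M] [T2Space M]
    (hl : IsLocalDiffeomorph ((𝓡 b).prod (𝓡 k)) (𝓡 n) ∞ Φ) (p : B × F) {u : B → ℝ}
    {v : F → ℝ} (hu : SmoothFn b u) (hv : SmoothFn k v) :
    ∃ f : M → ℝ, SmoothFn n f ∧ ∀ᶠ q in 𝓝 p, f (Φ q) = u q.1 + v q.2 :=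
  exists_smoothFn_lift hl p ((hu.comp contMDiff_fst).add (hv.comp contMDiff_snd))

theorem mvfderiv_inclB (hl : IsLocalDiffeomorph ((𝓡 b).prod (𝓡 k)) (𝓡 n) ∞ Φ)
    (p : B × F) {h : M → ℝ} (hh : MDifferentiableAt (𝓡 n) 𝓘(ℝ, ℝ) h (Φ p)) :
    (mvfderiv (𝓡 n) h (Φ p)).comp (inclB Φ p) =
      mvfderiv (𝓡 b) (fun x => h (Φ (x, p.2))) p.1 := by
  ext u
  exact (mfderiv_comp_apply (I := 𝓡 b) (I' := 𝓡 n) (I'' := 𝓘(ℝ, ℝ)) p.1 hh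
    ((contMDiff_slice_base hl.contMDiff p.2).mdifferentiable (by simp) p.1) u).symm

theorem mvfderiv_inclF (hl : IsLocalDiffeomorph ((𝓡 b).prod (𝓡 k)) (𝓡 n) ∞ Φ)
    (p : B × F) {h : M → ℝ} (hh : MDifferentiableAt (𝓡 n) 𝓘(ℝ, ℝ) h (Φ p)) :
    (mvfderiv (𝓡 n) h (Φ p)).comp (inclF Φ p) =
      mvfderiv (𝓡 k) (fun y => h (Φ (p.1, y))) p.2 := by
  ext w
  exact (mfderiv_comp_apply (I := 𝓡 k) (I' := 𝓡 n) (I'' := 𝓘(ℝ, ℝ)) p.2 hh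
    ((contMDiff_slice_fiber hl.contMDiff p.1).mdifferentiable (by simp) p.2) w).symm

theorem mvfderiv_add_const {f : M → ℝ} {x : M} (hf : MDifferentiableAt (𝓡 n) 𝓘(ℝ, ℝ) f x)
    (c : ℝ) : mvfderiv (𝓡 n) (fun y => f y + c) x = mvfderiv (𝓡 n) f x := by
  have hadd := mvfderiv_add (I := 𝓡 n) (g := f) (g' := fun _ => c) hf mdifferentiableAt_const
  rwa [mvfderiv_const, add_zero] at hadd

theorem mvfderiv_slice_base_of_eventually_eq {p : B × F} {h : B × F → ℝ} {u : B → ℝ} {v : F → ℝ}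
    (hu : SmoothFn b u) (hsum : ∀ᶠ q in 𝓝 p, h q = u q.1 + v q.2) :
    mvfderiv (𝓡 b) (fun x => h (x, p.2)) p.1 = mvfderiv (𝓡 b) u p.1 := by
  have hslice : (fun x => h (x, p.2)) =ᶠ[𝓝 p.1] fun x => u x + v p.2 :=
    (Continuous.prodMk_left p.2).continuousAt.eventually hsum
  rw [mvfderiv_congr hslice, mvfderiv_add_const (hu.mdifferentiableAt _)]

theorem mvfderiv_slice_fiber_of_eventually_eq {p : B × F} {h : B × F → ℝ} {u : B → ℝ}
    {v : F → ℝ} (hv : SmoothFn k v) (hsum : ∀ᶠ q in 𝓝 p, h q = u q.1 + v q.2) :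
    mvfderiv (𝓡 k) (fun y => h (p.1, y)) p.2 = mvfderiv (𝓡 k) v p.2 := by
  have hslice : (fun y => h (p.1, y)) =ᶠ[𝓝 p.2] fun y => v y + u p.1 := by
    filter_upwards [(Continuous.prodMk_right p.1).continuousAt.eventually hsum] with y hy
    rw [hy, add_comm]
  rw [mvfderiv_congr hslice, mvfderiv_add_const (hv.mdifferentiableAt _)]

theorem mvfderiv_lift {p : B × F} {f : M → ℝ} {u : B → ℝ} {v : F → ℝ} (hf : SmoothFn n f)
    (hu : SmoothFn b u) (hv : SmoothFn k v) (hfe : ∀ᶠ q in 𝓝 p, f (Φ q) = u q.1 + v q.2) :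
    mvfderiv (𝓡 n) f (Φ p) = (mvfderiv (𝓡 b) u p.1).comp (projB hl p) +
      (mvfderiv (𝓡 k) v p.2).comp (projF hl p) := by
  rw [cotan_eq_comp_projB_add_comp_projF hl p (mvfderiv (𝓡 n) f (Φ p)),
    mvfderiv_inclB hl p (hf.mdifferentiableAt _), mvfderiv_inclF hl p (hf.mdifferentiableAt _),
    mvfderiv_slice_base_of_eventually_eq (h := fun q => f (Φ q)) hu hfe,
    mvfderiv_slice_fiber_of_eventually_eq (h := fun q => f (Φ q)) hv hfe]

/-! ### Components of a tensor on a product -/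

/-- The base component `L_B` of a tensor `L` at the points of `B × F`. -/
def compB (L : ContraField n M) (p : B × F) : Cotan b p.1 →ₗ[ℝ] Tan b p.1 :=
  transport (projB hl p) (L (Φ p))

/-- The fiber component `L_F` of a tensor `L` at the points of `B × F`. -/
def compF (L : ContraField n M) (p : B × F) : Cotan k p.2 →ₗ[ℝ] Tan k p.2 :=
  transport (projF hl p) (L (Φ p))

theorem compB_apply (L : ContraField n M) (p : B × F) (α : Cotan b p.1) :
    compB hl L p α = projB hl p (L (Φ p) (α.comp (projB hl p))) := rfl

theorem compF_apply (L : ContraField n M) (p : B × F) (α : Cotan k p.2) :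
    compF hl L p α = projF hl p (L (Φ p) (α.comp (projF hl p))) := rfl

theorem compB_isSymm (L : SymTensor n M) (p : B × F) : IsSymm (compB hl L.1 p) :=
  (SymTensor.isSymm L (Φ p)).transport _

theorem compF_isSymm (L : SymTensor n M) (p : B × F) : IsSymm (compF hl L.1 p) :=
  (SymTensor.isSymm L (Φ p)).transport _

/-- The function `L_B(du, du')` on `B × F`, for functions `u`, `u'` on the base. -/
def pairB (L : ContraField n M) (u u' : B → ℝ) (p : B × F) : ℝ :=
  mvfderiv (𝓡 b) u p.1 (compB hl L p (mvfderiv (𝓡 b) u' p.1))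

/-- The function `L_F(dv, dv')` on `B × F`, for functions `v`, `v'` on the fiber. -/
def pairF (L : ContraField n M) (v v' : F → ℝ) (p : B × F) : ℝ :=
  mvfderiv (𝓡 k) v p.2 (compF hl L p (mvfderiv (𝓡 k) v' p.2))

/-- A tensor splits along the product if its mixed components vanish. By symmetry only one of the
two mixed components has to be considered. -/
def Splits (L : SymTensor n M) : Prop :=
  ∀ (p : B × F) (β : Cotan k p.2), projB hl p (L.1 (Φ p) (β.comp (projF hl p))) = 0

variable {hl}

theorem Splits.projF_eq_zero {L : SymTensor n M} (hL : Splits hl L) (p : B × F)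
    (α : Cotan b p.1) : projF hl p (L.1 (Φ p) (α.comp (projB hl p))) = 0 := by
  refine cotan_ext fun β => ?_
  have hmixed : α (projB hl p (L.1 (Φ p) (β.comp (projF hl p)))) = 0 := by rw [hL p β, map_zero]
  rw [map_zero]
  exact (SymTensor.isSymm L (Φ p) (β.comp (projF hl p)) (α.comp (projB hl p))).trans hmixed

theorem Splits.apply_eq {L : SymTensor n M} (hL : Splits hl L) (p : B × F) (α : Cotan n (Φ p)) :
    L.1 (Φ p) α = inclB Φ p (compB hl L.1 p (α.comp (inclB Φ p))) +
      inclF Φ p (compF hl L.1 p (α.comp (inclF Φ p))) := by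
  conv_lhs => rw [cotan_eq_comp_projB_add_comp_projF hl p α, map_add,
    ← inclB_projB_add_inclF_projF hl p (_ + _)]
  simp only [map_add, hL p, hL.projF_eq_zero p, compB_apply, compF_apply, add_zero, zero_add]

section Lift

variable {L : SymTensor n M} {p : B × F} {f : M → ℝ} {u : B → ℝ} {v : F → ℝ}

theorem Splits.pair_lift (hL : Splits hl L) {h : M → ℝ} (hf : SmoothFn n f) (hh : SmoothFn n h)
    (hu : SmoothFn b u) (hv : SmoothFn k v) (hfe : ∀ᶠ q in 𝓝 p, f (Φ q) = u q.1 + v q.2) :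
    L.1.pair f h (Φ p) =
      mvfderiv (𝓡 b) (fun x => h (Φ (x, p.2))) p.1 (compB hl L.1 p (mvfderiv (𝓡 b) u p.1)) +
        mvfderiv (𝓡 k) (fun y => h (Φ (p.1, y))) p.2
          (compF hl L.1 p (mvfderiv (𝓡 k) v p.2)) := by
  rw [← mvfderiv_inclB hl p (hh.mdifferentiableAt _),
    ← mvfderiv_inclF hl p (hh.mdifferentiableAt _),
    ← mvfderiv_slice_base_of_eventually_eq (h := fun q => f (Φ q)) hu hfe,
    ← mvfderiv_slice_fiber_of_eventually_eq (h := fun q => f (Φ q)) hv hfe,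
    ← mvfderiv_inclB hl p (hf.mdifferentiableAt _),
    ← mvfderiv_inclF hl p (hf.mdifferentiableAt _), ContraField.pair, L.2.1, hL.apply_eq, map_add]
  rfl

theorem Splits.pair_self_lift (hL : Splits hl L) (hf : SmoothFn n f) (hu : SmoothFn b u)
    (hv : SmoothFn k v) (hfe : ∀ᶠ q in 𝓝 p, f (Φ q) = u q.1 + v q.2) :
    L.1.pair f f (Φ p) = pairB hl L.1 u u p + pairF hl L.1 v v p := by
  rw [hL.pair_lift hf hf hu hv hfe,
    mvfderiv_slice_base_of_eventually_eq (h := fun q => f (Φ q)) hu hfe,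
    mvfderiv_slice_fiber_of_eventually_eq (h := fun q => f (Φ q)) hv hfe]
  rfl

end Lift

section Smooth

variable [IsManifold (𝓡 n) ∞ M] [T2Space M]

variable (hl) in
theorem contMDiff_pairB (L : SymTensor n M) {u u' : B → ℝ} (hu : SmoothFn b u)
    (hu' : SmoothFn b u') :
    ContMDiff ((𝓡 b).prod (𝓡 k)) 𝓘(ℝ, ℝ) ∞ (pairB hl L.1 u u') := by
  intro p
  have hzero : SmoothFn k (fun _ : F => (0 : ℝ)) := contMDiff_const
  obtain ⟨f, hf, hfe⟩ := exists_smoothFn_lift_add hl p hu hzero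
  obtain ⟨f', hf', hfe'⟩ := exists_smoothFn_lift_add hl p hu' hzero
  refine ((SymTensor.smoothFn_pair L hf hf').comp hl.contMDiff).contMDiffAt
    |>.congr_of_eventuallyEq ?_
  filter_upwards [hfe.eventually_nhds, hfe'.eventually_nhds] with q hq hq'
  simp only [Function.comp, ContraField.pair, mvfderiv_lift hl hf hu hzero hq,
    mvfderiv_lift hl hf' hu' hzero hq', mvfderiv_const, ContinuousLinearMap.zero_comp, add_zero]
  rfl

variable (hl) in
theorem contMDiff_pairF (L : SymTensor n M) {v v' : F → ℝ} (hv : SmoothFn k v)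
    (hv' : SmoothFn k v') :
    ContMDiff ((𝓡 b).prod (𝓡 k)) 𝓘(ℝ, ℝ) ∞ (pairF hl L.1 v v') := by
  intro p
  have hzero : SmoothFn b (fun _ : B => (0 : ℝ)) := contMDiff_const
  obtain ⟨f, hf, hfe⟩ := exists_smoothFn_lift_add hl p hzero hv
  obtain ⟨f', hf', hfe'⟩ := exists_smoothFn_lift_add hl p hzero hv'
  refine ((SymTensor.smoothFn_pair L hf hf').comp hl.contMDiff).contMDiffAt
    |>.congr_of_eventuallyEq ?_
  filter_upwards [hfe.eventually_nhds, hfe'.eventually_nhds] with q hq hq'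
  simp only [Function.comp, ContraField.pair, mvfderiv_lift hl hf hzero hv hq,
    mvfderiv_lift hl hf' hzero hv' hq', mvfderiv_const, ContinuousLinearMap.zero_comp, zero_add]
  rfl

theorem Splits.pair_pair_lift {L T : SymTensor n M} {p : B × F} {f : M → ℝ} {u : B → ℝ}
    {v : F → ℝ} (hL : Splits hl L) (hT : Splits hl T) (hf : SmoothFn n f) (hu : SmoothFn b u)
    (hv : SmoothFn k v) (hfe : ∀ᶠ q in 𝓝 p, f (Φ q) = u q.1 + v q.2) :
    L.1.pair f (T.1.pair f f) (Φ p) =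
      (mvfderiv (𝓡 b) (fun x => pairB hl T.1 u u (x, p.2)) p.1 +
          mvfderiv (𝓡 b) (fun x => pairF hl T.1 v v (x, p.2)) p.1)
          (compB hl L.1 p (mvfderiv (𝓡 b) u p.1)) +
        (mvfderiv (𝓡 k) (fun y => pairB hl T.1 u u (p.1, y)) p.2 +
          mvfderiv (𝓡 k) (fun y => pairF hl T.1 v v (p.1, y)) p.2)
          (compF hl L.1 p (mvfderiv (𝓡 k) v p.2)) := by
  have hpair : ∀ᶠ q in 𝓝 p, T.1.pair f f (Φ q) = pairB hl T.1 u u q + pairF hl T.1 v v q := by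
    filter_upwards [hfe.eventually_nhds] with q hq using hT.pair_self_lift hf hu hv hq
  have hbase : (fun x => T.1.pair f f (Φ (x, p.2))) =ᶠ[𝓝 p.1]
      (fun x => pairB hl T.1 u u (x, p.2)) + fun x => pairF hl T.1 v v (x, p.2) :=
    (Continuous.prodMk_left p.2).continuousAt.eventually hpair
  have hfiber : (fun y => T.1.pair f f (Φ (p.1, y))) =ᶠ[𝓝 p.2]
      (fun y => pairB hl T.1 u u (p.1, y)) + fun y => pairF hl T.1 v v (p.1, y) :=
    (Continuous.prodMk_right p.1).continuousAt.eventually hpair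
  have hpairB := contMDiff_pairB hl T hu hu
  have hpairF := contMDiff_pairF hl T hv hv
  rw [hL.pair_lift hf (SymTensor.smoothFn_pair T hf hf) hu hv hfe, mvfderiv_congr hbase,
    mvfderiv_congr hfiber,
    mvfderiv_add ((smoothFn_slice_base hpairB p.2).mdifferentiableAt p.1)
      ((smoothFn_slice_base hpairF p.2).mdifferentiableAt p.1),
    mvfderiv_add ((smoothFn_slice_fiber hpairB p.1).mdifferentiableAt p.2)
      ((smoothFn_slice_fiber hpairF p.1).mdifferentiableAt p.2)]

/-- The base component of `L` along the slice `B × {y}`, as a tensor field on `B`. -/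
def toB (hl : IsLocalDiffeomorph ((𝓡 b).prod (𝓡 k)) (𝓡 n) ∞ Φ) (y : F) (L : SymTensor n M) :
    SymTensor b B :=
  ⟨fun x => compB hl L.1 (x, y), fun x => compB_isSymm hl L (x, y), fun _ _ hu hu' =>
    smoothFn_slice_base (contMDiff_pairB hl L hu hu') y⟩

/-- The fiber component of `L` along the slice `{x} × F`, as a tensor field on `F`. -/
def toF (hl : IsLocalDiffeomorph ((𝓡 b).prod (𝓡 k)) (𝓡 n) ∞ Φ) (x : B) (L : SymTensor n M) :
    SymTensor k F :=
  ⟨fun y => compF hl L.1 (x, y), fun y => compF_isSymm hl L (x, y), fun _ _ hv hv' =>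
    smoothFn_slice_fiber (contMDiff_pairF hl L hv hv') x⟩

end Smooth

end Product

/-! ### Warped products -/

section Warped

variable {n b k : ℕ}
  {M : Type*} [TopologicalSpace M] [ChartedSpace (EuclideanSpace ℝ (Fin n)) M]
  {B : Type*} [TopologicalSpace B] [ChartedSpace (EuclideanSpace ℝ (Fin b)) B]
  {F : Type*} [TopologicalSpace F] [ChartedSpace (EuclideanSpace ℝ (Fin k)) F]
  [IsManifold (𝓡 n) ∞ M] [IsManifold (𝓡 b) ∞ B] [IsManifold (𝓡 k) ∞ F]

/-- `Φ : B × F → M` is a local isometry from the warped product `B ×_ρ F` to `M`. In contrast to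
`IsAdaptedWarpedProduct`, it need not be injective and no distribution on `M` is involved. -/
structure IsLocalWarpedProduct (g : PseudoRiemannianMetric n M) (gB : PseudoRiemannianMetric b B)
    (gF : PseudoRiemannianMetric k F) (ρ : B → ℝ) (Φ : B × F → M) : Prop where
  warp_smooth : SmoothFn b ρ
  warp_pos : ∀ x, 0 < ρ x
  localDiffeo : IsLocalDiffeomorph ((𝓡 b).prod (𝓡 k)) (𝓡 n) ∞ Φ
  metric : ∀ (p : B × F) (u v : TangentSpace ((𝓡 b).prod (𝓡 k)) p),
    g.val (Φ p) (mfderiv ((𝓡 b).prod (𝓡 k)) (𝓡 n) Φ p u)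
        (mfderiv ((𝓡 b).prod (𝓡 k)) (𝓡 n) Φ p v) =
      gB.val p.1 (mfderiv ((𝓡 b).prod (𝓡 k)) (𝓡 b) Prod.fst p u)
          (mfderiv ((𝓡 b).prod (𝓡 k)) (𝓡 b) Prod.fst p v) +
        ρ p.1 ^ 2 * gF.val p.2 (mfderiv ((𝓡 b).prod (𝓡 k)) (𝓡 k) Prod.snd p u)
          (mfderiv ((𝓡 b).prod (𝓡 k)) (𝓡 k) Prod.snd p v)

variable {g : PseudoRiemannianMetric n M} {gB : PseudoRiemannianMetric b B}
  {gF : PseudoRiemannianMetric k F} {ρ : B → ℝ} {Φ : B × F → M}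

theorem IsAdaptedWarpedProduct.isLocalWarpedProduct {D : ∀ x : M, Submodule ℝ (Tan n x)}
    (hΦ : IsAdaptedWarpedProduct g D gB gF ρ Φ) : IsLocalWarpedProduct g gB gF ρ Φ :=
  ⟨hΦ.warp_smooth, hΦ.warp_pos, hΦ.localDiffeo, hΦ.metric⟩

theorem IsAdaptedWarpedProduct.exists_endo_inclF_eq {D : ∀ x : M, Submodule ℝ (Tan n x)}
    (hΦ : IsAdaptedWarpedProduct g D gB gF ρ Φ) {K : SymTensor n M} (hK : IsInvariant g K D)
    (p : B × F) (w : Tan k p.2) :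
    ∃ w' : Tan k p.2, endo g K.1 (Φ p) (inclF Φ p w) = inclF Φ p w' := by
  have hfiber (v : Tan n (Φ p)) : v ∈ D (Φ p) ↔ ∃ w, inclF Φ p w = v :=
    (SetLike.ext_iff.1 (hΦ.tangent_fiber p.1 p.2) v).trans LinearMap.mem_range
  obtain ⟨w', hw'⟩ := (hfiber _).1 (hK (Φ p) _ ((hfiber _).2 ⟨w, rfl⟩))
  exact ⟨w', hw'.symm⟩

namespace IsLocalWarpedProduct

variable (hΦ : IsLocalWarpedProduct g gB gF ρ Φ)

theorem flat_eq (p : B × F) (v : Tan n (Φ p)) :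
    g.flat (Φ p) v =
      (gB.flat p.1 (projB hΦ.localDiffeo p v)).comp (projB hΦ.localDiffeo p) +
      ρ p.1 ^ 2 • (gF.flat p.2 (projF hΦ.localDiffeo p v)).comp (projF hΦ.localDiffeo p) := by
  obtain ⟨v, rfl⟩ := (diffEquiv hΦ.localDiffeo p).surjective v
  ext w
  obtain ⟨w, rfl⟩ := (diffEquiv hΦ.localDiffeo p).surjective w
  simp only [projB, projF, add_apply, smul_apply,
    ContinuousLinearMap.comp_apply]
  erw [ContinuousLinearEquiv.symm_apply_apply, ContinuousLinearEquiv.symm_apply_apply]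
  exact hΦ.metric p v w

theorem warp_sq_ne_zero (hΦ : IsLocalWarpedProduct g gB gF ρ Φ) (x : B) : ρ x ^ 2 ≠ 0 :=
  pow_ne_zero 2 (hΦ.warp_pos x).ne'

theorem smoothFn_inv_sq (hΦ : IsLocalWarpedProduct g gB gF ρ Φ) :
    SmoothFn b (fun x => (ρ x ^ 2)⁻¹) :=
  fun x => ((hΦ.warp_smooth x).pow 2).inv₀ (hΦ.warp_sq_ne_zero x)

section Splits

variable {K L : SymTensor n M}

theorem projB_endo (hL : Splits hΦ.localDiffeo L) (p : B × F) (v : Tan n (Φ p)) :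
    projB hΦ.localDiffeo p (endo g L.1 (Φ p) v) =
      compB hΦ.localDiffeo L.1 p (gB.flat p.1 (projB hΦ.localDiffeo p v)) := by
  simp only [endo, LinearMap.comp_apply, LinearEquiv.coe_coe, hΦ.flat_eq, map_add, map_smul,
    hL p, smul_zero, add_zero, compB_apply]

theorem projF_endo (hL : Splits hΦ.localDiffeo L) (p : B × F) (v : Tan n (Φ p)) :
    projF hΦ.localDiffeo p (endo g L.1 (Φ p) v) =
      ρ p.1 ^ 2 • compF hΦ.localDiffeo L.1 p (gF.flat p.2 (projF hΦ.localDiffeo p v)) := by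
  simp only [endo, LinearMap.comp_apply, LinearEquiv.coe_coe, hΦ.flat_eq, map_add, map_smul,
    hL.projF_eq_zero p, zero_add, compF_apply]

theorem endo_inclB (hL : Splits hΦ.localDiffeo L) (p : B × F) (u : Tan b p.1) :
    endo g L.1 (Φ p) (inclB Φ p u) =
      inclB Φ p (compB hΦ.localDiffeo L.1 p (gB.flat p.1 u)) := by
  rw [← inclB_projB_add_inclF_projF hΦ.localDiffeo p (endo g L.1 (Φ p) (inclB Φ p u)),
    hΦ.projB_endo hL, hΦ.projF_endo hL]
  simp

theorem endo_inclF (hL : Splits hΦ.localDiffeo L) (p : B × F) (w : Tan k p.2) :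
    endo g L.1 (Φ p) (inclF Φ p w) =
      ρ p.1 ^ 2 • inclF Φ p (compF hΦ.localDiffeo L.1 p (gF.flat p.2 w)) := by
  rw [← inclB_projB_add_inclF_projF hΦ.localDiffeo p (endo g L.1 (Φ p) (inclF Φ p w)),
    hΦ.projB_endo hL, hΦ.projF_endo hL]
  simp

theorem endo_inclB_projB (hL : Splits hΦ.localDiffeo L) (p : B × F) (v : Tan n (Φ p)) :
    endo g L.1 (Φ p) (inclB Φ p (projB hΦ.localDiffeo p v)) =
      inclB Φ p (projB hΦ.localDiffeo p (endo g L.1 (Φ p) v)) := by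
  rw [hΦ.endo_inclB hL, hΦ.projB_endo hL]

theorem endo_inclF_projF (hL : Splits hΦ.localDiffeo L) (p : B × F) (v : Tan n (Φ p)) :
    endo g L.1 (Φ p) (inclF Φ p (projF hΦ.localDiffeo p v)) =
      inclF Φ p (projF hΦ.localDiffeo p (endo g L.1 (Φ p) v)) := by
  rw [hΦ.endo_inclF hL, hΦ.projF_endo hL, map_smul]

theorem splits_of_projB_endo_inclF
    (h : ∀ (p : B × F) (w : Tan k p.2),
      projB hΦ.localDiffeo p (endo g L.1 (Φ p) (inclF Φ p w)) = 0) :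
    Splits hΦ.localDiffeo L := by
  intro p β
  obtain ⟨w, rfl⟩ := (gF.flat p.2).surjective β
  have hscaled := h p w
  simp only [endo, LinearMap.comp_apply, LinearEquiv.coe_coe, hΦ.flat_eq, projB_inclF,
    projF_inclF, map_zero, ContinuousLinearMap.zero_comp, zero_add, map_smul] at hscaled
  exact (smul_eq_zero.1 hscaled).resolve_left (hΦ.warp_sq_ne_zero p.1)

theorem splits_of_exists_endo_inclF_eq
    (h : ∀ (p : B × F) (w : Tan k p.2), ∃ w' : Tan k p.2,
      endo g L.1 (Φ p) (inclF Φ p w) = inclF Φ p w') :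
    Splits hΦ.localDiffeo L := by
  refine hΦ.splits_of_projB_endo_inclF fun p w => ?_
  obtain ⟨w', hw'⟩ := h p w
  rw [hw', projB_inclF]

theorem splits_of_isDiagonalFor (hsimple : ∀ x : M, HasSimpleEigenvalues g K.1 x)
    (hK : Splits hΦ.localDiffeo K) (hL : IsDiagonalFor g K.1 L.1) : Splits hΦ.localDiffeo L := by
  refine hΦ.splits_of_projB_endo_inclF fun p w => ?_
  obtain ⟨e, μ, -, he⟩ := hsimple (Φ p)
  have hmixed : (projB hΦ.localDiffeo p).toLinearMap ∘ₗ endo g L.1 (Φ p) ∘ₗ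
      (inclF Φ p).toLinearMap ∘ₗ (projF hΦ.localDiffeo p).toLinearMap = 0 := by
    refine e.ext fun i => ?_
    obtain ⟨ν, hν⟩ := hL (Φ p) (inclF Φ p (projF hΦ.localDiffeo p (e i))) (μ i)
      (by rw [hΦ.endo_inclF_projF hK, he, map_smul, map_smul])
    change projB hΦ.localDiffeo p
      (endo g L.1 (Φ p) (inclF Φ p (projF hΦ.localDiffeo p (e i)))) = 0
    rw [hν, map_smul, projB_inclF, smul_zero]
  simpa using LinearMap.congr_fun hmixed (inclF Φ p w)

theorem projB_eq_zero_or_projF_eq_zero (hsimple : ∀ x : M, HasSimpleEigenvalues g K.1 x)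
    (hK : Splits hΦ.localDiffeo K) {p : B × F} {v : Tan n (Φ p)} {μ : ℝ}
    (hv : endo g K.1 (Φ p) v = μ • v) :
    projB hΦ.localDiffeo p v = 0 ∨ projF hΦ.localDiffeo p v = 0 := by
  obtain rfl | hv0 := eq_or_ne v 0
  · exact Or.inl (map_zero _)
  obtain ⟨e, r, hr, he⟩ := hsimple (Φ p)
  obtain ⟨c, hc⟩ := exists_eq_smul_of_eigenvector he hr hv
    (w := inclB Φ p (projB hΦ.localDiffeo p v))
    (by rw [hΦ.endo_inclB_projB hK, hv, map_smul, map_smul]) hv0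
  have hprojB : projB hΦ.localDiffeo p v = c • projB hΦ.localDiffeo p v := by
    simpa using congrArg (projB hΦ.localDiffeo p) hc
  have hprojF : 0 = c • projF hΦ.localDiffeo p v := by
    simpa only [projF_inclB, map_smul] using congrArg (projF hΦ.localDiffeo p) hc
  rcases smul_eq_zero.1 hprojF.symm with rfl | hF
  · exact Or.inl (hprojB.trans (zero_smul _ _))
  · exact Or.inr hF

end Splits

theorem splits_contraTensor : Splits hΦ.localDiffeo g.contraTensor :=
  hΦ.splits_of_projB_endo_inclF fun p w => by
    rw [show endo g g.contraTensor.1 (Φ p) = LinearMap.id from endo_contra (Φ p),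
      LinearMap.id_apply, projB_inclF]

theorem compB_contraTensor (p : B × F) :
    compB hΦ.localDiffeo g.contraTensor.1 p = gB.contra p.1 := by
  refine LinearMap.ext fun α => ?_
  obtain ⟨u, rfl⟩ := (gB.flat p.1).surjective α
  have hendo := hΦ.projB_endo hΦ.splits_contraTensor p (inclB Φ p u)
  rw [show endo g g.contraTensor.1 (Φ p) = LinearMap.id from endo_contra (Φ p),
    LinearMap.id_apply, projB_inclB] at hendo
  rw [← hendo]
  exact ((gB.flat p.1).symm_apply_apply u).symm

theorem compF_contraTensor (p : B × F) :
    compF hΦ.localDiffeo g.contraTensor.1 p = (ρ p.1 ^ 2)⁻¹ • gF.contra p.2 := by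
  refine LinearMap.ext fun β => ?_
  obtain ⟨w, rfl⟩ := (gF.flat p.2).surjective β
  have hendo := hΦ.projF_endo hΦ.splits_contraTensor p (inclF Φ p w)
  rw [show endo g g.contraTensor.1 (Φ p) = LinearMap.id from endo_contra (Φ p),
    LinearMap.id_apply, projF_inclF] at hendo
  have hcontra : gF.contra p.2 (gF.flat p.2 w) = w := (gF.flat p.2).symm_apply_apply w
  rw [LinearMap.smul_apply, hcontra, eq_inv_smul_iff₀ (hΦ.warp_sq_ne_zero p.1), ← hendo]

end IsLocalWarpedProduct

end Warped

/-! ### The Killing equation on a warped product -/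

section Decomposition

variable {n b k : ℕ}
  {M : Type*} [TopologicalSpace M] [ChartedSpace (EuclideanSpace ℝ (Fin n)) M]
  {B : Type*} [TopologicalSpace B] [ChartedSpace (EuclideanSpace ℝ (Fin b)) B]
  {F : Type*} [TopologicalSpace F] [ChartedSpace (EuclideanSpace ℝ (Fin k)) F]
  [IsManifold (𝓡 n) ∞ M] [IsManifold (𝓡 b) ∞ B] [IsManifold (𝓡 k) ∞ F]
  {g : PseudoRiemannianMetric n M} {gB : PseudoRiemannianMetric b B}
  {gF : PseudoRiemannianMetric k F} {ρ : B → ℝ} {Φ : B × F → M}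
  {L : SymTensor n M} {u : B → ℝ} {v : F → ℝ}

theorem exists_pair_contra_ne_zero [T2Space F] (hk : 0 < k) (gF : PseudoRiemannianMetric k F)
    (y : F) : ∃ v : F → ℝ, SmoothFn k v ∧ gF.contra.pair v v y ≠ 0 := by
  by_contra! hnull
  have hcontra : gF.contra y = 0 :=
    (gF.contra_isSymm y).ext_mvfderiv (fun α β => (map_zero α).trans (map_zero β).symm)
      fun v hv => (hnull v hv).trans (map_zero _).symm
  have : Nontrivial (Tan k y) :=
    Module.nontrivial_of_finrank_pos (R := ℝ) (by rwa [finrank_tan])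
  obtain ⟨w, hw⟩ := exists_ne (0 : Tan k y)
  have hw' : gF.contra y (gF.flat y w) = w := (gF.flat y).symm_apply_apply w
  exact hw (by rw [← hw', hcontra, LinearMap.zero_apply])

namespace IsLocalWarpedProduct

theorem pairB_contraTensor (hΦ : IsLocalWarpedProduct g gB gF ρ Φ) (u : B → ℝ) (p : B × F) :
    pairB hΦ.localDiffeo g.contraTensor.1 u u p = gB.contra.pair u u p.1 := by
  rw [pairB, hΦ.compB_contraTensor]
  rfl

theorem pairF_contraTensor (hΦ : IsLocalWarpedProduct g gB gF ρ Φ) (v : F → ℝ) (p : B × F) :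
    pairF hΦ.localDiffeo g.contraTensor.1 v v p = (ρ p.1 ^ 2)⁻¹ * gF.contra.pair v v p.2 := by
  rw [pairF, hΦ.compF_contraTensor, LinearMap.smul_apply, map_smul]
  rfl

variable [T2Space M]

/-- The equation `[L, G] = 0` evaluated on the differential of `u + v`. -/
theorem killing_identity (hΦ : IsLocalWarpedProduct g gB gF ρ Φ)
    (hL : Splits hΦ.localDiffeo L) (hkilling : IsKilling g L) (hu : SmoothFn b u)
    (hv : SmoothFn k v) (p : B × F) :
    mvfderiv (𝓡 b) (gB.contra.pair u u) p.1
        (compB hΦ.localDiffeo L.1 p (mvfderiv (𝓡 b) u p.1)) +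
      gF.contra.pair v v p.2 * mvfderiv (𝓡 b) (fun x => (ρ x ^ 2)⁻¹) p.1
        (compB hΦ.localDiffeo L.1 p (mvfderiv (𝓡 b) u p.1)) +
      (ρ p.1 ^ 2)⁻¹ * mvfderiv (𝓡 k) (gF.contra.pair v v) p.2
        (compF hΦ.localDiffeo L.1 p (mvfderiv (𝓡 k) v p.2)) =
    mvfderiv (𝓡 b) (fun x => pairB hΦ.localDiffeo L.1 u u (x, p.2)) p.1
        (gB.contra p.1 (mvfderiv (𝓡 b) u p.1)) +
      mvfderiv (𝓡 b) (fun x => pairF hΦ.localDiffeo L.1 v v (x, p.2)) p.1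
        (gB.contra p.1 (mvfderiv (𝓡 b) u p.1)) +
      (ρ p.1 ^ 2)⁻¹ * mvfderiv (𝓡 k) (fun y => pairB hΦ.localDiffeo L.1 u u (p.1, y)) p.2
        (gF.contra p.2 (mvfderiv (𝓡 k) v p.2)) +
      (ρ p.1 ^ 2)⁻¹ * mvfderiv (𝓡 k) (fun y => pairF hΦ.localDiffeo L.1 v v (p.1, y)) p.2
        (gF.contra p.2 (mvfderiv (𝓡 k) v p.2)) := by
  obtain ⟨f, hf, hfe⟩ := exists_smoothFn_lift_add hΦ.localDiffeo p hu hv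
  have hbracket : schouten L.1 g.contraTensor.1 f (Φ p) = 0 := hkilling f hf (Φ p)
  have hwarp : mvfderiv (𝓡 b) (fun x => (ρ x ^ 2)⁻¹ * gF.contra.pair v v p.2) p.1 =
      gF.contra.pair v v p.2 • mvfderiv (𝓡 b) (fun x => (ρ x ^ 2)⁻¹) p.1 := by
    simp only [mul_comm _ (gF.contra.pair v v p.2)]
    exact mvfderiv_const_mul _ (hΦ.smoothFn_inv_sq.mdifferentiableAt _)
  have hfiber : mvfderiv (𝓡 k) (fun y => (ρ p.1 ^ 2)⁻¹ * gF.contra.pair v v y) p.2 =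
      (ρ p.1 ^ 2)⁻¹ • mvfderiv (𝓡 k) (gF.contra.pair v v) p.2 :=
    mvfderiv_const_mul _ ((gF.smoothFn_pair_contra hv hv).mdifferentiableAt _)
  rw [schouten, hL.pair_pair_lift hΦ.splits_contraTensor hf hu hv hfe,
    hΦ.splits_contraTensor.pair_pair_lift hL hf hu hv hfe] at hbracket
  simp only [hΦ.pairB_contraTensor, hΦ.pairF_contraTensor, hΦ.compB_contraTensor,
    hΦ.compF_contraTensor, hwarp, hfiber, mvfderiv_const, LinearMap.smul_apply, add_apply,
    smul_apply, map_smul, smul_eq_mul, zero_apply] at hbracket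
  linarith

theorem killing_base (hΦ : IsLocalWarpedProduct g gB gF ρ Φ) (hL : Splits hΦ.localDiffeo L)
    (hkilling : IsKilling g L) (hu : SmoothFn b u) (p : B × F) :
    mvfderiv (𝓡 b) (gB.contra.pair u u) p.1
        (compB hΦ.localDiffeo L.1 p (mvfderiv (𝓡 b) u p.1)) =
      mvfderiv (𝓡 b) (fun x => pairB hΦ.localDiffeo L.1 u u (x, p.2)) p.1
        (gB.contra p.1 (mvfderiv (𝓡 b) u p.1)) := by
  have h := hΦ.killing_identity hL hkilling (v := fun _ => 0) hu contMDiff_const p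
  simpa only [ContraField.pair, pairF, mvfderiv_const, map_zero, zero_mul, mul_zero, add_zero,
    zero_apply] using h

theorem killing_fiber (hΦ : IsLocalWarpedProduct g gB gF ρ Φ) (hL : Splits hΦ.localDiffeo L)
    (hkilling : IsKilling g L) (hv : SmoothFn k v) (p : B × F) :
    mvfderiv (𝓡 k) (gF.contra.pair v v) p.2
        (compF hΦ.localDiffeo L.1 p (mvfderiv (𝓡 k) v p.2)) =
      mvfderiv (𝓡 k) (fun y => pairF hΦ.localDiffeo L.1 v v (p.1, y)) p.2
        (gF.contra p.2 (mvfderiv (𝓡 k) v p.2)) := by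
  have h := hΦ.killing_identity hL hkilling (u := fun _ => 0) contMDiff_const hv p
  simp only [pairB, mvfderiv_const, map_zero, mul_zero, zero_add, add_zero, zero_apply] at h
  exact mul_left_cancel₀ (inv_ne_zero (hΦ.warp_sq_ne_zero p.1)) h

theorem killing_mixed (hΦ : IsLocalWarpedProduct g gB gF ρ Φ) (hL : Splits hΦ.localDiffeo L)
    (hkilling : IsKilling g L) (hu : SmoothFn b u) (hv : SmoothFn k v) (p : B × F) :
    gF.contra.pair v v p.2 * mvfderiv (𝓡 b) (fun x => (ρ x ^ 2)⁻¹) p.1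
        (compB hΦ.localDiffeo L.1 p (mvfderiv (𝓡 b) u p.1)) =
      mvfderiv (𝓡 b) (fun x => pairF hΦ.localDiffeo L.1 v v (x, p.2)) p.1
        (gB.contra p.1 (mvfderiv (𝓡 b) u p.1)) +
      (ρ p.1 ^ 2)⁻¹ * mvfderiv (𝓡 k) (fun y => pairB hΦ.localDiffeo L.1 u u (p.1, y)) p.2
        (gF.contra p.2 (mvfderiv (𝓡 k) v p.2)) := by
  have h := hΦ.killing_identity hL hkilling hu hv p
  rw [hΦ.killing_base hL hkilling hu p, hΦ.killing_fiber hL hkilling hv p] at h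
  linarith

-- The mixed terms are separated by parity in `u`.
theorem killing_mixed_odd (hΦ : IsLocalWarpedProduct g gB gF ρ Φ)
    (hL : Splits hΦ.localDiffeo L) (hkilling : IsKilling g L) (hu : SmoothFn b u)
    (hv : SmoothFn k v) (p : B × F) :
    gF.contra.pair v v p.2 * mvfderiv (𝓡 b) (fun x => (ρ x ^ 2)⁻¹) p.1
        (compB hΦ.localDiffeo L.1 p (mvfderiv (𝓡 b) u p.1)) =
      mvfderiv (𝓡 b) (fun x => pairF hΦ.localDiffeo L.1 v v (x, p.2)) p.1
        (gB.contra p.1 (mvfderiv (𝓡 b) u p.1)) := by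
  have hpos := hΦ.killing_mixed hL hkilling hu hv p
  have hneg := hΦ.killing_mixed hL hkilling (u := -u) hu.neg hv p
  simp only [pairB, mvfderiv_neg, map_neg, neg_apply, neg_neg, mul_neg] at hpos hneg
  linarith

theorem killing_mixed_even (hΦ : IsLocalWarpedProduct g gB gF ρ Φ)
    (hL : Splits hΦ.localDiffeo L) (hkilling : IsKilling g L) (hu : SmoothFn b u)
    (hv : SmoothFn k v) (p : B × F) :
    mvfderiv (𝓡 k) (fun y => pairB hΦ.localDiffeo L.1 u u (p.1, y)) p.2
      (gF.contra p.2 (mvfderiv (𝓡 k) v p.2)) = 0 := by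
  have h := hΦ.killing_mixed hL hkilling hu hv p
  rw [hΦ.killing_mixed_odd hL hkilling hu hv p, left_eq_add] at h
  exact (mul_eq_zero.1 h).resolve_left (inv_ne_zero (hΦ.warp_sq_ne_zero p.1))

theorem isKilling_toB (hΦ : IsLocalWarpedProduct g gB gF ρ Φ) (hL : Splits hΦ.localDiffeo L)
    (hkilling : IsKilling g L) (y : F) : IsKilling gB (toB hΦ.localDiffeo y L) := by
  intro u hu x
  have hleft : (toB hΦ.localDiffeo y L).1.pair u (gB.contra.pair u u) x =
      mvfderiv (𝓡 b) (gB.contra.pair u u) x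
        (compB hΦ.localDiffeo L.1 (x, y) (mvfderiv (𝓡 b) u x)) :=
    compB_isSymm hΦ.localDiffeo L (x, y) _ _
  have hright : gB.contra.pair u ((toB hΦ.localDiffeo y L).1.pair u u) x =
      mvfderiv (𝓡 b) (fun x => pairB hΦ.localDiffeo L.1 u u (x, y)) x
        (gB.contra x (mvfderiv (𝓡 b) u x)) :=
    gB.contra_isSymm x _ _
  rw [schouten, hleft, hright, hΦ.killing_base hL hkilling hu (x, y), sub_self, mul_zero]

theorem isKilling_toF (hΦ : IsLocalWarpedProduct g gB gF ρ Φ) (hL : Splits hΦ.localDiffeo L)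
    (hkilling : IsKilling g L) (x : B) : IsKilling gF (toF hΦ.localDiffeo x L) := by
  intro v hv y
  have hleft : (toF hΦ.localDiffeo x L).1.pair v (gF.contra.pair v v) y =
      mvfderiv (𝓡 k) (gF.contra.pair v v) y
        (compF hΦ.localDiffeo L.1 (x, y) (mvfderiv (𝓡 k) v y)) :=
    compF_isSymm hΦ.localDiffeo L (x, y) _ _
  have hright : gF.contra.pair v ((toF hΦ.localDiffeo x L).1.pair v v) y =
      mvfderiv (𝓡 k) (fun y => pairF hΦ.localDiffeo L.1 v v (x, y)) y
        (gF.contra y (mvfderiv (𝓡 k) v y)) :=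
    gF.contra_isSymm y _ _
  rw [schouten, hleft, hright, hΦ.killing_fiber hL hkilling hv (x, y), sub_self, mul_zero]

theorem mvfderiv_pairF [T2Space B] (hΦ : IsLocalWarpedProduct g gB gF ρ Φ)
    (hL : Splits hΦ.localDiffeo L) (hkilling : IsKilling g L) (hv : SmoothFn k v) (x : B)
    (y : F) :
    mvfderiv (𝓡 b) (fun x => pairF hΦ.localDiffeo L.1 v v (x, y)) x =
      gF.contra.pair v v y • gB.flat x (compB hΦ.localDiffeo L.1 (x, y)
        (mvfderiv (𝓡 b) (fun x => (ρ x ^ 2)⁻¹) x)) := by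
  ext w
  obtain ⟨u, hu, huw⟩ := exists_smoothFn_mvfderiv_eq x (gB.flat x w)
  have hw : gB.contra x (mvfderiv (𝓡 b) u x) = w := by
    rw [huw]
    exact (gB.flat x).symm_apply_apply w
  have hsymm : mvfderiv (𝓡 b) (fun x => (ρ x ^ 2)⁻¹) x
      (compB hΦ.localDiffeo L.1 (x, y) (mvfderiv (𝓡 b) u x)) =
      gB.flat x (compB hΦ.localDiffeo L.1 (x, y)
        (mvfderiv (𝓡 b) (fun x => (ρ x ^ 2)⁻¹) x)) w := by
    rw [compB_isSymm hΦ.localDiffeo L (x, y), huw]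
    exact gB.symm x _ _
  have hodd := hΦ.killing_mixed_odd hL hkilling hu hv (x, y)
  rw [hw] at hodd
  rw [smul_apply, smul_eq_mul, ← hsymm]
  exact hodd.symm

theorem mvfderiv_pairB_fiber [T2Space F] (hΦ : IsLocalWarpedProduct g gB gF ρ Φ)
    (hL : Splits hΦ.localDiffeo L) (hkilling : IsKilling g L) (hu : SmoothFn b u) (x : B)
    (y : F) : mvfderiv (𝓡 k) (fun y => pairB hΦ.localDiffeo L.1 u u (x, y)) y = 0 := by
  ext w
  obtain ⟨v, hv, hvw⟩ := exists_smoothFn_mvfderiv_eq y (gF.flat y w)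
  have hw : gF.contra y (mvfderiv (𝓡 k) v y) = w := by
    rw [hvw]
    exact (gF.flat y).symm_apply_apply w
  have heven := hΦ.killing_mixed_even hL hkilling hu hv (x, y)
  rwa [hw] at heven

theorem pairF_eq_add [T2Space B] [PreconnectedSpace B]
    (hΦ : IsLocalWarpedProduct g gB gF ρ Φ) (hL : Splits hΦ.localDiffeo L)
    (hkilling : IsKilling g L) (hv : SmoothFn k v) {l : B → ℝ} (hl : SmoothFn b l) {x₀ : B}
    (hlx₀ : l x₀ = 0) {y : F}
    (hdl : ∀ x, mvfderiv (𝓡 b) l x = gB.flat x (compB hΦ.localDiffeo L.1 (x, y)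
      (mvfderiv (𝓡 b) (fun x' => (ρ x' ^ 2)⁻¹) x))) (x : B) :
    pairF hΦ.localDiffeo L.1 v v (x, y) =
      l x * gF.contra.pair v v y + pairF hΦ.localDiffeo L.1 v v (x₀, y) := by
  have hpair : SmoothFn b (fun x => pairF hΦ.localDiffeo L.1 v v (x, y)) :=
    smoothFn_slice_base (contMDiff_pairF hΦ.localDiffeo L hv hv) y
  have hscaled : SmoothFn b (fun x => -gF.contra.pair v v y * l x) := contMDiff_const.mul hl
  have hconst := eq_of_mvfderiv_eq_zero (f := (fun x => pairF hΦ.localDiffeo L.1 v v (x, y)) +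
    fun x => -gF.contra.pair v v y * l x)
    (fun z => (hpair.mdifferentiableAt z).add (hscaled.mdifferentiableAt z)) (fun z => by
      rw [mvfderiv_add (hpair.mdifferentiableAt z) (hscaled.mdifferentiableAt z),
        mvfderiv_const_mul _ (hl.mdifferentiableAt z), hΦ.mvfderiv_pairF hL hkilling hv, hdl z,
        neg_smul, add_neg_cancel]) x x₀
  simp only [Pi.add_apply, hlx₀, mul_zero, add_zero] at hconst
  linarith

section Connected

variable [T2Space B] [T2Space F] [PreconnectedSpace F]

theorem compB_eq_compB (hΦ : IsLocalWarpedProduct g gB gF ρ Φ) (hL : Splits hΦ.localDiffeo L)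
    (hkilling : IsKilling g L) (x : B) (y y' : F) :
    compB hΦ.localDiffeo L.1 (x, y) = compB hΦ.localDiffeo L.1 (x, y') :=
  (compB_isSymm hΦ.localDiffeo L (x, y)).ext_mvfderiv (compB_isSymm hΦ.localDiffeo L (x, y'))
    fun _ hu => eq_of_mvfderiv_eq_zero
      (smoothFn_slice_fiber (contMDiff_pairB hΦ.localDiffeo L hu hu) x).mdifferentiableAt
      (hΦ.mvfderiv_pairB_fiber hL hkilling hu x) y y'

theorem exists_mvfderiv_eq_flat_compB (hΦ : IsLocalWarpedProduct g gB gF ρ Φ) (hk : 0 < k)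
    (hL : Splits hΦ.localDiffeo L) (hkilling : IsKilling g L) (x₀ : B) (y₀ : F) :
    ∃ l : B → ℝ, SmoothFn b l ∧ l x₀ = 0 ∧ ∀ x y, mvfderiv (𝓡 b) l x =
      gB.flat x (compB hΦ.localDiffeo L.1 (x, y)
        (mvfderiv (𝓡 b) (fun x' => (ρ x' ^ 2)⁻¹) x)) := by
  obtain ⟨v₀, hv₀, hne⟩ := exists_pair_contra_ne_zero hk gF y₀
  have hpair : SmoothFn b (fun x => pairF hΦ.localDiffeo L.1 v₀ v₀ (x, y₀)) :=
    smoothFn_slice_base (contMDiff_pairF hΦ.localDiffeo L hv₀ hv₀) y₀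
  have hshift : SmoothFn b (fun x => pairF hΦ.localDiffeo L.1 v₀ v₀ (x, y₀) +
      -pairF hΦ.localDiffeo L.1 v₀ v₀ (x₀, y₀)) := hpair.add contMDiff_const
  refine ⟨fun x => (gF.contra.pair v₀ v₀ y₀)⁻¹ * (pairF hΦ.localDiffeo L.1 v₀ v₀ (x, y₀) +
    -pairF hΦ.localDiffeo L.1 v₀ v₀ (x₀, y₀)), contMDiff_const.mul hshift,
    by simp only [add_neg_cancel, mul_zero], fun x y => ?_⟩
  rw [mvfderiv_const_mul _ (hshift.mdifferentiableAt x),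
    mvfderiv_add_const (hpair.mdifferentiableAt x), hΦ.mvfderiv_pairF hL hkilling hv₀, smul_smul,
    inv_mul_cancel₀ hne, one_smul, hΦ.compB_eq_compB hL hkilling x y₀ y]

theorem exists_compF_eq_add [PreconnectedSpace B] (hΦ : IsLocalWarpedProduct g gB gF ρ Φ)
    (hk : 0 < k) (hL : Splits hΦ.localDiffeo L) (hkilling : IsKilling g L) (x₀ : B) (y₀ : F) :
    ∃ l : B → ℝ, SmoothFn b l ∧ l x₀ = 0 ∧
      (∀ x y, compF hΦ.localDiffeo L.1 (x, y) =
        l x • gF.contra y + compF hΦ.localDiffeo L.1 (x₀, y)) ∧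
      ∀ x, mvfderiv (𝓡 b) l x = gB.flat x ((toB hΦ.localDiffeo y₀ L).1 x
        (mvfderiv (𝓡 b) (fun x' => (ρ x' ^ 2)⁻¹) x)) := by
  obtain ⟨l, hl, hlx₀, hdl⟩ := hΦ.exists_mvfderiv_eq_flat_compB hk hL hkilling x₀ y₀
  refine ⟨l, hl, hlx₀, fun x y => ?_, fun x => hdl x y₀⟩
  exact (compF_isSymm hΦ.localDiffeo L (x, y)).ext_mvfderiv
    (((gF.contra_isSymm y).smul (l x)).add (compF_isSymm hΦ.localDiffeo L (x₀, y)))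
    fun v hv => by
      have hpair := hΦ.pairF_eq_add hL hkilling hv hl hlx₀ (fun x => hdl x y) x
      simpa only [pairF, ContraField.pair, LinearMap.add_apply, LinearMap.smul_apply, map_add,
        map_smul, smul_eq_mul] using hpair

end Connected

end IsLocalWarpedProduct

end Decomposition

/-! ### The Killing–Stäckel spaces of the base and the fiber -/

section Factors

variable {n b k : ℕ}
  {M : Type*} [TopologicalSpace M] [ChartedSpace (EuclideanSpace ℝ (Fin n)) M]
  {B : Type*} [TopologicalSpace B] [ChartedSpace (EuclideanSpace ℝ (Fin b)) B]
  {F : Type*} [TopologicalSpace F] [ChartedSpace (EuclideanSpace ℝ (Fin k)) F]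
  [IsManifold (𝓡 n) ∞ M] {g : PseudoRiemannianMetric n M} {Φ : B × F → M}

section Intertwines

variable {m : ℕ} {N : Type*} [TopologicalSpace N] [ChartedSpace (EuclideanSpace ℝ (Fin m)) N]
  [IsManifold (𝓡 m) ∞ N] {K : ContraField n M} {gN : PseudoRiemannianMetric m N}
  {KN : ContraField m N}

theorem Intertwines.congr {x : M} {z z' : N} {A : Tan n x →L[ℝ] Tan m z}
    {A' : Tan n x →L[ℝ] Tan m z'} (h : Intertwines g K gN KN A) (hz : z' = z)
    (hA : ∀ v, (A' v : EuclideanSpace ℝ (Fin m)) = A v) : Intertwines g K gN KN A' := by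
  subst hz
  rwa [show A' = A from ContinuousLinearMap.ext hA]

theorem hasIntegrableEigenspaces_of_intertwines_comp {f : B × F → N}
    (hl : IsLocalDiffeomorph ((𝓡 b).prod (𝓡 k)) (𝓡 n) ∞ Φ) (hK : HasIntegrableEigenspaces g K)
    (hf : ContMDiff ((𝓡 b).prod (𝓡 k)) (𝓡 m) ∞ f) (hfs : Function.Surjective f)
    (hsurj : ∀ p, Function.Surjective ((mfderiv ((𝓡 b).prod (𝓡 k)) (𝓡 m) f p).comp
      (diffEquiv hl p).symm.toContinuousLinearMap))
    (hint : ∀ p, Intertwines g K gN KN ((mfderiv ((𝓡 b).prod (𝓡 k)) (𝓡 m) f p).comp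
      (diffEquiv hl p).symm.toContinuousLinearMap)) :
    HasIntegrableEigenspaces gN KN := by
  refine hasIntegrableEigenspaces_of_intertwines hK fun z => ?_
  obtain ⟨p, rfl⟩ := hfs z
  obtain ⟨W, π, hW, hpW, hπ, hπp, hfactor⟩ := exists_local_factor hl hf p
  have hπsurj : ∀ y ∈ W, Function.Surjective (mfderiv (𝓡 n) (𝓡 m) π y) := fun y hy u => by
    obtain ⟨q, rfl, -, hq⟩ := hfactor y hy
    obtain ⟨v, hv⟩ := hsurj q u
    exact ⟨v, (hq v).trans hv⟩
  refine ⟨W, π, Φ p, hW, hπ, hpW, hπp, hπsurj _ hpW, fun y hy => ?_⟩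
  obtain ⟨q, rfl, hπq, hq⟩ := hfactor y hy
  exact (hint q).congr hπq hq

end Intertwines

namespace IsLocalWarpedProduct

variable [IsManifold (𝓡 b) ∞ B] [IsManifold (𝓡 k) ∞ F] [T2Space M]
  {gB : PseudoRiemannianMetric b B} {gF : PseudoRiemannianMetric k F} {ρ : B → ℝ}
  {K L : SymTensor n M} {𝒦 : Submodule ℝ (SymTensor n M)}

theorem endo_toB_eq_smul_iff (hΦ : IsLocalWarpedProduct g gB gF ρ Φ)
    (hL : Splits hΦ.localDiffeo L) {x : B} {y : F} {u : Tan b x} {μ : ℝ} :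
    endo gB (toB hΦ.localDiffeo y L).1 x u = μ • u ↔
      endo g L.1 (Φ (x, y)) (inclB Φ (x, y) u) = μ • inclB Φ (x, y) u := by
  have hinj : Function.Injective (inclB Φ (x, y)) :=
    Function.LeftInverse.injective (projB_inclB hΦ.localDiffeo (x, y))
  rw [hΦ.endo_inclB hL, ← map_smul]
  exact hinj.eq_iff.symm

theorem endo_toF_eq_smul_iff (hΦ : IsLocalWarpedProduct g gB gF ρ Φ)
    (hL : Splits hΦ.localDiffeo L) {x : B} {y : F} {w : Tan k y} {μ : ℝ} :
    endo gF (toF hΦ.localDiffeo x L).1 y w = μ • w ↔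
      endo g L.1 (Φ (x, y)) (inclF Φ (x, y) w) = (ρ x ^ 2 * μ) • inclF Φ (x, y) w := by
  have hinj : Function.Injective (inclF Φ (x, y)) :=
    Function.LeftInverse.injective (projF_inclF hΦ.localDiffeo (x, y))
  rw [hΦ.endo_inclF hL, mul_smul, ← map_smul _ μ]
  exact ((smul_right_injective _ (hΦ.warp_sq_ne_zero x)).eq_iff.trans hinj.eq_iff).symm

theorem toB_mem_killingSpace (hΦ : IsLocalWarpedProduct g gB gF ρ Φ)
    (hK : Splits hΦ.localDiffeo K) (hL : Splits hΦ.localDiffeo L) (hLK : L ∈ killingSpace g K)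
    (y : F) : toB hΦ.localDiffeo y L ∈ killingSpace gB (toB hΦ.localDiffeo y K) := by
  refine ⟨hΦ.isKilling_toB hL hLK.1 y, fun x u μ hu => ?_⟩
  obtain ⟨ν, hν⟩ := hLK.2 _ _ _ ((hΦ.endo_toB_eq_smul_iff hK).1 hu)
  exact ⟨ν, (hΦ.endo_toB_eq_smul_iff hL).2 hν⟩

theorem toF_mem_killingSpace (hΦ : IsLocalWarpedProduct g gB gF ρ Φ)
    (hK : Splits hΦ.localDiffeo K) (hL : Splits hΦ.localDiffeo L) (hLK : L ∈ killingSpace g K)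
    (x : B) : toF hΦ.localDiffeo x L ∈ killingSpace gF (toF hΦ.localDiffeo x K) := by
  refine ⟨hΦ.isKilling_toF hL hLK.1 x, fun y w μ hw => ?_⟩
  obtain ⟨ν, hν⟩ := hLK.2 _ _ _ ((hΦ.endo_toF_eq_smul_iff hK).1 hw)
  refine ⟨(ρ x ^ 2)⁻¹ * ν, (hΦ.endo_toF_eq_smul_iff hL).2 ?_⟩
  rw [hν, mul_inv_cancel_left₀ (hΦ.warp_sq_ne_zero x)]

variable [T2Space B] [T2Space F] [PreconnectedSpace F]

theorem intertwines_projB (hΦ : IsLocalWarpedProduct g gB gF ρ Φ)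
    (hL : Splits hΦ.localDiffeo L) (hkilling : IsKilling g L) (y₀ : F) (p : B × F) :
    Intertwines g L.1 gB (toB hΦ.localDiffeo y₀ L).1 (projB hΦ.localDiffeo p) := by
  refine ⟨1, 0, one_ne_zero, fun v => ?_⟩
  rw [one_smul, zero_smul, add_zero, hΦ.projB_endo hL]
  exact LinearMap.congr_fun (hΦ.compB_eq_compB hL hkilling p.1 y₀ p.2) _

theorem isCharacteristic_toB (hΦ : IsLocalWarpedProduct g gB gF ρ Φ)
    (hK : IsCharacteristic g K) (hsplits : Splits hΦ.localDiffeo K) (y₀ : F) :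
    IsCharacteristic gB (toB hΦ.localDiffeo y₀ K) where
  killing := hΦ.isKilling_toB hsplits hK.killing y₀
  simple x := (hK.simple (Φ (x, y₀))).of_intertwines (projB_surjective hΦ.localDiffeo (x, y₀))
    (hΦ.intertwines_projB hsplits hK.killing y₀ (x, y₀))
  integrable := hasIntegrableEigenspaces_of_intertwines_comp hΦ.localDiffeo hK.integrable
    contMDiff_fst (fun x => ⟨(x, y₀), rfl⟩) (projB_surjective hΦ.localDiffeo)
    (hΦ.intertwines_projB hsplits hK.killing y₀)

variable [PreconnectedSpace B]

theorem intertwines_projF (hΦ : IsLocalWarpedProduct g gB gF ρ Φ) (hk : 0 < k)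
    (hL : Splits hΦ.localDiffeo L) (hkilling : IsKilling g L) (x₀ : B) (p : B × F) :
    Intertwines g L.1 gF (toF hΦ.localDiffeo x₀ L).1 (projF hΦ.localDiffeo p) := by
  obtain ⟨l, -, -, hcomp, -⟩ := hΦ.exists_compF_eq_add hk hL hkilling x₀ p.2
  refine ⟨(ρ p.1 ^ 2)⁻¹, -l p.1, inv_ne_zero (hΦ.warp_sq_ne_zero p.1), fun v => ?_⟩
  have hcontra : gF.contra p.2 (gF.flat p.2 (projF hΦ.localDiffeo p v)) =
      projF hΦ.localDiffeo p v := (gF.flat p.2).symm_apply_apply _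
  have hcompF : compF hΦ.localDiffeo L.1 p (gF.flat p.2 (projF hΦ.localDiffeo p v)) =
      l p.1 • projF hΦ.localDiffeo p v +
        endo gF (toF hΦ.localDiffeo x₀ L).1 p.2 (projF hΦ.localDiffeo p v) := by
    rw [show compF hΦ.localDiffeo L.1 p = _ from hcomp p.1 p.2, LinearMap.add_apply,
      LinearMap.smul_apply, hcontra]
    rfl
  rw [map_add, map_smul, map_smul, hΦ.projF_endo hL, inv_smul_smul₀ (hΦ.warp_sq_ne_zero p.1),
    hcompF, neg_smul]
  abel

theorem isCharacteristic_toF (hΦ : IsLocalWarpedProduct g gB gF ρ Φ) (hk : 0 < k)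
    (hK : IsCharacteristic g K) (hsplits : Splits hΦ.localDiffeo K) (x₀ : B) :
    IsCharacteristic gF (toF hΦ.localDiffeo x₀ K) where
  killing := hΦ.isKilling_toF hsplits hK.killing x₀
  simple y := (hK.simple (Φ (x₀, y))).of_intertwines (projF_surjective hΦ.localDiffeo (x₀, y))
    (hΦ.intertwines_projF hk hsplits hK.killing x₀ (x₀, y))
  integrable := hasIntegrableEigenspaces_of_intertwines_comp hΦ.localDiffeo hK.integrable
    contMDiff_snd (fun y => ⟨(x₀, y), rfl⟩) (projF_surjective hΦ.localDiffeo)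
    (hΦ.intertwines_projF hk hsplits hK.killing x₀)

variable [PreconnectedSpace M]

theorem isKSSpace_killingSpace_toB (hΦ : IsLocalWarpedProduct g gB gF ρ Φ)
    (hK : IsCharacteristic g K) (hsplits : Splits hΦ.localDiffeo K) (h𝒦 : IsKSSpaceOf g K 𝒦)
    (x₀ : B) (y₀ : F) : IsKSSpace gB (killingSpace gB (toB hΦ.localDiffeo y₀ K)) := by
  have hKB := hΦ.isCharacteristic_toB hK hsplits y₀
  refine ⟨_, hKB, isKSSpaceOf_killingSpace hKB (x := x₀) fun c => ?_⟩
  obtain ⟨L, hL, hLc⟩ := h𝒦.exists_endo_eq hK (Φ (x₀, y₀)) c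
  have hLs := hΦ.splits_of_isDiagonalFor hK.simple hsplits (h𝒦.diagonal L hL)
  exact ⟨_, hΦ.toB_mem_killingSpace hsplits hLs (h𝒦.le_killingSpace hL) y₀, fun u μ hu =>
    (hΦ.endo_toB_eq_smul_iff hLs).2 (hLc _ _ ((hΦ.endo_toB_eq_smul_iff hsplits).1 hu))⟩

theorem isKSSpace_killingSpace_toF (hΦ : IsLocalWarpedProduct g gB gF ρ Φ) (hk : 0 < k)
    (hK : IsCharacteristic g K) (hsplits : Splits hΦ.localDiffeo K) (h𝒦 : IsKSSpaceOf g K 𝒦)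
    (x₀ : B) (y₀ : F) : IsKSSpace gF (killingSpace gF (toF hΦ.localDiffeo x₀ K)) := by
  have hKF := hΦ.isCharacteristic_toF hk hK hsplits x₀
  refine ⟨_, hKF, isKSSpaceOf_killingSpace hKF (x := y₀) fun c => ?_⟩
  obtain ⟨L, hL, hLc⟩ := h𝒦.exists_endo_eq hK (Φ (x₀, y₀))
    (fun s => ρ x₀ ^ 2 * c ((ρ x₀ ^ 2)⁻¹ * s))
  have hLs := hΦ.splits_of_isDiagonalFor hK.simple hsplits (h𝒦.diagonal L hL)
  refine ⟨_, hΦ.toF_mem_killingSpace hsplits hLs (h𝒦.le_killingSpace hL) x₀, fun w μ hw =>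
    (hΦ.endo_toF_eq_smul_iff hLs).2 ?_⟩
  rw [hLc _ _ ((hΦ.endo_toF_eq_smul_iff hsplits).1 hw),
    inv_mul_cancel_left₀ (hΦ.warp_sq_ne_zero x₀)]

end IsLocalWarpedProduct

end Factors

/-! ### Assembling Killing tensors of the factors -/

section Assemble

variable {n b k : ℕ}
  {M : Type*} [TopologicalSpace M] [ChartedSpace (EuclideanSpace ℝ (Fin n)) M]
  {B : Type*} [TopologicalSpace B] [ChartedSpace (EuclideanSpace ℝ (Fin b)) B]
  {F : Type*} [TopologicalSpace F] [ChartedSpace (EuclideanSpace ℝ (Fin k)) F]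
  [IsManifold (𝓡 k) ∞ F] {gF : PseudoRiemannianMetric k F} {Φ : B × F → M}

/-- The value at `Φ (x, y)` of the tensor `A + c G_F + C`, where `A` is lifted from the base and
`G_F`, `C` are lifted from the fiber. -/
def assemble (gF : PseudoRiemannianMetric k F) (Φ : B × F → M) (x : B) (y : F)
    (A : Cotan b x →ₗ[ℝ] Tan b x) (c : ℝ) (C : Cotan k y →ₗ[ℝ] Tan k y) :
    Cotan n (Φ (x, y)) →ₗ[ℝ] Tan n (Φ (x, y)) :=
  push (fun x' => Φ (x', y)) x A + c • push (fun y' => Φ (x, y')) y (gF.contra y) +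
    push (fun y' => Φ (x, y')) y C

section Pointwise

variable {x : B} {y : F} {A : Cotan b x →ₗ[ℝ] Tan b x} {c : ℝ} {C : Cotan k y →ₗ[ℝ] Tan k y}

theorem assemble_apply (α : Cotan n (Φ (x, y))) :
    assemble gF Φ x y A c C α = inclB Φ (x, y) (A (α.comp (inclB Φ (x, y)))) +
      inclF Φ (x, y) ((c • gF.contra y + C) (α.comp (inclF Φ (x, y)))) := by
  rw [LinearMap.add_apply, LinearMap.smul_apply, map_add, map_smul, ← add_assoc]
  rfl

theorem Splits.eq_assemble {hl : IsLocalDiffeomorph ((𝓡 b).prod (𝓡 k)) (𝓡 n) ∞ Φ}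
    {L : SymTensor n M} (hL : Splits hl L) (hA : compB hl L.1 (x, y) = A)
    (hC : compF hl L.1 (x, y) = c • gF.contra y + C) :
    L.1 (Φ (x, y)) = assemble gF Φ x y A c C :=
  LinearMap.ext fun α => by rw [hL.apply_eq, assemble_apply, ← hC, ← hA]

theorem compB_of_eq_assemble (hl : IsLocalDiffeomorph ((𝓡 b).prod (𝓡 k)) (𝓡 n) ∞ Φ)
    {L : ContraField n M} (hL : L (Φ (x, y)) = assemble gF Φ x y A c C) :
    compB hl L (x, y) = A := by
  refine LinearMap.ext fun α => ?_
  have hB : (α.comp (projB hl (x, y))).comp (inclB Φ (x, y)) = α :=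
    ContinuousLinearMap.ext fun u => congrArg α (projB_inclB hl (x, y) u)
  have hF : (α.comp (projB hl (x, y))).comp (inclF Φ (x, y)) = 0 :=
    ContinuousLinearMap.ext fun w => (congrArg α (projB_inclF hl (x, y) w)).trans (map_zero α)
  rw [compB_apply, hL, assemble_apply, hB, hF, map_zero, map_zero, add_zero, projB_inclB]

theorem compF_of_eq_assemble (hl : IsLocalDiffeomorph ((𝓡 b).prod (𝓡 k)) (𝓡 n) ∞ Φ)
    {L : ContraField n M} (hL : L (Φ (x, y)) = assemble gF Φ x y A c C) :
    compF hl L (x, y) = c • gF.contra y + C := by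
  refine LinearMap.ext fun β => ?_
  have hB : (β.comp (projF hl (x, y))).comp (inclB Φ (x, y)) = 0 :=
    ContinuousLinearMap.ext fun u => (congrArg β (projF_inclB hl (x, y) u)).trans (map_zero β)
  have hF : (β.comp (projF hl (x, y))).comp (inclF Φ (x, y)) = β :=
    ContinuousLinearMap.ext fun w => congrArg β (projF_inclF hl (x, y) w)
  rw [compF_apply, hL, assemble_apply, hB, hF, map_zero, map_zero, zero_add, projF_inclF]

end Pointwise

namespace IsLocalWarpedProduct

variable [IsManifold (𝓡 n) ∞ M] [IsManifold (𝓡 b) ∞ B] {g : PseudoRiemannianMetric n M}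
  {gB : PseudoRiemannianMetric b B} {ρ : B → ℝ} {K : SymTensor n M}

theorem flat_comp_inclB (hΦ : IsLocalWarpedProduct g gB gF ρ Φ) (p : B × F) (v : Tan n (Φ p)) :
    (g.flat (Φ p) v).comp (inclB Φ p) = gB.flat p.1 (projB hΦ.localDiffeo p v) := by
  ext u
  simp [hΦ.flat_eq]

theorem flat_comp_inclF (hΦ : IsLocalWarpedProduct g gB gF ρ Φ) (p : B × F) (v : Tan n (Φ p)) :
    (g.flat (Φ p) v).comp (inclF Φ p) =
      ρ p.1 ^ 2 • gF.flat p.2 (projF hΦ.localDiffeo p v) := by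
  ext w
  simp [hΦ.flat_eq]

theorem assemble_flat (hΦ : IsLocalWarpedProduct g gB gF ρ Φ) {x : B} {y : F}
    (A : Cotan b x →ₗ[ℝ] Tan b x) (c : ℝ) (C : Cotan k y →ₗ[ℝ] Tan k y) (v : Tan n (Φ (x, y))) :
    assemble gF Φ x y A c C (g.flat (Φ (x, y)) v) =
      inclB Φ (x, y) (A (gB.flat x (projB hΦ.localDiffeo (x, y) v))) +
      ρ x ^ 2 • inclF Φ (x, y) (c • projF hΦ.localDiffeo (x, y) v +
        C (gF.flat y (projF hΦ.localDiffeo (x, y) v))) := by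
  have hcontra : gF.contra y (gF.flat y (projF hΦ.localDiffeo (x, y) v)) =
      projF hΦ.localDiffeo (x, y) v := (gF.flat y).symm_apply_apply _
  rw [assemble_apply, hΦ.flat_comp_inclB, hΦ.flat_comp_inclF, map_smul, map_smul,
    LinearMap.add_apply, LinearMap.smul_apply, hcontra]

variable [T2Space M]

theorem exists_assemble_flat_eq_smul (hΦ : IsLocalWarpedProduct g gB gF ρ Φ)
    (hsimple : ∀ x : M, HasSimpleEigenvalues g K.1 x) (hsplits : Splits hΦ.localDiffeo K)
    {x : B} {y : F} {LB : ContraField b B} {LF : ContraField k F}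
    (hLB : IsDiagonalFor gB (toB hΦ.localDiffeo y K).1 LB)
    (hLF : IsDiagonalFor gF (toF hΦ.localDiffeo x K).1 LF) (c : ℝ) {v : Tan n (Φ (x, y))} {μ : ℝ}
    (hv : endo g K.1 (Φ (x, y)) v = μ • v) :
    ∃ ν : ℝ, assemble gF Φ x y (LB x) c (LF y) (g.flat (Φ (x, y)) v) = ν • v := by
  have hsum := inclB_projB_add_inclF_projF hΦ.localDiffeo (x, y) v
  rw [hΦ.assemble_flat]
  rcases hΦ.projB_eq_zero_or_projF_eq_zero hsimple hsplits hv with hB | hF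
  · rw [hB, map_zero, zero_add] at hsum
    obtain ⟨ν, hν⟩ : ∃ ν : ℝ, LF y (gF.flat y (projF hΦ.localDiffeo (x, y) v)) =
        ν • projF hΦ.localDiffeo (x, y) v :=
      hLF y _ ((ρ x ^ 2)⁻¹ * μ) ((hΦ.endo_toF_eq_smul_iff hsplits).2 (by
        rw [hsum, hv, mul_inv_cancel_left₀ (hΦ.warp_sq_ne_zero x)]))
    refine ⟨ρ x ^ 2 * (c + ν), ?_⟩
    rw [hB, hν, ← add_smul, map_smul, hsum, map_zero, map_zero, map_zero, zero_add, smul_smul]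
  · rw [hF, map_zero, add_zero] at hsum
    obtain ⟨ν, hν⟩ : ∃ ν : ℝ, LB x (gB.flat x (projB hΦ.localDiffeo (x, y) v)) =
        ν • projB hΦ.localDiffeo (x, y) v :=
      hLB x _ μ ((hΦ.endo_toB_eq_smul_iff hsplits).2 (by rw [hsum, hv]))
    refine ⟨ν, ?_⟩
    rw [hF, hν, map_smul, hsum, map_zero, map_zero, smul_zero, add_zero, map_zero, smul_zero,
      add_zero]

variable [PreconnectedSpace M] {𝒦 : Submodule ℝ (SymTensor n M)}

theorem exists_mem_eq_assemble_at (hΦ : IsLocalWarpedProduct g gB gF ρ Φ)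
    (hK : IsCharacteristic g K) (hsplits : Splits hΦ.localDiffeo K) (h𝒦 : IsKSSpaceOf g K 𝒦)
    {x : B} {y : F} {LB : ContraField b B} {LF : ContraField k F}
    (hLB : IsDiagonalFor gB (toB hΦ.localDiffeo y K).1 LB)
    (hLF : IsDiagonalFor gF (toF hΦ.localDiffeo x K).1 LF) (c : ℝ) :
    ∃ L ∈ 𝒦, L.1 (Φ (x, y)) = assemble gF Φ x y (LB x) c (LF y) := by
  obtain ⟨L, hL, hendo⟩ := h𝒦.exists_endo_eq_of_diagonal hK (Φ (x, y))
    (assemble gF Φ x y (LB x) c (LF y) ∘ₗ (g.flat (Φ (x, y))).toLinearMap)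
    fun _ _ hv => hΦ.exists_assemble_flat_eq_smul hK.simple hsplits hLB hLF c hv
  refine ⟨L, hL, LinearMap.ext fun α => ?_⟩
  obtain ⟨v, rfl⟩ := (g.flat (Φ (x, y))).surjective α
  exact LinearMap.congr_fun hendo v

variable [T2Space B] [PreconnectedSpace B] [T2Space F] [PreconnectedSpace F]

theorem exists_mem_eq_assemble (hΦ : IsLocalWarpedProduct g gB gF ρ Φ) (hk : 0 < k)
    (hK : IsCharacteristic g K) (hsplits : Splits hΦ.localDiffeo K) (h𝒦 : IsKSSpaceOf g K 𝒦)
    {x₀ : B} {y₀ : F} {LB : SymTensor b B}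
    (hLB : LB ∈ killingSpace gB (toB hΦ.localDiffeo y₀ K)) {LF : SymTensor k F}
    (hLF : LF ∈ killingSpace gF (toF hΦ.localDiffeo x₀ K)) {l : B → ℝ} (hl : SmoothFn b l)
    (hdl : ∀ x : B, mvfderiv (𝓡 b) l x =
      gB.flat x (LB.1 x (mvfderiv (𝓡 b) (fun x' => (ρ x' ^ 2)⁻¹) x))) :
    ∃ L ∈ 𝒦, ∀ x y, L.1 (Φ (x, y)) = assemble gF Φ x y (LB.1 x) (l x) (LF.1 y) := by
  obtain ⟨L, hL, hLx₀⟩ := hΦ.exists_mem_eq_assemble_at hK hsplits h𝒦 hLB.2 hLF.2 (l x₀)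
  have hLs := hΦ.splits_of_isDiagonalFor hK.simple hsplits (h𝒦.diagonal L hL)
  have hkilling := h𝒦.killing L hL
  have hbase : toB hΦ.localDiffeo y₀ L = LB :=
    eq_of_apply_eq (hΦ.isCharacteristic_toB hK hsplits y₀)
      (hΦ.toB_mem_killingSpace hsplits hLs (h𝒦.le_killingSpace hL) y₀) hLB
      (compB_of_eq_assemble hΦ.localDiffeo hLx₀)
  have hfiber : toF hΦ.localDiffeo x₀ L = l x₀ • gF.contraTensor + LF :=
    eq_of_apply_eq (hΦ.isCharacteristic_toF hk hK hsplits x₀)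
      (hΦ.toF_mem_killingSpace hsplits hLs (h𝒦.le_killingSpace hL) x₀)
      (Submodule.add_mem _ (Submodule.smul_mem _ _ (contraTensor_mem_killingSpace gF _)) hLF)
      (compF_of_eq_assemble hΦ.localDiffeo hLx₀)
  obtain ⟨l', hl', hl'x₀, hcomp, hdl'⟩ := hΦ.exists_compF_eq_add hk hLs hkilling x₀ y₀
  have hshift (x : B) : l x = l' x + l x₀ := by
    have hconst := eq_of_mvfderiv_eq_zero (f := l - l')
      (fun z => (hl.mdifferentiableAt z).sub (hl'.mdifferentiableAt z)) (fun z => by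
        rw [mvfderiv_sub (hl.mdifferentiableAt z) (hl'.mdifferentiableAt z), hdl, hdl', hbase,
          sub_self]) x x₀
    simp only [Pi.sub_apply, hl'x₀] at hconst
    linarith
  refine ⟨L, hL, fun x y => hLs.eq_assemble ?_ ?_⟩
  · rw [← hbase]
    exact hΦ.compB_eq_compB hLs hkilling x y y₀
  · have hcompF : compF hΦ.localDiffeo L.1 (x₀, y) = l x₀ • gF.contra y + LF.1 y :=
      congrFun (congrArg Subtype.val hfiber) y
    rw [hcomp, hcompF, hshift x, add_smul, add_assoc]

end IsLocalWarpedProduct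

end Assemble

end KillingStackel

end

open KillingStackel in
theorem mainTheorem3_general {n b k : ℕ}
    {M : Type*} [TopologicalSpace M] [ChartedSpace (EuclideanSpace ℝ (Fin n)) M]
    [IsManifold (𝓡 n) ∞ M] [T2Space M] [PreconnectedSpace M]
    {B : Type*} [TopologicalSpace B] [ChartedSpace (EuclideanSpace ℝ (Fin b)) B]
    [IsManifold (𝓡 b) ∞ B] [T2Space B] [ConnectedSpace B]
    {F : Type*} [TopologicalSpace F] [ChartedSpace (EuclideanSpace ℝ (Fin k)) F]
    [IsManifold (𝓡 k) ∞ F] [T2Space F] [ConnectedSpace F] (hk : 0 < k)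
    {g : PseudoRiemannianMetric n M} {K : SymTensor n M} (hK : IsCharacteristic g K)
    {𝒦 : Submodule ℝ (SymTensor n M)} (h𝒦 : IsKSSpaceOf g K 𝒦)
    {gB : PseudoRiemannianMetric b B} {gF : PseudoRiemannianMetric k F} {ρ : B → ℝ}
    {Φ : B × F → M} (hΦ : IsLocalWarpedProduct g gB gF ρ Φ)
    (hfiber : ∀ (p : B × F) (w : Tan k p.2), ∃ w' : Tan k p.2,
      endo g K.1 (Φ p) (inclF Φ p w) = inclF Φ p w') :
    ∃ (𝒦B : Submodule ℝ (SymTensor b B)) (𝒦F : Submodule ℝ (SymTensor k F)),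
      IsKSSpace gB 𝒦B ∧ IsKSSpace gF 𝒦F ∧
      ∀ L : ∀ p : B × F, Cotan n (Φ p) →ₗ[ℝ] Tan n (Φ p),
        (∃ L' ∈ 𝒦, ∀ p, L p = L'.1 (Φ p)) ↔
        ∃ LB ∈ 𝒦B, ∃ LF ∈ 𝒦F, ∃ l : B → ℝ, SmoothFn b l ∧
          (∀ (x : B) (y : F), L (x, y) = assemble gF Φ x y (LB.1 x) (l x) (LF.1 y)) ∧
          (∀ x : B, mvfderiv (𝓡 b) l x =
            gB.flat x (LB.1 x (mvfderiv (𝓡 b) (fun x' => (ρ x' ^ 2)⁻¹) x))) := by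
  obtain ⟨x₀⟩ : Nonempty B := inferInstance
  obtain ⟨y₀⟩ : Nonempty F := inferInstance
  have hsplits := hΦ.splits_of_exists_endo_inclF_eq hfiber
  refine ⟨killingSpace gB (toB hΦ.localDiffeo y₀ K), killingSpace gF (toF hΦ.localDiffeo x₀ K),
    hΦ.isKSSpace_killingSpace_toB hK hsplits h𝒦 x₀ y₀,
    hΦ.isKSSpace_killingSpace_toF hk hK hsplits h𝒦 x₀ y₀, fun L => ⟨?_, ?_⟩⟩
  · rintro ⟨L', hL', hL⟩
    have hL's := hΦ.splits_of_isDiagonalFor hK.simple hsplits (h𝒦.diagonal L' hL')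
    have hkilling := h𝒦.killing L' hL'
    have hmem := h𝒦.le_killingSpace hL'
    obtain ⟨l, hl, -, hcomp, hdl⟩ := hΦ.exists_compF_eq_add hk hL's hkilling x₀ y₀
    exact ⟨_, hΦ.toB_mem_killingSpace hsplits hL's hmem y₀, _,
      hΦ.toF_mem_killingSpace hsplits hL's hmem x₀, l, hl, fun x y => (hL (x, y)).trans
        (hL's.eq_assemble (hΦ.compB_eq_compB hL's hkilling x y y₀) (hcomp x y)), hdl⟩
  · rintro ⟨LB, hLB, LF, hLF, l, hl, hL, hdl⟩
    obtain ⟨L', hL', hL'eq⟩ := hΦ.exists_mem_eq_assemble hk hK hsplits h𝒦 hLB hLF hl hdl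
    exact ⟨L', hL', fun p => (hL p.1 p.2).trans (hL'eq p.1 p.2).symm⟩

theorem mainTheorem3 {n b k : ℕ}
    {M : Type*} [TopologicalSpace M] [ChartedSpace (EuclideanSpace ℝ (Fin n)) M]
    [IsManifold (𝓡 n) ∞ M] [T2Space M] [ConnectedSpace M]
    {B : Type*} [TopologicalSpace B] [ChartedSpace (EuclideanSpace ℝ (Fin b)) B]
    [IsManifold (𝓡 b) ∞ B] [T2Space B] [ConnectedSpace B]
    {F : Type*} [TopologicalSpace F] [ChartedSpace (EuclideanSpace ℝ (Fin k)) F]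
    [IsManifold (𝓡 k) ∞ F] [T2Space F] [ConnectedSpace F]
    (g : KillingStackel.PseudoRiemannianMetric n M)
    (K : KillingStackel.SymTensor n M)
    (hK : KillingStackel.IsCharacteristic g K)
    (𝒦 : Submodule ℝ (KillingStackel.SymTensor n M))
    (h𝒦 : KillingStackel.IsKSSpaceOf g K 𝒦)
    (D : ∀ x : M, Submodule ℝ (KillingStackel.Tan n x))
    (hD : KillingStackel.IsKillingDistribution g D)
    (hKD : KillingStackel.IsInvariant g K D)
    (gB : KillingStackel.PseudoRiemannianMetric b B)
    (gF : KillingStackel.PseudoRiemannianMetric k F)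
    (ρ : B → ℝ) (Φ : B × F → M)
    (hΦ : KillingStackel.IsAdaptedWarpedProduct g D gB gF ρ Φ) :
    ∃ (𝒦B : Submodule ℝ (KillingStackel.SymTensor b B))
      (𝒦F : Submodule ℝ (KillingStackel.SymTensor k F)),
      KillingStackel.IsKSSpace gB 𝒦B ∧ KillingStackel.IsKSSpace gF 𝒦F ∧
      -- `L` is an arbitrary contravariant 2-tensor field on the open set `Φ (B × F)` of `M`
      ∀ L : ∀ p : B × F, KillingStackel.Cotan n (Φ p) →ₗ[ℝ] KillingStackel.Tan n (Φ p),
        (∃ L' ∈ 𝒦, ∀ p, L p = L'.1 (Φ p)) ↔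
        ∃ LB ∈ 𝒦B, ∃ LF ∈ 𝒦F, ∃ l : B → ℝ, KillingStackel.SmoothFn b l ∧
          (∀ (x : B) (y : F), L (x, y) =
            KillingStackel.push (fun x' => Φ (x', y)) x (LB.1 x) +
            l x • KillingStackel.push (fun y' => Φ (x, y')) y (gF.contra y) +
            KillingStackel.push (fun y' => Φ (x, y')) y (LF.1 y)) ∧
          (∀ x : B, mvfderiv (𝓡 b) l x =
            gB.flat x (LB.1 x (mvfderiv (𝓡 b) (fun x' => (ρ x' ^ 2)⁻¹) x))) := by
  exact mainTheorem3_general hΦ.dim_pos hK h𝒦 hΦ.isLocalWarpedProduct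
    (hΦ.exists_endo_inclF_eq hKD)
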